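/- Let $n\ge 0$ and let $k$ be a field of characteristic different from $2$ in which $n!\neq 0$ (i.e. the characteristic is $0$ or greater than $n$). For a permutation $\sigma\in S_n$ put $\sigma(0)=0$ and $\mathrm{Peak}(\sigma)=\{i\in\{1,\dots,n-1\}:\sigma(i-1)<\sigma(i)>\sigma(i+1)\}$. For a signed permutation $w\in B_n=S_n\ltimes\mathbb Z_2^n$ put $w(0)=0$ and $\mathrm{Des}(w)=\{i\in\{0,\dots,n-1\}: w(i)>w(i+1)\}$. A set of integers is sparse if it contains no two consecutive integers. For $J\subseteq\{0,\dots,n-1\}$ let $X_J=\sum_{\mathrm{Des}(w)\subseteq J}w\in kB_n$; for sparse $F\subseteq\{1,\dots,n-1\}$ let $P_F=\sum_{\mathrm{Peak}(\sigma)=F}\sigma\in kS_n$. The linear span of the elements $X_J$ is a unital subalgebra of $kB_n$, the descent algebra $\mathrm{Sol}(B_n)$, and the linear span of the elements $P_F$ is a unital subalgebra of $kS_n$, the peak algebra $\mathfrak P_n$; the $X_J$, respectively the $P_F$, are linear bases. For a pseudocomposition $(b_0,b_1,\dots,b_m)$ of $n$ (integers with $b_0\ge 0$, $b_r\ge 1$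 for $r\geq 1$, and sum $n$) write $X_{(b_0,\dots,b_m)}=X_J$ with $J=\{b_0,\,b_0+b_1,\,\dots,\,b_0+\cdots+b_{m-1}\}$. Let $\beta:\mathrm{Sol}(B_n)\to\mathrm{Sol}(B_{n-1})$ be the linear map with $X_{(b_0,b_1,\dots,b_m)}\mapsto X_{(b_0-1,b_1,\dots,b_m)}$ if $b_0\ne 0$ and $\mapsto 0$ if $b_0=0$ (and $\beta=0$ on $\mathrm{Sol}(B_0)$). Let $\pi:\mathfrak P_n\to\mathfrak P_{n-2}$ ($n\geq 2$) be the linear map with $P_F\mapsto -P_{(F\setminus\{1\})-2}$ if $1\in F$, $P_F\mapsto 0$ if $2\in F$, and $P_F\mapsto P_{F-2}$ if $1,2\notin F$ (and $\pi=0$ on $\mathfrak P_0$ and $\mathfrak P_1$). Put $$\mathfrak I_n^i=\ker(\beta^{i+1})\subseteq\mathrm{Sol}(B_n)\quad(0\le i\le n),\qquad \mathfrak P_n^j=\ker(\pi^{j+1})\subseteq\mathfrak P_n\quad(0\le j\le\lfloor n/2\rfloor).$$ Let $\mathrm{rad}$ denote the Jacobson radical, $p(m)$ the number of partitions of $m$,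 and $p_o(m)$ the number of partitions of $m$ into odd parts. Then for every $i=0,\dots,n$ $$\dim\frac{\mathfrak I_n^i}{\mathrm{rad}(\mathrm{Sol}(B_n))\cap\mathfrak I_n^i}=p(n)+p(n-1)+\cdots+p(n-i),$$ and for every $j=0,\dots,\lfloor n/2\rfloor$ $$\dim\frac{\mathfrak P_n^j}{\mathrm{rad}(\mathfrak P_n)\cap\mathfrak P_n^j}=p_o(n)+p_o(n-2)+\cdots+p_o(n-2j).$$ -/

import Mathlib

open scoped BigOperators

noncomputable section

namespace PeakAlgebra

/-! ### Signed permutations and their descents -/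

/-- The group `B_n = S_n ⋉ ℤ₂ⁿ` of signed permutations. The element `w = (ε, σ)` is the signed
permutation `i ↦ ε (σ i) · σ i`; with this reading the product of the semidirect product,
in which `S_n` permutes the coordinates, is composition of signed permutations
(see `SignedPerm.apply_mul`). -/
abbrev SignedPerm (n : ℕ) : Type :=
  (Fin n → ℤˣ) ⋊[mulAutArrow] (Equiv.Perm (Fin n))

instance (n : ℕ) : Fintype (SignedPerm n) :=
  Fintype.ofEquiv _ SemidirectProduct.equivProd.symm

instance (n : ℕ) : DecidableEq (SignedPerm n) := Classical.decEq _

/-- The value `w(i) ∈ {±1, …, ±n}` of a signed permutation at `i ∈ [n]`, with the convention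
`w(0) = 0`. (Positions and values in `[n]` are one more than the elements of `Fin n`. The value at
`i > n` is the irrelevant `0`.) -/
def SignedPerm.apply {n : ℕ} (w : SignedPerm n) (i : ℕ) : ℤ :=
  if h : 0 < i ∧ i ≤ n then
    (w.left (w.right ⟨i - 1, by omega⟩) : ℤ) * (((w.right ⟨i - 1, by omega⟩ : Fin n) : ℕ) + 1)
  else 0

/-- The product in `SignedPerm n` is composition, where a signed permutation is extended to
negative arguments by `w(-i) = -w(i)`. -/
theorem SignedPerm.apply_mul {n : ℕ} (v w : SignedPerm n) (i : ℕ) :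
    (v * w).apply i = (w.apply i).sign * v.apply (w.apply i).natAbs := by
  by_cases h : 0 < i ∧ i ≤ n
  · set j : Fin n := w.right ⟨i - 1, by omega⟩ with hj
    have hw : w.apply i = (w.left j : ℤ) * ((j : ℕ) + 1 : ℤ) := by
      simp only [SignedPerm.apply, dif_pos h, ← hj]
    have hpos : (0 : ℤ) < (j : ℕ) + 1 := by positivity
    have habs : (w.apply i).natAbs = (j : ℕ) + 1 := by
      rw [hw, Int.natAbs_mul, Int.units_natAbs]
      omega
    have hs : (w.apply i).sign = (w.left j : ℤ) := by
      rw [hw, Int.sign_mul, Int.sign_eq_one_of_pos hpos, mul_one]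
      rcases Int.units_eq_one_or (w.left j) with h1 | h1 <;> simp [h1]
    rw [hs, habs]
    have hj' : (0 : ℕ) < (j : ℕ) + 1 ∧ (j : ℕ) + 1 ≤ n := ⟨by omega, j.2⟩
    simp only [SignedPerm.apply, dif_pos h, dif_pos hj', SemidirectProduct.mul_left,
      SemidirectProduct.mul_right, Equiv.Perm.mul_apply, ← hj, Nat.add_sub_cancel, Fin.eta,
      Pi.mul_apply, Units.val_mul]
    have : (mulAutArrow v.right w.left) (v.right j) = w.left j := by
      change w.left (v.right⁻¹ • v.right j) = w.left j
      simp [Equiv.Perm.smul_def]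
    rw [this]
    ring
  · simp [SignedPerm.apply, h]

/-- `Des(w) = {i ∈ [0, n-1] | w(i) > w(i+1)}` for a signed permutation `w`. -/
def SignedPerm.des {n : ℕ} (w : SignedPerm n) : Finset ℕ :=
  (Finset.range n).filter fun i => w.apply (i + 1) < w.apply i

/-! ### Ordinary permutations and their peaks -/

/-- The value `σ(i) ∈ [n]` of an ordinary permutation at `i ∈ [n]`, with `σ(0) = 0`. (Positions and
values in `[n]` are one more than the elements of `Fin n`. The value at `i > n` is the irrelevant
`0`.) -/
def permApply {n : ℕ} (σ : Equiv.Perm (Fin n)) (i : ℕ) : ℕ :=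
  if h : 0 < i ∧ i ≤ n then ((σ ⟨i - 1, by omega⟩ : Fin n) : ℕ) + 1 else 0

/-- `Peak(σ) = {i ∈ [n-1] | σ(i-1) < σ(i) > σ(i+1)}`, where `σ(0) = 0`. -/
def peak {n : ℕ} (σ : Equiv.Perm (Fin n)) : Finset ℕ :=
  (Finset.Icc 1 (n - 1)).filter fun i =>
    permApply σ (i - 1) < permApply σ i ∧ permApply σ (i + 1) < permApply σ i

/-- The sparse subsets of `[n-1]`: those which contain no two consecutive integers. -/
def IsSparse (n : ℕ) (F : Finset ℕ) : Prop :=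
  F ⊆ Finset.Icc 1 (n - 1) ∧ ∀ i ∈ F, i + 1 ∉ F

section Algebras

variable (k : Type*) [Field k]

/-! ### The descent algebra of type `B` -/

/-- `X_J`, the sum of all signed permutations `w` with `Des(w) ⊆ J`, in the group algebra. -/
def descentX (n : ℕ) (J : Finset ℕ) : MonoidAlgebra k (SignedPerm n) :=
  ∑ w : SignedPerm n with w.des ⊆ J, MonoidAlgebra.of k (SignedPerm n) w

/-- The subspace of the group algebra of `B_n` spanned by the elements `X_J`, `J ⊆ [0, n-1]`. -/
def descentSpan (n : ℕ) : Submodule k (MonoidAlgebra k (SignedPerm n)) :=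
  Submodule.span k (Set.range fun J : {J : Finset ℕ // J ⊆ Finset.range n} => descentX k n J)

/-- The signed permutation `i ↦ ± i` with the minus sign exactly at those `i` with `i - 1 ∈ J`. -/
def signPerm (n : ℕ) (J : Finset ℕ) : SignedPerm n :=
  ⟨fun i => if (i : ℕ) ∈ J then -1 else 1, 1⟩

theorem signPerm_apply {n : ℕ} (J : Finset ℕ) {i : ℕ} (hi : i < n) :
    (signPerm n J).apply (i + 1) = if i ∈ J then -((i : ℤ) + 1) else (i : ℤ) + 1 := by
  have h : 0 < i + 1 ∧ i + 1 ≤ n := by omega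
  simp only [SignedPerm.apply, dif_pos h, signPerm, Equiv.Perm.coe_one, id_eq,
    Nat.add_sub_cancel]
  split_ifs <;> simp

theorem signPerm_des {n : ℕ} {J : Finset ℕ} (hJ : J ⊆ Finset.range n) :
    (signPerm n J).des = J := by
  ext i
  simp only [SignedPerm.des, Finset.mem_filter, Finset.mem_range]
  constructor
  · rintro ⟨hi, h⟩
    by_contra hiJ
    rw [signPerm_apply J hi, if_neg hiJ] at h
    rcases i with _ | i
    · simp [SignedPerm.apply] at h
    · rw [signPerm_apply J (by omega)] at h
      split_ifs at h <;> push_cast at h <;> omega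
  · intro hiJ
    have hi : i < n := Finset.mem_range.mp (hJ hiJ)
    refine ⟨hi, ?_⟩
    rw [signPerm_apply J hi, if_pos hiJ]
    rcases i with _ | i
    · simp [SignedPerm.apply]
    · rw [signPerm_apply J (by omega)]
      split_ifs <;> push_cast <;> omega

theorem descentX_coeff (n : ℕ) (J : Finset ℕ) (w : SignedPerm n) :
    (descentX k n J).coeff w = if w.des ⊆ J then 1 else 0 := by
  classical
  have : (descentX k n J).coeff w
      = ∑ v : SignedPerm n with v.des ⊆ J, (if v = w then (1 : k) else 0) := by
    simp [descentX, MonoidAlgebra.of_apply, Finsupp.single_apply]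
  rw [this, Finset.sum_ite_eq']
  simp

theorem descentX_linearIndependent (n : ℕ) :
    LinearIndependent k
      (fun J : {J : Finset ℕ // J ⊆ Finset.range n} => descentX k n J) := by
  classical
  have : Fintype {J : Finset ℕ // J ⊆ Finset.range n} :=
    Fintype.ofEquiv {J // J ∈ (Finset.range n).powerset}
      (Equiv.subtypeEquivRight fun J => Finset.mem_powerset)
  rw [Fintype.linearIndependent_iff]
  intro c hc
  have key : ∀ I : {J : Finset ℕ // J ⊆ Finset.range n},
      ∑ J, (if I.1 ⊆ J.1 then c J else 0) = 0 := by
    intro I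
    have h := congrArg (fun x => x.coeff (signPerm n I.1)) hc
    simpa [descentX_coeff, signPerm_des I.2] using h
  have main : ∀ m : ℕ, ∀ I : {J : Finset ℕ // J ⊆ Finset.range n},
      n - I.1.card = m → c I = 0 := by
    intro m
    induction m using Nat.strong_induction_on with
    | _ m ih =>
      intro I hI
      rw [← key I, Finset.sum_eq_single I]
      · simp
      · intro J _ hJI
        split_ifs with hsub
        · have hlt : I.1.card < J.1.card := Finset.card_lt_card
            (Finset.ssubset_iff_subset_ne.mpr ⟨hsub, fun h => hJI (Subtype.ext h.symm)⟩)
          have hle : J.1.card ≤ n := by simpa using Finset.card_le_card J.2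
          exact ih (n - J.1.card) (by omega) J rfl
        · rfl
      · simp
  exact fun I => main _ I rfl

/-- The basis of `descentSpan k n` formed by the elements `X_J`, `J ⊆ [0, n-1]`. -/
def descentBasis (n : ℕ) :
    Module.Basis {J : Finset ℕ // J ⊆ Finset.range n} k (descentSpan k n) :=
  Module.Basis.span (descentX_linearIndependent k n)

theorem descentX_mem {n : ℕ} {J : Finset ℕ} (hJ : J ⊆ Finset.range n) :
    descentX k n J ∈ descentSpan k n :=
  Submodule.subset_span ⟨⟨J, hJ⟩, rfl⟩

theorem shift_one_subset {n : ℕ} {J : Finset ℕ} (hJ : J ⊆ Finset.range n) (h0 : 0 ∉ J) :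
    J.image (fun i => i - 1) ⊆ Finset.range (n - 1) := by
  intro x hx
  obtain ⟨i, hi, rfl⟩ := Finset.mem_image.mp hx
  have h1 := Finset.mem_range.mp (hJ hi)
  have h2 : i ≠ 0 := fun h => h0 (h ▸ hi)
  exact Finset.mem_range.mpr (by omega)

/-- The linear map `β_n` from the span for `n` to the span for `n - 1`. Under the bijection
`(b_0, …, b_m) ↦ {b_0, b_0 + b_1, …, b_0 + ⋯ + b_{m-1}}` between pseudocompositions of `n` and
subsets `J` of `[0, n-1]`, and for `n ≥ 1`, one has `b_0 = 0` exactly when `0 ∈ J`, and otherwise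
`(b_0 - 1, b_1, …, b_m)` corresponds to `J - 1`. So `β_n` maps `X_{(b_0, …, b_m)}` to
`X_{(b_0 - 1, b_1, …, b_m)}` if `b_0 ≠ 0` and to `0` if `b_0 = 0`. The map `β_0` is zero. -/
def beta (n : ℕ) : descentSpan k n →ₗ[k] descentSpan k (n - 1) :=
  if n = 0 then 0 else
    (descentBasis k n).constr k fun J =>
      if h0 : 0 ∈ J.1 then 0
      else ⟨descentX k (n - 1) (J.1.image fun i => i - 1),
        descentX_mem k (shift_one_subset J.2 h0)⟩

/-- The `m`-fold composite `β^m`, starting on the span for `n`. -/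
def betaIter (n : ℕ) : (m : ℕ) → (descentSpan k n →ₗ[k] descentSpan k (n - m))
  | 0 => LinearMap.id
  | m + 1 => (beta k (n - m)).comp (betaIter n m)

/-- The ideal `𝔍_n^i = ker (β^{i+1})`, as a subspace of the group algebra of `B_n`. -/
def idealJ (n i : ℕ) : Submodule k (MonoidAlgebra k (SignedPerm n)) :=
  (LinearMap.ker (betaIter k n (i + 1))).map (descentSpan k n).subtype

/-! ### The peak algebra -/

/-- `P_F`, the sum of all permutations `σ ∈ S_n` with `Peak(σ) = F`, in the group algebra. -/
def peakP (n : ℕ) (F : Finset ℕ) : MonoidAlgebra k (Equiv.Perm (Fin n)) :=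
  ∑ σ : Equiv.Perm (Fin n) with peak σ = F, MonoidAlgebra.of k (Equiv.Perm (Fin n)) σ

/-- The subspace of the group algebra of `S_n` spanned by the elements `P_F`, for `F` a sparse
subset of `[n-1]`. -/
def peakSpan (n : ℕ) : Submodule k (MonoidAlgebra k (Equiv.Perm (Fin n))) :=
  Submodule.span k (Set.range fun F : {F : Finset ℕ // IsSparse n F} => peakP k n F)

/-- The involution of `Fin n` which exchanges the positions `i` and `i + 1` for each `i ∈ F`. -/
def swapFun {n : ℕ} {F : Finset ℕ} (hF : IsSparse n F) (x : Fin n) : Fin n :=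
  if h : (x : ℕ) + 1 ∈ F then ⟨x + 1, by have := Finset.mem_Icc.mp (hF.1 h); omega⟩
  else if (x : ℕ) ∈ F then ⟨x - 1, by omega⟩
  else x

theorem swapFun_val {n : ℕ} {F : Finset ℕ} (hF : IsSparse n F) (x : Fin n) :
    (swapFun hF x : ℕ) =
      if (x : ℕ) + 1 ∈ F then (x : ℕ) + 1 else if (x : ℕ) ∈ F then (x : ℕ) - 1 else x := by
  unfold swapFun
  split_ifs <;> rfl

theorem swapFun_involutive {n : ℕ} {F : Finset ℕ} (hF : IsSparse n F) :
    Function.Involutive (swapFun hF) := by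
  intro x
  apply Fin.ext
  rw [swapFun_val, swapFun_val]
  by_cases h1 : (x : ℕ) + 1 ∈ F
  · have := hF.2 _ h1
    simp [h1, this]
  · by_cases h2 : (x : ℕ) ∈ F
    · have h3 := Finset.mem_Icc.mp (hF.1 h2)
      have h4 : (x : ℕ) - 1 + 1 = x := by omega
      simp [h1, h2, h4]
    · simp [h1, h2]

theorem peak_swap {n : ℕ} {F : Finset ℕ} (hF : IsSparse n F) :
    peak (swapFun_involutive hF).toPerm = F := by
  have val : ∀ i, 0 < i → i ≤ n → permApply (swapFun_involutive hF).toPerm i =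
      if i ∈ F then i + 1 else if i - 1 ∈ F then i - 1 else i := by
    intro i h0 hn
    have h : 0 < i ∧ i ≤ n := ⟨h0, hn⟩
    have e : i - 1 + 1 = i := by omega
    simp only [permApply, dif_pos h, Function.Involutive.coe_toPerm, swapFun_val, e]
    split_ifs with h1 h2
    · rfl
    · have := (Finset.mem_Icc.mp (hF.1 h2)).1
      omega
    · exact e
  have zero : permApply (swapFun_involutive hF).toPerm 0 = 0 := by simp [permApply]
  have hz : 0 ∉ F := fun h => by simpa using (Finset.mem_Icc.mp (hF.1 h)).1
  ext i
  simp only [peak, Finset.mem_filter, Finset.mem_Icc]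
  constructor
  · rintro ⟨⟨h1, h2⟩, -, h3⟩
    by_contra hi
    rw [val i (by omega) (by omega), val (i + 1) (by omega) (by omega)] at h3
    simp only [hi, if_false, Nat.add_sub_cancel] at h3
    split_ifs at h3 <;> omega
  · intro hi
    have h1 := Finset.mem_Icc.mp (hF.1 hi)
    have h2 := hF.2 i hi
    have h3 : i - 1 ∉ F := fun h => by
      have := hF.2 _ h
      rw [Nat.sub_add_cancel h1.1] at this
      exact this hi
    refine ⟨h1, ?_, ?_⟩
    · rw [val i (by omega) (by omega), if_pos hi]
      rcases Nat.eq_zero_or_pos (i - 1) with h0 | h0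
      · rw [h0, zero]; omega
      · rw [val (i - 1) h0 (by omega), if_neg h3]
        split_ifs <;> omega
    · rw [val i (by omega) (by omega), if_pos hi, val (i + 1) (by omega) (by omega), if_neg h2]
      simp [hi]

theorem peakP_coeff (n : ℕ) (F : Finset ℕ) (σ : Equiv.Perm (Fin n)) :
    (peakP k n F).coeff σ = if peak σ = F then 1 else 0 := by
  classical
  have : (peakP k n F).coeff σ
      = ∑ τ : Equiv.Perm (Fin n) with peak τ = F, (if τ = σ then (1 : k) else 0) := by
    simp [peakP, MonoidAlgebra.of_apply, Finsupp.single_apply]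
  rw [this, Finset.sum_ite_eq']
  simp

theorem peakP_linearIndependent (n : ℕ) :
    LinearIndependent k (fun F : {F : Finset ℕ // IsSparse n F} => peakP k n F) := by
  classical
  rw [linearIndependent_iff']
  intro s c hc F hF
  have h := congrArg (fun x => x.coeff (swapFun_involutive F.2).toPerm) hc
  have h' : ∑ G ∈ s, (if F = G then c G else 0) = 0 := by
    simpa [peakP_coeff, peak_swap F.2, Subtype.ext_iff] using h
  rw [Finset.sum_ite_eq] at h'
  simpa [hF] using h'

/-- The basis of `peakSpan k n` formed by the elements `P_F`, `F` sparse. -/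
def peakBasis (n : ℕ) :
    Module.Basis {F : Finset ℕ // IsSparse n F} k (peakSpan k n) :=
  Module.Basis.span (peakP_linearIndependent k n)

theorem peakP_mem {n : ℕ} {F : Finset ℕ} (hF : IsSparse n F) : peakP k n F ∈ peakSpan k n :=
  Submodule.subset_span ⟨⟨F, hF⟩, rfl⟩

theorem isSparse_shift {n : ℕ} {F : Finset ℕ} (hF : IsSparse n F) (h2 : 2 ∉ F) :
    IsSparse (n - 2) ((F.erase 1).image fun i => i - 2) := by
  have h3 : ∀ i ∈ F.erase 1, 3 ≤ i := by
    intro i hi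
    have hi' := Finset.mem_erase.mp hi
    have := Finset.mem_Icc.mp (hF.1 hi'.2)
    have : i ≠ 2 := fun h => h2 (h ▸ hi'.2)
    omega
  constructor
  · intro x hx
    obtain ⟨i, hi, rfl⟩ := Finset.mem_image.mp hx
    have := h3 i hi
    have := Finset.mem_Icc.mp (hF.1 (Finset.mem_of_mem_erase hi))
    exact Finset.mem_Icc.mpr (by omega)
  · intro x hx hx'
    obtain ⟨i, hi, rfl⟩ := Finset.mem_image.mp hx
    obtain ⟨l, hl, hil⟩ := Finset.mem_image.mp hx'
    have := h3 i hi
    have := h3 l hl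
    have hli : l = i + 1 := by omega
    exact hF.2 i (Finset.mem_of_mem_erase hi) (hli ▸ Finset.mem_of_mem_erase hl)

/-- The linear map `π_n` from the span for `n` to the span for `n - 2`: for `n ≥ 2` it maps `P_F` to
`-P_{(F ∖ {1}) - 2}` if `1 ∈ F`, to `0` if `2 ∈ F`, and to `P_{F - 2}` if `1, 2 ∉ F` (in this last
case `F.erase 1 = F`). The maps `π_1` and `π_0` are zero. -/
def piMap (n : ℕ) : peakSpan k n →ₗ[k] peakSpan k (n - 2) :=
  if n < 2 then 0 else
    (peakBasis k n).constr k fun F =>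
      if h2 : 2 ∈ F.1 then 0
      else (if 1 ∈ F.1 then (-1 : k) else 1) •
        ⟨peakP k (n - 2) ((F.1.erase 1).image fun i => i - 2),
          peakP_mem k (isSparse_shift F.2 h2)⟩

/-- The `m`-fold composite `π^m`, starting on the span for `n`. -/
def piIter (n : ℕ) : (m : ℕ) → (peakSpan k n →ₗ[k] peakSpan k (n - 2 * m))
  | 0 => LinearMap.id
  | m + 1 => (piMap k (n - 2 * m)).comp (piIter n m)

/-- The ideal `𝔓_n^j = ker (π^{j+1})`, as a subspace of the group algebra of `S_n`. -/
def peakIdeal (n j : ℕ) : Submodule k (MonoidAlgebra k (Equiv.Perm (Fin n))) :=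
  (LinearMap.ker (piIter k n (j + 1))).map (peakSpan k n).subtype

/-! ### Algebras and radicals -/

/-- The algebra `Sol(B_n)`, as the subalgebra generated by the span of the elements `X_J`.
(That this span is closed under multiplication, so that it is the whole algebra, is Solomon's
theorem.) -/
def solB (n : ℕ) : Subalgebra k (MonoidAlgebra k (SignedPerm n)) :=
  Algebra.adjoin k (descentSpan k n : Set (MonoidAlgebra k (SignedPerm n)))

/-- The peak algebra `𝔓_n`, as the subalgebra generated by the span of the elements `P_F`.
(That this span is closed under multiplication, so that it is the whole algebra, is a theorem.) -/
def peakAlg (n : ℕ) : Subalgebra k (MonoidAlgebra k (Equiv.Perm (Fin n))) :=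
  Algebra.adjoin k (peakSpan k n : Set (MonoidAlgebra k (Equiv.Perm (Fin n))))

/-- The Jacobson radical of a subalgebra `S` of `A`, as a subspace of `A`. -/
def rad {k A : Type*} [Field k] [Ring A] [Algebra k A] (S : Subalgebra k A) : Submodule k A :=
  ((Ring.jacobson S).restrictScalars k).map S.val.toLinearMap

end Algebras

end PeakAlgebra

end

noncomputable section

namespace PeakAlgebra

/-! ### Algebras of left regular bands -/

/-! A finite left regular band `M` has the characters `bandChar e`, and an element of `kM` killed by
all of them is nilpotent: multiplication by it pushes every `e` to elements of larger rank. If a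
group `G` acts on `M` simply transitively on chambers, then `x ↦ x * c` embeds the `G`-invariants of
`kM` anti-multiplicatively into `kG` (Bidigare's argument). The image is the descent algebra. For
the faces of the arrangements of types B and A this yields Solomon's theorem, together with
characters whose common kernel is the radical (`mem_rad_iff`).

In type B the characters are indexed by the size `z` of a zero block and the multiset `U` of the
sizes of the other blocks, with total size `n`. The value at `X_b` is the number `signedDist` of
distributions of these signed blocks to the parts of `b`. Two facts give the first formula. The
character of `(z + 1, U)` is the character of `(z, U)` composed with `β` (`solChar_succ`), so on
`ker β^(i+1)` all characters with `z > i` vanish. The elements `X_(z, U)` with `z ≤ i` lie in this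
kernel, and the matrix of the remaining characters at them is triangular with respect to the number
of parts. Its diagonal entries are `2^m` times factorials of multiplicities, hence nonzero. So the
dimension is the number of pairs `(z, U)` with `z ≤ i` (`finrank_quotient_eq_card`).

Forgetting signs is an algebra homomorphism `φ` that maps `Sol(B_n)` onto the peak algebra
(`map_forget_descentSpan`), and `π φ = φ β²` (`piMap_comp_forgetSpan`). The image of `X_b` counts
permutations that increase on the first block and are valley-shaped on the others. It lies in the
descent algebra of `S_n`, and a character of that algebra gives a block of size `ν` placed in a
valley the weight `1 + (-1)^(ν+1)`, which is `2` for odd `ν` and `0` for even `ν`. Even blocks are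
thus forced into the first part. A character of type A therefore pulls back along `φ` to the type B
character whose `z` is the total size of the even blocks and whose `U` consists of the odd ones
(`peakChar_forgetSpan`). The counting argument for type B then applies with `z` even and `U` odd. -/

theorem sum_coeff_smul_of {k M : Type*} [Field k] [Monoid M] [Fintype M]
    (x : MonoidAlgebra k M) : ∑ a : M, x.coeff a • MonoidAlgebra.of k M a = x := by
  classical
  ext b
  simp [MonoidAlgebra.of_apply]

/-- A left regular band: a monoid in which `a * b * a = a * b`. -/
class IsLeftRegularBand (M : Type*) [Monoid M] : Prop where
  mul_mul_self : ∀ a b : M, a * b * a = a * b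

open Classical in
/-- The number of elements which act trivially on `e` from the right. -/
def bandRank {M : Type*} [Monoid M] [Fintype M] (e : M) : ℕ :=
  (Finset.univ.filter fun a : M => e * a = e).card

theorem bandRank_le {M : Type*} [Monoid M] [Fintype M] (e : M) : bandRank e ≤ Fintype.card M := by
  classical
  exact Finset.card_le_univ _

section Band

variable {M : Type*} [Monoid M] [IsLeftRegularBand M]

theorem band_mul_self (a : M) : a * a = a := by
  simpa using IsLeftRegularBand.mul_mul_self a 1

/-- This makes `bandChar e` multiplicative: a product stabilizes `e` from the right only if both
factors do. -/
theorem band_mul_mul_eq_iff (e a b : M) : e * (a * b) = e ↔ e * a = e ∧ e * b = e := by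
  constructor
  · intro h
    have h1 : e * a = e := by
      conv_lhs => rw [← h]
      rw [mul_assoc, IsLeftRegularBand.mul_mul_self, h]
    exact ⟨h1, by rwa [← mul_assoc, h1] at h⟩
  · rintro ⟨h1, h2⟩
    rw [← mul_assoc, h1, h2]

/-- The right stabilizer only grows when `e` is replaced by `e * b`, so `bandRank` is monotone. -/
theorem band_mul_eq_of_mul_eq {e a : M} (b : M) (h : e * a = e) : e * b * a = e * b := by
  conv_lhs => rw [← h]
  rw [mul_assoc e a b, mul_assoc, IsLeftRegularBand.mul_mul_self, ← mul_assoc, h]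

variable (k : Type*) [Field k]

open Classical in
/-- The character of a left regular band attached to the support of `e`. -/
def bandChar (e : M) : MonoidAlgebra k M →ₐ[k] k :=
  MonoidAlgebra.lift k k M
    { toFun := fun a => if e * a = e then 1 else 0
      map_one' := by simp
      map_mul' := fun a b => by
        rw [ite_zero_mul_ite_zero, one_mul, if_congr (band_mul_mul_eq_iff e a b) rfl rfl] }

variable {k}

open Classical in
theorem bandChar_of (e a : M) :
    bandChar k e (MonoidAlgebra.of k M a) = if e * a = e then 1 else 0 := by
  simp [bandChar]

variable [Fintype M]

/-- The new element of the stabilizer is `b` itself, by idempotence. -/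
theorem bandRank_lt {e b : M} (h : e * b ≠ e) : bandRank e < bandRank (e * b) := by
  classical
  refine Finset.card_lt_card (Finset.ssubset_iff_of_subset ?_ |>.mpr ⟨b, ?_, ?_⟩)
  · intro a ha
    simp only [Finset.mem_filter, Finset.mem_univ, true_and] at ha ⊢
    exact band_mul_eq_of_mul_eq b ha
  · simp [mul_assoc, band_mul_self]
  · simpa using h

variable (k M) in
/-- The span of the elements of rank at least `j`. -/
def bandLevel (j : ℕ) : Submodule k (MonoidAlgebra k M) :=
  Submodule.span k (MonoidAlgebra.of k M '' {b | j ≤ bandRank b})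

/-- In `e * x` the terms with `e * a = e` have total coefficient `bandChar k e x = 0`; all other
terms have larger rank than `e`. -/
theorem mul_mem_bandLevel {x : MonoidAlgebra k M} (hx : ∀ e, bandChar k e x = 0) (j : ℕ)
    {y : MonoidAlgebra k M} (hy : y ∈ bandLevel M k j) : y * x ∈ bandLevel M k (j + 1) := by
  classical
  refine Submodule.span_induction (p := fun y _ => y * x ∈ bandLevel M k (j + 1)) ?_ (by simp)
    (fun y z _ _ hy hz => by rw [add_mul]; exact add_mem hy hz)
    (fun c y _ hy => by rw [smul_mul_assoc]; exact Submodule.smul_mem _ _ hy) hy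
  rintro _ ⟨e, he, rfl⟩
  have h0 := hx e
  rw [← sum_coeff_smul_of x, map_sum] at h0
  simp only [map_smul, bandChar_of, smul_eq_mul] at h0
  have h1 : MonoidAlgebra.of k M e * x
      = ∑ a : M, x.coeff a • (if e * a = e then 0 else MonoidAlgebra.of k M (e * a)) := by
    have h2 : MonoidAlgebra.of k M e * x = ∑ a : M, x.coeff a • MonoidAlgebra.of k M (e * a) := by
      conv_lhs => rw [← sum_coeff_smul_of x]
      simp only [Finset.mul_sum, mul_smul_comm, ← map_mul]
    have h3 : ∑ a : M, (x.coeff a * if e * a = e then 1 else 0) • MonoidAlgebra.of k M e = 0 := by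
      rw [← Finset.sum_smul, h0, zero_smul]
    refine h2.trans ((sub_eq_self.mpr h3).symm.trans ?_)
    rw [← Finset.sum_sub_distrib]
    refine Finset.sum_congr rfl fun a _ => ?_
    split_ifs with h
    · simp [h]
    · simp
  rw [h1]
  refine Submodule.sum_mem _ fun a _ => Submodule.smul_mem _ _ ?_
  split_ifs with h
  · exact zero_mem _
  · exact Submodule.subset_span ⟨e * a, by have := bandRank_lt h; simp at he ⊢; omega, rfl⟩

/-- Ranks are bounded by the cardinality of `M`, so the span of the elements of larger rank is zero.
-/
theorem isNilpotent_of_bandChar_eq_zero {x : MonoidAlgebra k M}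
    (hx : ∀ e, bandChar k e x = 0) : IsNilpotent x := by
  refine ⟨Fintype.card M + 1, ?_⟩
  have h : ∀ j, x ^ j ∈ bandLevel M k j := by
    intro j
    induction j with
    | zero => exact Submodule.subset_span ⟨1, by simp, by simp [MonoidAlgebra.one_def]⟩
    | succ j ih => rw [pow_succ]; exact mul_mem_bandLevel hx j ih
  have h2 := h (Fintype.card M + 1)
  have h3 : {b : M | Fintype.card M + 1 ≤ bandRank b} = ∅ := by
    ext b
    have := bandRank_le b
    simp
    omega
  rw [bandLevel, h3] at h2
  simpa using h2

end Band

/-! ### The Jacobson radical from characters -/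

/-- Characters with values in `k` kill the radical; conversely their common kernel is an ideal, and
if it consists of nilpotents it is quasi-regular. -/
theorem mem_rad_iff {k A ι : Type*} [Field k] [Ring A] [Algebra k A] (S : Subalgebra k A)
    (χ : ι → S →ₐ[k] k) (hnil : ∀ x : S, (∀ i, χ i x = 0) → IsNilpotent x) (x : S) :
    (x : A) ∈ rad S ↔ ∀ i, χ i x = 0 := by
  have h0 : (x : A) ∈ rad S ↔ x ∈ Ring.jacobson S := by
    simp only [rad, Submodule.mem_map, Submodule.restrictScalars_mem]
    constructor
    · rintro ⟨y, hy, hxy⟩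
      rwa [Subtype.ext hxy] at hy
    · exact fun h => ⟨x, h, rfl⟩
  rw [h0, ← Ideal.jacobson_bot, Ideal.mem_jacobson_iff]
  simp only [Ideal.mem_bot]
  constructor
  · intro h i
    by_contra hc
    -- The multiplier is chosen so that `χ i` sends `z * y * x + z - 1` to `-1`.
    obtain ⟨z, hz⟩ := h (algebraMap k S (-(χ i x)⁻¹))
    have := congrArg (χ i) hz
    simp only [map_sub, map_add, map_mul, AlgHom.commutes, map_one, map_zero,
      Algebra.algebraMap_self, RingHom.id_apply] at this
    field_simp at this
    simp at this
  · intro h y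
    have hn : IsNilpotent (y * x) := hnil _ fun i => by simp [h i]
    obtain ⟨u, hu⟩ := hn.isUnit_one_add
    refine ⟨(u⁻¹ : Sˣ), ?_⟩
    have := u.inv_mul
    rw [hu, mul_add, mul_one] at this
    rw [mul_assoc, add_comm, this, sub_self]

set_option linter.unusedSectionVars false

/-! ### Invariants of the algebra of a left regular band and descent algebras -/

/-- A base chamber `c` of a left regular band `M` with an action of a group `G`, such that `G` acts
simply transitively on the chambers and the faces of `c` represent the `G`-orbits. -/
structure IsChamberSystem (G : Type*) {M : Type*} [Group G] [Monoid M] [MulDistribMulAction G M]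
    (c : M) : Prop where
  exists_smul : ∀ a : M, ∃ g : G, a * c = g • c
  free : ∀ g : G, g • c = c → g = 1
  eq_of_smul_eq : ∀ (a b : M) (g : G), a * c = c → b * c = c → g • a = b → a = b
  -- In the examples `w` has exactly the descents permitted by `a`: any face that permits `w` lies
  -- above `a`. This makes the elements `descentSum` linearly independent.
  exists_descent : ∀ a : M, a * c = c →
    ∃ w : G, a * (w⁻¹ • c) = c ∧ ∀ b, b * c = c → b * (w⁻¹ • c) = c → a * b = b

variable {G M : Type*} [Group G] [Monoid M] [MulDistribMulAction G M]

namespace IsChamberSystem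

variable {c : M} (h : IsChamberSystem G c)
include h

/-- The group element corresponding to the chamber `a * c`. -/
def elt (a : M) : G := (h.exists_smul a).choose

theorem mul_eq_elt_smul (a : M) : a * c = h.elt a • c := (h.exists_smul a).choose_spec

theorem elt_eq_of_mul_eq {a : M} {g : G} (hg : a * c = g • c) : h.elt a = g := by
  have h1 : g⁻¹ • h.elt a • c = c := by rw [← h.mul_eq_elt_smul, hg, inv_smul_smul]
  rw [smul_smul] at h1
  exact (inv_mul_eq_one.mp (h.free _ h1)).symm

/-- Moving `elt b` past `a` twists `a`; this is where the order of the factors gets reversed. -/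
theorem elt_mul (a b : M) : h.elt (a * b) = h.elt b * h.elt ((h.elt b)⁻¹ • a) := by
  apply h.elt_eq_of_mul_eq
  rw [mul_smul, ← h.mul_eq_elt_smul, smul_mul', smul_inv_smul, mul_assoc, h.mul_eq_elt_smul b]

omit h in
theorem smul_mul_eq_iff (a : M) (w : G) : a * (w⁻¹ • c) = c ↔ (w • a) * c = w • c := by
  rw [← smul_left_cancel_iff w, smul_mul', smul_inv_smul]

/-- A translate of any `a` is a face of `c`, so the faces of `c` meet every orbit. -/
theorem elt_inv_smul_mul [IsLeftRegularBand M] (a : M) : ((h.elt a)⁻¹ • a) * c = c := by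
  rw [← smul_left_cancel_iff (h.elt a), smul_mul', smul_inv_smul, ← h.mul_eq_elt_smul,
    ← mul_assoc, band_mul_self]

end IsChamberSystem

section Inv

variable (k : Type*) [Field k]

/-- The action of `G` on the monoid algebra of `M`. -/
def bandAct (g : G) : MonoidAlgebra k M ≃ₐ[k] MonoidAlgebra k M :=
  MonoidAlgebra.domCongr k k (MulDistribMulAction.toMulEquiv M g)

variable {k} in
theorem bandAct_of (g : G) (a : M) :
    bandAct k g (MonoidAlgebra.of k M a) = MonoidAlgebra.of k M (g • a) := by
  simp [bandAct, MonoidAlgebra.of_apply]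

variable {k} in
theorem bandAct_coeff (g : G) (x : MonoidAlgebra k M) (a : M) :
    (bandAct k g x).coeff (g • a) = x.coeff a := by
  have : (MulDistribMulAction.toMulEquiv M g).symm (g • a) = a :=
    (MulDistribMulAction.toMulEquiv M g).symm_apply_apply a
  simp [bandAct, this]

variable (G M) in
/-- The subalgebra of `G`-invariants of the algebra of `M`. -/
def bandInv : Subalgebra k (MonoidAlgebra k M) where
  carrier := {x | ∀ g : G, bandAct k g x = x}
  mul_mem' hx hy g := by rw [map_mul, hx g, hy g]
  add_mem' hx hy g := by rw [map_add, hx g, hy g]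
  algebraMap_mem' r g := (bandAct k g).commutes r

variable {k} in
theorem bandInv_coeff_smul {x : MonoidAlgebra k M} (hx : x ∈ bandInv G M k) (g : G) (a : M) :
    x.coeff (g • a) = x.coeff a := by
  conv_lhs => rw [← hx g]
  exact bandAct_coeff g x a

end Inv

/-! ### The anti-homomorphism from the invariants to the group algebra, and its image -/

namespace IsChamberSystem

variable {c : M} (h : IsChamberSystem G c) (k : Type*) [Field k]

/-- The linear map from the algebra of `M` to that of `G` given by `x ↦ x * c`, where the chambers
are identified with the elements of `G`. -/
def toGroup : MonoidAlgebra k M →ₗ[k] MonoidAlgebra k G :=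
  MonoidAlgebra.mapDomainLinearMap k k h.elt

variable {k}

theorem toGroup_of (a : M) :
    h.toGroup k (MonoidAlgebra.of k M a) = MonoidAlgebra.of k G (h.elt a) := by
  simp [toGroup, MonoidAlgebra.of_apply]

variable [Fintype M]

theorem toGroup_mul_of (x : MonoidAlgebra k M) (b : M) :
    h.toGroup k (x * MonoidAlgebra.of k M b)
      = MonoidAlgebra.of k G (h.elt b) * h.toGroup k (bandAct k (h.elt b)⁻¹ x) := by
  rw [← sum_coeff_smul_of x]
  simp only [Finset.sum_mul, smul_mul_assoc, map_sum, map_smul, ← map_mul, toGroup_of, bandAct_of,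
    h.elt_mul, Finset.mul_sum, mul_smul_comm]

/-- Invariance of `x` removes the twist in `toGroup_mul_of`. Only the left factor has to be
invariant. -/
theorem toGroup_mul {x : MonoidAlgebra k M} (hx : x ∈ bandInv G M k) (y : MonoidAlgebra k M) :
    h.toGroup k (x * y) = h.toGroup k y * h.toGroup k x := by
  rw [← sum_coeff_smul_of y]
  simp only [Finset.mul_sum, Finset.sum_mul, smul_mul_assoc, mul_smul_comm, map_sum, map_smul,
    toGroup_mul_of, hx _, toGroup_of]

theorem toGroup_one : h.toGroup k 1 = 1 := by
  rw [← map_one (MonoidAlgebra.of k M), toGroup_of, h.elt_eq_of_mul_eq (g := 1) (by simp), map_one]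

theorem toGroup_pow {x : MonoidAlgebra k M} (hx : x ∈ bandInv G M k) (m : ℕ) :
    h.toGroup k (x ^ m) = h.toGroup k x ^ m := by
  induction m with
  | zero => simp [toGroup_one]
  | succ m ih => rw [pow_succ, pow_succ', h.toGroup_mul (pow_mem hx m), ih]

variable (k) in
/-- The descent algebra: the image of the invariants in the group algebra. -/
def descentAlg : Subalgebra k (MonoidAlgebra k G) where
  carrier := h.toGroup k '' (bandInv G M k)
  mul_mem' := by
    rintro _ _ ⟨x, hx, rfl⟩ ⟨y, hy, rfl⟩
    exact ⟨y * x, mul_mem hy hx, h.toGroup_mul hy x⟩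
  add_mem' := by
    rintro _ _ ⟨x, hx, rfl⟩ ⟨y, hy, rfl⟩
    exact ⟨x + y, add_mem hx hy, map_add _ _ _⟩
  algebraMap_mem' r := ⟨algebraMap k _ r, Subalgebra.algebraMap_mem _ r, by
    rw [Algebra.algebraMap_eq_smul_one, map_smul, toGroup_one, Algebra.algebraMap_eq_smul_one]⟩

theorem toGroup_mem {x : MonoidAlgebra k M} (hx : x ∈ bandInv G M k) :
    h.toGroup k x ∈ h.descentAlg k := ⟨x, hx, rfl⟩

variable [Fintype G]

open Classical in
variable (G k) in
/-- The sum of the `w` whose descents are allowed by the face `a` of `c`. -/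
def _root_.PeakAlgebra.descentSum (c a : M) : MonoidAlgebra k G :=
  ∑ w : G with a * (w⁻¹ • c) = c, MonoidAlgebra.of k G w

open Classical in
theorem _root_.PeakAlgebra.descentSum_coeff (a : M) (w : G) :
    (descentSum G k c a).coeff w = if a * (w⁻¹ • c) = c then 1 else 0 := by
  have : (descentSum G k c a).coeff w
      = ∑ v : G with a * (v⁻¹ • c) = c, (if v = w then (1 : k) else 0) := by
    simp [descentSum, MonoidAlgebra.of_apply, Finsupp.single_apply]
  rw [this, Finset.sum_ite_eq']
  simp

open Classical in
variable (G k) in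
/-- The sum of the orbit of the face `a` of `c`. -/
def _root_.PeakAlgebra.orbitSum (c a : M) : MonoidAlgebra k M :=
  ∑ w : G with a * (w⁻¹ • c) = c, MonoidAlgebra.of k M (w • a)

include h

-- Although `a` may have a nontrivial stabilizer, the condition on `w` singles out one group element
-- for each member `b` of the orbit, namely `elt b`. So every member has coefficient one.
open Classical in
theorem orbitSum_coeff [IsLeftRegularBand M] {a : M} (ha : a * c = c) (b : M) :
    (orbitSum G k c a).coeff b = if ∃ v : G, v • a = b then 1 else 0 := by
  have h1 : (orbitSum G k c a).coeff b
      = ∑ w : G with a * (w⁻¹ • c) = c, if w • a = b then (1 : k) else 0 := by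
    simp [orbitSum, MonoidAlgebra.of_apply, Finsupp.single_apply]
  rw [h1]
  split_ifs with hv
  · obtain ⟨v, hv⟩ := hv
    have h2 : (h.elt b)⁻¹ • b = a := by
      refine (h.eq_of_smul_eq a _ ((h.elt b)⁻¹ * v) ha (h.elt_inv_smul_mul b) ?_).symm
      rw [mul_smul, hv]
    have h3 : h.elt b • a = b := by rw [← h2, smul_inv_smul]
    rw [Finset.sum_eq_single_of_mem (h.elt b), if_pos h3]
    · rw [Finset.mem_filter, smul_mul_eq_iff, h3]
      exact ⟨Finset.mem_univ _, h.mul_eq_elt_smul b⟩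
    · intro w hw hne
      rw [Finset.mem_filter, smul_mul_eq_iff] at hw
      refine if_neg fun hwb => hne ?_
      rw [hwb] at hw
      exact (h.elt_eq_of_mul_eq hw.2).symm
  · exact Finset.sum_eq_zero fun w _ => if_neg fun hw => hv ⟨w, hw⟩

theorem orbitSum_mem [IsLeftRegularBand M] {a : M} (ha : a * c = c) :
    orbitSum G k c a ∈ bandInv G M k := by
  classical
  intro g
  ext b
  have h1 := bandAct_coeff g (orbitSum G k c a) (g⁻¹ • b)
  rw [smul_inv_smul] at h1
  rw [h1, h.orbitSum_coeff ha, h.orbitSum_coeff ha]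
  refine if_congr ⟨fun ⟨v, hv⟩ => ⟨g * v, ?_⟩, fun ⟨v, hv⟩ => ⟨g⁻¹ * v, ?_⟩⟩ rfl rfl
  · rw [mul_smul, hv, smul_inv_smul]
  · rw [mul_smul, hv]

theorem toGroup_orbitSum (a : M) : h.toGroup k (orbitSum G k c a) = descentSum G k c a := by
  classical
  rw [orbitSum, descentSum, map_sum]
  refine Finset.sum_congr rfl fun w hw => ?_
  rw [Finset.mem_filter, smul_mul_eq_iff] at hw
  rw [toGroup_of, h.elt_eq_of_mul_eq hw.2]

theorem descentSum_mem [IsLeftRegularBand M] {a : M} (ha : a * c = c) :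
    descentSum G k c a ∈ h.descentAlg k := by
  rw [← h.toGroup_orbitSum]
  exact h.toGroup_mem (h.orbitSum_mem ha)

-- By `eq_of_smul_eq` each orbit contains exactly one face of `c`, at which an invariant has a
-- well-defined coefficient.
open Classical in
theorem eq_sum_orbitSum [IsLeftRegularBand M] {x : MonoidAlgebra k M} (hx : x ∈ bandInv G M k) :
    x = ∑ a : M with a * c = c, x.coeff a • orbitSum G k c a := by
  ext b
  have h1 : (∑ a : M with a * c = c, x.coeff a • orbitSum G k c a).coeff b
      = ∑ a : M with a * c = c, x.coeff a * if ∃ v : G, v • a = b then 1 else 0 := by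
    simp only [MonoidAlgebra.coeff_sum, Finsupp.finsetSum_apply, MonoidAlgebra.coeff_smul,
      Finsupp.smul_apply, smul_eq_mul]
    refine Finset.sum_congr rfl fun a ha => ?_
    rw [h.orbitSum_coeff (Finset.mem_filter.mp ha).2]
  rw [h1, Finset.sum_eq_single_of_mem ((h.elt b)⁻¹ • b)]
  · rw [bandInv_coeff_smul hx, if_pos ⟨h.elt b, smul_inv_smul _ _⟩, mul_one]
  · simpa using h.elt_inv_smul_mul b
  · intro a ha hne
    rw [if_neg, mul_zero]
    rintro ⟨v, hv⟩
    refine hne (h.eq_of_smul_eq a _ ((h.elt b)⁻¹ * v) (Finset.mem_filter.mp ha).2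
      (h.elt_inv_smul_mul b) ?_)
    rw [mul_smul, hv]

theorem descentAlg_eq_span [IsLeftRegularBand M] :
    Subalgebra.toSubmodule (h.descentAlg k)
      = Submodule.span k (descentSum G k c '' {a | a * c = c}) := by
  classical
  apply le_antisymm
  · rintro _ ⟨x, hx, rfl⟩
    rw [h.eq_sum_orbitSum hx, map_sum]
    refine Submodule.sum_mem _ fun a ha => ?_
    rw [map_smul, toGroup_orbitSum]
    exact Submodule.smul_mem _ _ (Submodule.subset_span ⟨a, (Finset.mem_filter.mp ha).2, rfl⟩)
  · rw [Submodule.span_le]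
    rintro _ ⟨a, ha, rfl⟩
    exact h.descentSum_mem ha

/-- The coefficient at the `w` supplied by `exists_descent` involves only faces `b` with `a * b =
b`. Apart from `a` these have larger rank, so the coefficients vanish by descending induction on the
rank. -/
theorem eq_zero_of_toGroup_eq_zero [IsLeftRegularBand M] {x : MonoidAlgebra k M}
    (hx : x ∈ bandInv G M k) (h0 : h.toGroup k x = 0) : x = 0 := by
  classical
  have key : ∀ w : G, ∑ a : M with a * c = c, (if a * (w⁻¹ • c) = c then x.coeff a else 0) = 0 := by
    intro w
    rw [h.eq_sum_orbitSum hx, map_sum] at h0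
    have h1 := congrArg (fun y => y.coeff w) h0
    simp only [map_smul, toGroup_orbitSum, MonoidAlgebra.coeff_sum, Finsupp.finsetSum_apply,
      MonoidAlgebra.coeff_smul, Finsupp.smul_apply, descentSum_coeff, smul_eq_mul, mul_ite,
      mul_one, mul_zero, MonoidAlgebra.coeff_zero, Finsupp.zero_apply] at h1
    exact h1
  have main : ∀ m : ℕ, ∀ a : M, a * c = c → Fintype.card M - bandRank a = m → x.coeff a = 0 := by
    intro m
    induction m using Nat.strong_induction_on with
    | _ m ih =>
      intro a ha hm
      obtain ⟨w, hw, hb⟩ := h.exists_descent a ha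
      have h1 := key w
      rw [Finset.sum_eq_single_of_mem a (by simpa using ha), if_pos hw] at h1
      · exact h1
      · intro b hbc hne
        have hbc' := (Finset.mem_filter.mp hbc).2
        split_ifs with hbw
        · have h2 := hb b hbc' hbw
          have h3 : a * b ≠ a := by rwa [h2]
          have h4 := bandRank_lt h3
          rw [h2] at h4
          have h5 := bandRank_le b
          exact ih (Fintype.card M - bandRank b) (by omega) b hbc' rfl
        · rfl
  rw [h.eq_sum_orbitSum hx]
  exact Finset.sum_eq_zero fun a ha => by rw [main _ a (Finset.mem_filter.mp ha).2 rfl, zero_smul]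

theorem toGroup_injOn [IsLeftRegularBand M] {x y : MonoidAlgebra k M}
    (hx : x ∈ bandInv G M k) (hy : y ∈ bandInv G M k) (hxy : h.toGroup k x = h.toGroup k y) :
    x = y :=
  sub_eq_zero.mp <| h.eq_zero_of_toGroup_eq_zero (sub_mem hx hy) <| by rw [map_sub, hxy, sub_self]

variable [IsLeftRegularBand M]

/-- The invariant which corresponds to an element of the descent algebra. -/
def lift (y : h.descentAlg k) : MonoidAlgebra k M := y.2.choose

theorem lift_mem (y : h.descentAlg k) : h.lift y ∈ bandInv G M k := y.2.choose_spec.1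

theorem toGroup_lift (y : h.descentAlg k) : h.toGroup k (h.lift y) = y := y.2.choose_spec.2

theorem lift_eq {y : h.descentAlg k} {x : MonoidAlgebra k M} (hx : x ∈ bandInv G M k)
    (hxy : h.toGroup k x = y) : h.lift y = x :=
  h.toGroup_injOn (h.lift_mem y) hx ((h.toGroup_lift y).trans hxy.symm)

variable (k) in
/-- The character of the descent algebra attached to the support of `e`. -/
def char (e : M) : h.descentAlg k →ₐ[k] k where
  toFun y := bandChar k e (h.lift y)
  map_one' := by
    rw [h.lift_eq (one_mem _) (by rw [toGroup_one]; rfl), map_one]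
  map_mul' y z := by
    rw [h.lift_eq (mul_mem (h.lift_mem z) (h.lift_mem y)), map_mul, mul_comm]
    rw [h.toGroup_mul (h.lift_mem z), toGroup_lift, toGroup_lift]
    rfl
  map_zero' := by
    rw [h.lift_eq (zero_mem _) (by rw [map_zero]; rfl), map_zero]
  map_add' y z := by
    rw [h.lift_eq (add_mem (h.lift_mem y) (h.lift_mem z)), map_add]
    rw [map_add, toGroup_lift, toGroup_lift]
    rfl
  commutes' r := by
    rw [h.lift_eq (Subalgebra.algebraMap_mem _ r), AlgHom.commutes]
    rw [Algebra.algebraMap_eq_smul_one, map_smul, toGroup_one,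
      Algebra.algebraMap_eq_smul_one (A := h.descentAlg k)]
    rfl

/-- Lifts are invariant, so the character depends only on the orbit of `e`, and the faces of `c`
suffice. -/
theorem char_smul (e : M) (g : G) (y : h.descentAlg k) : h.char k (g • e) y = h.char k e y := by
  classical
  have h1 (x : MonoidAlgebra k M) : bandChar k (g • e) (bandAct k g x) = bandChar k e x := by
    rw [← sum_coeff_smul_of x]
    simp only [map_sum, map_smul, bandAct_of, bandChar_of, ← smul_mul', smul_left_cancel_iff]
  have h2 := h1 (h.lift y)
  rwa [h.lift_mem y g] at h2

/-- Nilpotence is tested on the invariant lift in the band algebra; powers are respected even by an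
anti-homomorphism. -/
theorem isNilpotent_of_char_eq_zero (y : h.descentAlg k)
    (hy : ∀ e, e * c = c → h.char k e y = 0) : IsNilpotent y := by
  have h1 : ∀ e, h.char k e y = 0 := fun e => by
    rw [← h.char_smul e (h.elt e)⁻¹]
    exact hy _ (h.elt_inv_smul_mul e)
  obtain ⟨m, hm⟩ := isNilpotent_of_bandChar_eq_zero (x := h.lift y) h1
  refine ⟨m, Subtype.ext ?_⟩
  have h2 := h.toGroup_pow (h.lift_mem y) m
  rw [hm, map_zero, toGroup_lift] at h2
  simpa using h2.symm

-- Evaluated at the orbit sum, the character counts the orbit members that stabilize `e` from the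
-- right.
open Classical in
theorem char_descentSum {a : M} (ha : a * c = c) (e : M)
    (hm : descentSum G k c a ∈ h.descentAlg k) :
    h.char k e ⟨descentSum G k c a, hm⟩
      = (Finset.univ.filter fun w : G => a * (w⁻¹ • c) = c ∧ e * (w • a) = e).card := by
  change bandChar k e (h.lift _) = _
  rw [h.lift_eq (h.orbitSum_mem ha) (h.toGroup_orbitSum a), orbitSum, map_sum]
  simp only [bandChar_of, Finset.sum_boole, Finset.filter_filter]

end IsChamberSystem

/-! ### Sign vectors -/

/-- A group of integer functions on a `G`-set which is stable under `G`. -/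
class IsStableSubgroup (G : Type*) {X : Type*} [Group G] [MulAction G X]
    (V : AddSubgroup (X → ℤ)) : Prop where
  comp_mem : ∀ (g : G), ∀ f ∈ V, (fun x => f (g⁻¹ • x)) ∈ V

/-- The sign vectors `(sign (f x - f y))` of the functions `f` in `V`. -/
@[ext]
structure SignFace {X : Type*} (V : AddSubgroup (X → ℤ)) where
  /-- The sign of the difference of the values at two points. -/
  sgn : X → X → SignType
  exists_fun : ∃ f ∈ V, ∀ x y, sgn x y = SignType.sign (f x - f y)

/-- A large multiple of `f` dominates all differences of `g`, so `N f + g` orders points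
lexicographically. This realizes products of sign vectors inside the group `V`. -/
theorem exists_lex_sign {X : Type*} [Finite X] (f g : X → ℤ) : ∃ N : ℤ, ∀ x y,
    SignType.sign ((N * f x + g x) - (N * f y + g y)) =
      if SignType.sign (f x - f y) = 0 then SignType.sign (g x - g y)
      else SignType.sign (f x - f y) := by
  have := Fintype.ofFinite X
  -- Any difference of two values of `g` is at most `2 * ∑ |g x|` in absolute value.
  refine ⟨1 + 2 * ∑ x, |g x|, fun x y => ?_⟩
  have hx := Finset.single_le_sum (f := fun x => |g x|) (fun i _ => abs_nonneg _) (Finset.mem_univ x)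
  have hy := Finset.single_le_sum (f := fun x => |g x|) (fun i _ => abs_nonneg _) (Finset.mem_univ y)
  set S := ∑ x, |g x|
  have hx' := abs_le.mp hx
  have hy' := abs_le.mp hy
  rcases lt_trichotomy (f x) (f y) with h | h | h
  · rw [sign_neg (by linarith : f x - f y < 0), if_neg (by decide), sign_neg]
    nlinarith
  · simp [h]
  · rw [sign_pos (by linarith : 0 < f x - f y), if_neg (by decide), sign_pos]
    nlinarith

/-- The number of points with a smaller value is preserved by `v`, and it determines the value of
`f`. -/
theorem comp_perm_eq_of_sign_eq {X : Type*} [Finite X] (f : X → ℤ) (v : Equiv.Perm X)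
    (h : ∀ x y, SignType.sign (f (v x) - f (v y)) = SignType.sign (f x - f y)) (x : X) :
    f (v x) = f x := by
  classical
  have := Fintype.ofFinite X
  have hlt : ∀ x y, f (v x) < f (v y) ↔ f x < f y := fun x y => by
    rw [← sub_neg, ← sub_neg (a := f x), ← sign_eq_neg_one_iff, ← sign_eq_neg_one_iff, h]
  have hcard : ∀ x, (Finset.univ.filter fun y => f y < f (v x)).card
      = (Finset.univ.filter fun y => f y < f x).card := fun x => by
    refine (Finset.card_bij' (fun y _ => v y) (fun y _ => v.symm y) ?_ ?_ ?_ ?_).symm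
    · intro y hy; simpa [hlt] using hy
    · intro y hy
      have := hlt (v.symm y) x
      simp only [Equiv.apply_symm_apply] at this
      simpa [← this] using hy
    · simp
    · simp
  have hss : ∀ x y, f x < f y → (Finset.univ.filter fun z => f z < f x).card
      < (Finset.univ.filter fun z => f z < f y).card := fun x y hxy => by
    refine Finset.card_lt_card (Finset.ssubset_iff_of_subset ?_ |>.mpr ⟨x, by simpa, by simp⟩)
    intro z hz
    simp only [Finset.mem_filter, Finset.mem_univ, true_and] at hz ⊢
    exact hz.trans hxy
  rcases lt_trichotomy (f (v x)) (f x) with hx | hx | hx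
  · have := hss _ _ hx
    rw [hcard] at this
    omega
  · exact hx
  · have := hss _ _ hx
    rw [hcard] at this
    omega

/-- Two weakly increasing arrangements of the same values agree: their sublevel sets have equal size
and are both initial segments of the order given by `c`. -/
theorem comp_perm_eq_of_monotone {X : Type*} [Finite X] (c f : X → ℤ) (v : Equiv.Perm X)
    (h1 : ∀ x y, c x < c y → f x ≤ f y) (h2 : ∀ x y, c x < c y → f (v x) ≤ f (v y))
    (hc : Function.Injective c) (x : X) : f (v x) = f x := by
  classical
  have := Fintype.ofFinite X
  have key : ∀ t : ℤ, (Finset.univ.filter fun x => f (v x) ≤ t)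
      = Finset.univ.filter fun x => f x ≤ t := by
    intro t
    have hcard : (Finset.univ.filter fun x => f (v x) ≤ t).card
        = (Finset.univ.filter fun x => f x ≤ t).card :=
      Finset.card_bij' (fun y _ => v y) (fun y _ => v.symm y) (by simp) (by simp) (by simp)
        (by simp)
    by_cases hs : (Finset.univ.filter fun x => f (v x) ≤ t) ⊆ Finset.univ.filter fun x => f x ≤ t
    · exact Finset.eq_of_subset_of_card_le hs hcard.ge
    · refine (Finset.eq_of_subset_of_card_le ?_ hcard.le).symm
      obtain ⟨y, hy, hy'⟩ := Finset.not_subset.mp hs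
      intro z hz
      simp only [Finset.mem_filter, Finset.mem_univ, true_and, not_le] at hy hy' hz ⊢
      rcases lt_trichotomy (c y) (c z) with hyz | hyz | hyz
      · have := h1 _ _ hyz; omega
      · rwa [← hc hyz]
      · exact (h2 _ _ hyz).trans hy
  have k1 := key (f x)
  have k2 := key (f (v x))
  have e1 : x ∈ Finset.univ.filter fun y => f (v y) ≤ f x := by rw [k1]; simp
  have e2 : x ∈ Finset.univ.filter fun y => f y ≤ f (v x) := by rw [← k2]; simp
  simp only [Finset.mem_filter, Finset.mem_univ, true_and] at e1 e2
  omega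

namespace SignFace

variable {X : Type*} {V : AddSubgroup (X → ℤ)}

/-- The sign vector of a function. -/
def ofFun (f : X → ℤ) (hf : f ∈ V) : SignFace V where
  sgn x y := SignType.sign (f x - f y)
  exists_fun := ⟨f, hf, fun _ _ => rfl⟩

theorem exists_ofFun (a : SignFace V) : ∃ f, ∃ hf : f ∈ V, a = ofFun f hf := by
  obtain ⟨f, hf, h⟩ := a.exists_fun
  exact ⟨f, hf, SignFace.ext (funext fun x => funext fun y => h x y)⟩

theorem ofFun_sgn (f : X → ℤ) (hf : f ∈ V) (x y : X) :
    (ofFun f hf).sgn x y = SignType.sign (f x - f y) := rfl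

theorem ofFun_sgn_eq_zero {f : X → ℤ} {hf : f ∈ V} {x y : X} :
    (ofFun f hf).sgn x y = 0 ↔ f x = f y := by
  rw [ofFun_sgn, sign_eq_zero_iff, sub_eq_zero]

instance [Finite X] : Finite (SignFace V) :=
  Finite.of_injective (fun a => a.sgn) fun _ _ h => SignFace.ext h

instance [Finite X] : Fintype (SignFace V) := Fintype.ofFinite _

/-- The Tits product of faces: a point of `a` is moved slightly in the direction of `b`. -/
instance [Finite X] : Mul (SignFace V) where
  mul a b :=
    { sgn := fun x y => if a.sgn x y = 0 then b.sgn x y else a.sgn x y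
      exists_fun := by
        obtain ⟨f, hf, hf'⟩ := a.exists_fun
        obtain ⟨g, hg, hg'⟩ := b.exists_fun
        obtain ⟨N, hN⟩ := exists_lex_sign f g
        refine ⟨fun x => N * f x + g x, V.add_mem (V.zsmul_mem hf N) hg, fun x y => ?_⟩
        rw [hN, hf', hg'] }

instance : One (SignFace V) where
  one := ofFun 0 V.zero_mem

theorem mul_sgn [Finite X] (a b : SignFace V) (x y : X) :
    (a * b).sgn x y = if a.sgn x y = 0 then b.sgn x y else a.sgn x y := rfl

theorem one_sgn (x y : X) : (1 : SignFace V).sgn x y = 0 := by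
  change SignType.sign ((0 : ℤ) - 0) = 0
  simp

instance [Finite X] : Monoid (SignFace V) where
  mul_assoc a b c := by
    ext x y
    simp only [mul_sgn]
    split_ifs <;> simp_all
  one_mul a := by
    ext x y
    simp [mul_sgn, one_sgn]
  mul_one a := by
    ext x y
    simp only [mul_sgn, one_sgn]
    split_ifs with h <;> simp [h]

instance [Finite X] : IsLeftRegularBand (SignFace V) where
  mul_mul_self a b := by
    ext x y
    simp only [mul_sgn]
    split_ifs <;> simp_all

theorem mul_eq_left_iff [Finite X] (a b : SignFace V) :
    a * b = a ↔ ∀ x y, a.sgn x y = 0 → b.sgn x y = 0 := by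
  constructor
  · intro h x y hxy
    have := congrArg (fun s => s.sgn x y) h
    simpa [mul_sgn, hxy] using this
  · intro h
    ext x y
    rw [mul_sgn]
    split_ifs with h0
    · rw [h x y h0, h0]
    · rfl

theorem mul_eq_right_iff [Finite X] (a b : SignFace V) :
    a * b = b ↔ ∀ x y, a.sgn x y ≠ 0 → a.sgn x y = b.sgn x y := by
  constructor
  · intro h x y hxy
    have := congrArg (fun s => s.sgn x y) h
    simpa [mul_sgn, hxy] using this
  · intro h
    ext x y
    rw [mul_sgn]
    split_ifs with h0
    · rfl
    · exact h x y h0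

theorem ofFun_mul_eq_right_iff [Finite X] {f c : X → ℤ} {hf : f ∈ V} {hc : c ∈ V}
    (hinj : Function.Injective c) :
    ofFun f hf * ofFun c hc = ofFun c hc ↔ ∀ x y, c x < c y → f x ≤ f y := by
  rw [mul_eq_right_iff]
  constructor
  · intro h x y hxy
    by_contra hlt
    have h1 := h x y (by rw [Ne, ofFun_sgn_eq_zero]; omega)
    rw [ofFun_sgn, ofFun_sgn, sign_pos (by omega), sign_neg (by omega)] at h1
    exact absurd h1 (by decide)
  · intro h x y hxy
    rw [Ne, ofFun_sgn_eq_zero] at hxy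
    rw [ofFun_sgn, ofFun_sgn]
    rcases lt_trichotomy (c x) (c y) with h1 | h1 | h1
    · have := h _ _ h1
      rw [sign_neg (by omega), sign_neg (by omega)]
    · exact absurd (congrArg f (hinj h1)) hxy
    · have := h _ _ h1
      rw [sign_pos (by omega), sign_pos (by omega)]

variable {G : Type*} [Group G] [MulAction G X] [IsStableSubgroup G V]

instance : SMul G (SignFace V) where
  smul g a :=
    { sgn := fun x y => a.sgn (g⁻¹ • x) (g⁻¹ • y)
      exists_fun := by
        obtain ⟨f, hf, h⟩ := a.exists_fun
        exact ⟨_, IsStableSubgroup.comp_mem g f hf, fun x y => h _ _⟩ }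

theorem smul_sgn (g : G) (a : SignFace V) (x y : X) :
    (g • a).sgn x y = a.sgn (g⁻¹ • x) (g⁻¹ • y) := rfl

instance [Finite X] : MulDistribMulAction G (SignFace V) where
  one_smul a := by
    ext x y
    simp [smul_sgn]
  mul_smul g h a := by
    ext x y
    simp [smul_sgn, mul_smul]
  smul_mul g a b := rfl
  smul_one g := by
    ext x y
    simp [smul_sgn, one_sgn]

theorem smul_ofFun (g : G) (f : X → ℤ) (hf : f ∈ V) :
    g • ofFun f hf = ofFun (fun x => f (g⁻¹ • x)) (IsStableSubgroup.comp_mem g f hf) := rfl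

variable [Finite X] {c : X → ℤ} {hc : c ∈ V}

/-- Sorting the values of injective functions (`htrans`) gives transitivity on chambers. Freeness
and uniqueness of orbit representatives come from `comp_perm_eq_of_sign_eq` and
`comp_perm_eq_of_monotone`. -/
theorem isChamberSystem (hinj : Function.Injective c)
    (hfaith : ∀ g : G, (∀ x : X, g • x = x) → g = 1)
    (htrans : ∀ f ∈ V, Function.Injective f →
      ∃ g : G, ∀ x y, c x < c y → f (g • x) < f (g • y)) :
    IsChamberSystem G (ofFun c hc) where
  exists_smul a := by
    obtain ⟨f, hf, h⟩ := (a * ofFun c hc).exists_ofFun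
    have hne : ∀ x y, (a * ofFun c hc).sgn x y = 0 → x = y := by
      intro x y hxy
      rw [mul_sgn] at hxy
      split_ifs at hxy with h0
      · exact hinj (ofFun_sgn_eq_zero.mp hxy)
      · exact absurd hxy h0
    have hfinj : Function.Injective f := fun x y hxy => hne x y <| by
      rw [h, ofFun_sgn_eq_zero, hxy]
    obtain ⟨g, hg⟩ := htrans f hf hfinj
    refine ⟨g, ?_⟩
    rw [h]
    ext x y
    rw [smul_sgn, ofFun_sgn, ofFun_sgn]
    have h1 := hg (g⁻¹ • x) (g⁻¹ • y)
    have h2 := hg (g⁻¹ • y) (g⁻¹ • x)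
    rw [smul_inv_smul, smul_inv_smul] at h1 h2
    rcases lt_trichotomy (c (g⁻¹ • x)) (c (g⁻¹ • y)) with h3 | h3 | h3
    · have := h1 h3
      rw [sign_neg (by omega), sign_neg (by omega)]
    · have : x = y := by simpa using hinj h3
      simp [this]
    · have := h2 h3
      rw [sign_pos (by omega), sign_pos (by omega)]
  free g hg := by
    have h1 : ∀ x, c (g⁻¹ • x) = c x := by
      refine comp_perm_eq_of_sign_eq c (MulAction.toPerm g⁻¹) fun x y => ?_
      exact congrArg (fun s => s.sgn x y) hg
    have h2 : g⁻¹ = 1 := hfaith _ fun x => hinj (h1 x)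
    simpa using h2
  eq_of_smul_eq a b g ha hb hab := by
    obtain ⟨f, hf, rfl⟩ := a.exists_ofFun
    rw [smul_ofFun] at hab
    subst hab
    rw [ofFun_mul_eq_right_iff hinj] at ha hb
    have h1 : ∀ x, f (g⁻¹ • x) = f x :=
      comp_perm_eq_of_monotone c f (MulAction.toPerm g⁻¹) ha hb hinj
    ext x y
    rw [ofFun_sgn, ofFun_sgn, h1, h1]
  exists_descent a ha := by
    obtain ⟨f, hf, rfl⟩ := a.exists_ofFun
    -- The chamber `t` keeps the order of `c` within level sets of `f` and reverses it between them.
    -- A face `b` of `c` with `b * t = c` must then separate every pair of points that `f`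
    -- separates.
    set t : SignFace V := ofFun (-f) (V.neg_mem hf) * ofFun c hc with ht
    have htz : ∀ x y, t.sgn x y = if f x = f y then SignType.sign (c x - c y)
        else SignType.sign (f y - f x) := fun x y => by
      rw [ht, mul_sgn]
      simp only [ofFun_sgn_eq_zero, Pi.neg_apply, neg_inj]
      split_ifs with h0
      · rfl
      · rw [ofFun_sgn]
        congr 1
        simp only [Pi.neg_apply]
        ring
    obtain ⟨f', hf', h⟩ := t.exists_ofFun
    have hfinj : Function.Injective f' := fun x y hxy => by
      have h1 : t.sgn x y = 0 := by rw [h, ofFun_sgn_eq_zero, hxy]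
      rw [htz] at h1
      split_ifs at h1 with h0
      · rw [sign_eq_zero_iff, sub_eq_zero] at h1
        exact hinj h1
      · rw [sign_eq_zero_iff, sub_eq_zero] at h1
        exact absurd h1.symm h0
    obtain ⟨g, hg⟩ := htrans f' hf' hfinj
    have hgt : g⁻¹⁻¹ • ofFun c hc = t := by
      rw [inv_inv, h]
      ext x y
      rw [smul_sgn, ofFun_sgn, ofFun_sgn]
      have h1 := hg (g⁻¹ • x) (g⁻¹ • y)
      have h2 := hg (g⁻¹ • y) (g⁻¹ • x)
      rw [smul_inv_smul, smul_inv_smul] at h1 h2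
      rcases lt_trichotomy (c (g⁻¹ • x)) (c (g⁻¹ • y)) with h3 | h3 | h3
      · have := h1 h3
        rw [sign_neg (by omega), sign_neg (by omega)]
      · have : x = y := by simpa using hinj h3
        simp [this]
      · have := h2 h3
        rw [sign_pos (by omega), sign_pos (by omega)]
    rw [mul_eq_right_iff] at ha
    refine ⟨g⁻¹, ?_, fun b hb hbt => ?_⟩
    · rw [hgt]
      ext x y
      rw [mul_sgn, htz]
      split_ifs with h0 h1
      · rfl
      · exact absurd (ofFun_sgn_eq_zero.mp h0) h1
      · exact ha x y h0
    · rw [hgt] at hbt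
      rw [mul_eq_right_iff] at hb ⊢
      intro x y hxy
      have hb0 : b.sgn x y ≠ 0 := by
        intro h0
        have h1 := congrArg (fun s => s.sgn x y) hbt
        have h2 := ha x y hxy
        simp only [mul_sgn, h0, if_true, htz] at h1
        rw [Ne, ofFun_sgn_eq_zero] at hxy
        rw [if_neg hxy, ← h2, ofFun_sgn, ← neg_sub, Left.sign_neg] at h1
        have h3 : SignType.sign (f x - f y) ≠ 0 := by
          rwa [Ne, sign_eq_zero_iff, sub_eq_zero]
        revert h1 h3
        generalize SignType.sign (f x - f y) = s
        revert s
        decide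
      rw [ha x y hxy, hb x y hb0]

variable [Fintype G]

-- Counting group elements becomes counting functions: each translate of the face is hit by a single
-- admissible `w`, and a translated face determines the translated function.
open Classical in
theorem card_descent_eq_ncard (h : IsChamberSystem G (ofFun c hc)) {f : X → ℤ} {hf : f ∈ V}
    (hfc : ofFun f hf * ofFun c hc = ofFun c hc) (e : SignFace V) :
    (Finset.univ.filter fun w : G =>
        ofFun f hf * (w⁻¹ • ofFun c hc) = ofFun c hc ∧ e * (w • ofFun f hf) = e).card
      = Set.ncard {g : X → ℤ | (∃ w : G, g = fun x => f (w⁻¹ • x)) ∧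
          ∀ x y, e.sgn x y = 0 → g x = g y} := by
  rw [← Finset.card_image_of_injOn (f := fun w : G => fun x => f (w⁻¹ • x)), ← Set.ncard_coe_finset]
  · congr 1
    ext g
    simp only [Finset.coe_image, Finset.coe_filter, Finset.mem_univ, true_and, Set.mem_image,
      Set.mem_ofPred_eq]
    constructor
    · rintro ⟨w, ⟨-, he⟩, rfl⟩
      refine ⟨⟨w, rfl⟩, fun x y hxy => ?_⟩
      rw [smul_ofFun, mul_eq_left_iff] at he
      have h0 := he x y hxy
      rwa [ofFun_sgn_eq_zero] at h0
    · rintro ⟨⟨v, rfl⟩, he⟩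
      set b := v • ofFun f hf with hb
      set w := h.elt b
      have h1 : w⁻¹ • b = ofFun f hf := by
        refine (h.eq_of_smul_eq _ _ (w⁻¹ * v) hfc (h.elt_inv_smul_mul b) ?_).symm
        rw [mul_smul]
      have h2 : w • ofFun f hf = b := by rw [← h1, smul_inv_smul]
      refine ⟨w, ⟨?_, ?_⟩, ?_⟩
      · rw [IsChamberSystem.smul_mul_eq_iff, h2]
        exact h.mul_eq_elt_smul b
      · rw [h2, hb, smul_ofFun, mul_eq_left_iff]
        exact fun x y hxy => ofFun_sgn_eq_zero.mpr (he x y hxy)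
      · funext x
        -- `w` and `v` give the same translated face, hence differ by an element that fixes the face
        -- of `f`; such an element fixes `f` itself.
        have h3 := comp_perm_eq_of_sign_eq f (MulAction.toPerm (w⁻¹ * v)) (fun x y => by
          have h4 : (v⁻¹ * w) • ofFun f hf = ofFun f hf := by
            rw [mul_smul, h2, hb, inv_smul_smul]
          have h5 := congrArg (fun s => s.sgn x y) h4
          simpa [smul_sgn, ofFun_sgn] using h5) (v⁻¹ • x)
        simpa [mul_smul] using h3
  · intro w hw w' hw' hww
    simp only [Finset.coe_filter, Finset.mem_univ, true_and, Set.mem_ofPred_eq,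
      IsChamberSystem.smul_mul_eq_iff] at hw hw'
    have h1 : w • ofFun f hf = w' • ofFun f hf := by
      ext x y
      have hx := congrFun hww x
      have hy := congrFun hww y
      simp only at hx hy
      rw [smul_ofFun, smul_ofFun, ofFun_sgn, ofFun_sgn, hx, hy]
    have h2 := hw.1
    rw [h1, hw'.1] at h2
    have h3 : (w⁻¹ * w') • ofFun c hc = ofFun c hc := by rw [mul_smul, h2, inv_smul_smul]
    exact inv_mul_eq_one.mp (h.free _ h3)

end SignFace

/-! ### Weighted numbers of distributions of a multiset of blocks -/

section DistSum

open Multiset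

theorem sum_antidiagonal_cons {R : Type*} [AddCommMonoid R] (a : ℕ) (U : Multiset ℕ)
    (F : Multiset ℕ × Multiset ℕ → R) :
    ((antidiagonal (a ::ₘ U)).map F).sum
      = ((antidiagonal U).map fun p => F (p.1, a ::ₘ p.2)).sum
        + ((antidiagonal U).map fun p => F (a ::ₘ p.1, p.2)).sum := by
  rw [antidiagonal_cons, Multiset.map_add, Multiset.sum_add, Multiset.map_map, Multiset.map_map]
  rfl

/-- Coassociativity: a splitting into three submultisets may be made in two steps in either order.
-/
theorem sum_antidiagonal_assoc {R : Type*} [AddCommMonoid R] (U : Multiset ℕ)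
    (F : Multiset ℕ → Multiset ℕ → Multiset ℕ → R) :
    ((antidiagonal U).map fun p => ((antidiagonal p.2).map fun q => F p.1 q.1 q.2).sum).sum
      = ((antidiagonal U).map fun p => ((antidiagonal p.1).map fun q => F q.1 q.2 p.2).sum).sum := by
  induction U using Multiset.induction_on generalizing F with
  | empty => simp
  | cons a U ih =>
    simp only [sum_antidiagonal_cons, Multiset.sum_map_add]
    rw [ih fun x y z => F x y (a ::ₘ z), ih fun x y z => F x (a ::ₘ y) z, ih fun x y z => F (a ::ₘ x) y z]
    abel

theorem sum_antidiagonal_fst_eq_zero {R : Type*} [AddCommMonoid R] (U : Multiset ℕ)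
    (F : Multiset ℕ → R) :
    ((antidiagonal U).map fun p => if p.1 = 0 then F p.2 else 0).sum = F U := by
  induction U using Multiset.induction_on generalizing F with
  | empty => simp
  | cons a U ih => simp [ih fun x => F (a ::ₘ x)]

theorem sum_antidiagonal_fst_eq_singleton {R : Type*} [AddCommMonoidWithOne R] (b : ℕ)
    (U : Multiset ℕ) :
    ((antidiagonal U).map fun p => if p.1 = {b} then (1 : R) else 0).sum = (U.count b : R) := by
  induction U using Multiset.induction_on with
  | empty =>
    have : (0 : Multiset ℕ) ≠ {b} := (Multiset.singleton_ne_zero b).symm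
    simp [this]
  | cons a U ih =>
    rw [sum_antidiagonal_cons, ih, count_cons, Nat.cast_add]
    congr 1
    by_cases hab : b = a
    · subst hab
      rw [if_pos rfl, Nat.cast_one]
      have : ∀ s : Multiset ℕ, b ::ₘ s = {b} ↔ s = 0 := fun s => by
        rw [← Multiset.cons_zero, Multiset.cons_inj_right]
      simp only [this]
      exact sum_antidiagonal_fst_eq_zero U fun _ => (1 : R)
    · rw [if_neg hab, Nat.cast_zero]
      have : ∀ s : Multiset ℕ, ¬ a ::ₘ s = {b} := fun s h => hab <| by
        have := h ▸ Multiset.mem_cons_self a s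
        simpa using (Multiset.mem_singleton.mp this).symm
      simp [this]

variable {k : Type*} [Field k]

/-- The weighted number of distributions of the blocks with sizes `U` to the entries of a list:
the blocks for the entry `(w, c)` have total size `c`, and each of them contributes its weight. -/
def distSum : List ((ℕ → k) × ℕ) → Multiset ℕ → k
  | [], U => if U = 0 then 1 else 0
  | g :: gs, U => ((antidiagonal U).map fun p =>
      if p.1.sum = g.2 then (p.1.map g.1).prod * distSum gs p.2 else 0).sum

theorem distSum_cons (g : (ℕ → k) × ℕ) (gs : List ((ℕ → k) × ℕ)) (U : Multiset ℕ) :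
    distSum (g :: gs) U = ((antidiagonal U).map fun p =>
      if p.1.sum = g.2 then (p.1.map g.1).prod * distSum gs p.2 else 0).sum := rfl

theorem sum_eq_zero_iff_of_pos {T : Multiset ℕ} (h : ∀ x ∈ T, 0 < x) : T.sum = 0 ↔ T = 0 := by
  constructor
  · intro h0
    refine Multiset.eq_zero_of_forall_notMem fun x hx => ?_
    have h1 := Multiset.single_le_sum (fun _ _ => Nat.zero_le _) x hx
    have h2 := h x hx
    omega
  · rintro rfl
    rfl

theorem distSum_cons_zero (w : ℕ → k) (gs : List ((ℕ → k) × ℕ)) {U : Multiset ℕ}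
    (hU : ∀ x ∈ U, 0 < x) : distSum ((w, 0) :: gs) U = distSum gs U := by
  rw [distSum_cons, ← sum_antidiagonal_fst_eq_zero U (distSum gs)]
  congr 1
  refine Multiset.map_congr rfl fun p hp => ?_
  rw [mem_antidiagonal] at hp
  have h1 : ∀ x ∈ p.1, 0 < x := fun x hx => hU x (hp ▸ Multiset.mem_add.mpr (Or.inl hx))
  simp only [sum_eq_zero_iff_of_pos h1]
  split_ifs with h0
  · simp [h0]
  · rfl

/-- Expanding the product of the weights `w₁ x + w₂ x` over the blocks of one entry means
distributing these blocks to two adjacent entries, with all possible sizes. -/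
theorem sum_distSum_cons_cons (w₁ w₂ : ℕ → k) (c : ℕ) (gs : List ((ℕ → k) × ℕ))
    (U : Multiset ℕ) :
    ∑ j ∈ Finset.range (c + 1), distSum ((w₁, j) :: (w₂, c - j) :: gs) U
      = distSum ((w₁ + w₂, c) :: gs) U := by
  have h1 : ∀ j, distSum ((w₁, j) :: (w₂, c - j) :: gs) U
      = ((antidiagonal U).map fun p => ((antidiagonal p.1).map fun q =>
          if q.1.sum = j ∧ q.2.sum = c - j then
            (q.1.map w₁).prod * (q.2.map w₂).prod * distSum gs p.2 else 0).sum).sum := by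
    intro j
    rw [← sum_antidiagonal_assoc U fun x y z => if x.sum = j ∧ y.sum = c - j then
            (x.map w₁).prod * (y.map w₂).prod * distSum gs z else 0, distSum_cons]
    congr 1
    refine Multiset.map_congr rfl fun p _ => ?_
    simp only [distSum_cons]
    split_ifs with hp
    · rw [← Multiset.sum_map_mul_left]
      simp [hp, mul_assoc]
    · simp [hp]
  simp only [h1]
  have h2 : ∀ (W : Multiset (Multiset ℕ × Multiset ℕ)) (F : ℕ → Multiset ℕ × Multiset ℕ → k),
      ∑ j ∈ Finset.range (c + 1), (W.map (F j)).sum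
        = (W.map fun p => ∑ j ∈ Finset.range (c + 1), F j p).sum := fun W F =>
    Multiset.sum_map_sum_map _ _
  rw [h2, distSum_cons]
  congr 1
  refine Multiset.map_congr rfl fun p _ => ?_
  rw [h2]
  simp only [Pi.add_apply]
  rw [Multiset.prod_map_add, ← Multiset.sum_map_mul_right]
  have h3 : ∀ q ∈ antidiagonal p.1, (∑ j ∈ Finset.range (c + 1),
      if q.1.sum = j ∧ q.2.sum = c - j then
        (q.1.map w₁).prod * (q.2.map w₂).prod * distSum gs p.2 else 0)
      = if p.1.sum = c then (q.1.map w₁).prod * (q.2.map w₂).prod * distSum gs p.2 else 0 := by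
    intro q hq
    rw [mem_antidiagonal] at hq
    have h4 : p.1.sum = q.1.sum + q.2.sum := by rw [← hq, Multiset.sum_add]
    split_ifs with hc
    · rw [Finset.sum_eq_single_of_mem q.1.sum (by rw [Finset.mem_range]; omega), if_pos]
      · constructor
        · rfl
        · omega
      · exact fun j _ hj => if_neg fun h => hj h.1.symm
    · refine Finset.sum_eq_zero fun j hj => if_neg ?_
      rw [Finset.mem_range] at hj
      omega
  rw [Multiset.map_congr rfl h3]
  split_ifs <;> simp

/-- The weight `ν ↦ (-1) ^ (ν + 1)`. -/
def altWeight (ν : ℕ) : k := (-1) ^ (ν + 1)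

/-- The sign `(-1)^j` is absorbed as the weight `(-1)^ν` per block, which is the negative of
`altWeight`. Merging the two entries leaves an entry of weight zero and positive size. This is the
counterpart of `sum_alternating_shapesWeight`. -/
theorem sum_alternating_distSum {c : ℕ} (hc : 0 < c) (gs : List ((ℕ → k) × ℕ))
    (U : Multiset ℕ) :
    ∑ j ∈ Finset.range (c + 1),
      (-1) ^ j * distSum ((1, j) :: (altWeight, c - j) :: gs) U = 0 := by
  have h1 : ∀ j, (-1) ^ j * distSum ((1, j) :: (altWeight, c - j) :: gs) U
      = distSum (((fun ν => (-1) ^ ν), j) :: (altWeight, c - j) :: gs) U := by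
    intro j
    rw [distSum_cons, distSum_cons, ← Multiset.sum_map_mul_left]
    congr 1
    refine Multiset.map_congr rfl fun p _ => ?_
    rw [mul_ite, mul_zero]
    refine if_ctx_congr Iff.rfl (fun h => ?_) fun _ => rfl
    have h2 : (p.1.map fun ν => ((-1 : k)) ^ ν).prod = (-1) ^ p.1.sum := by
      induction p.1 using Multiset.induction_on with
      | empty => simp
      | cons a T ih => simp [ih, pow_add]
    rw [h2, h]
    simp
  simp only [h1]
  rw [sum_distSum_cons_cons, distSum_cons]
  have h2 : ((fun ν => (-1) ^ ν) + altWeight : ℕ → k) = 0 := by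
    funext ν
    simp [altWeight, pow_succ]
  rw [h2]
  refine (congrArg Multiset.sum (Multiset.map_congr rfl (g := fun _ => (0 : k)) fun p _ => ?_)).trans
    (by simp)
  split_ifs with h
  · have h3 : p.1 ≠ 0 := by
      rintro h0
      rw [h0] at h
      simp at h
      omega
    obtain ⟨x, hx⟩ := Multiset.exists_mem_of_ne_zero h3
    rw [Multiset.prod_eq_zero (Multiset.mem_map.mpr ⟨x, hx, rfl⟩), zero_mul]
  · rfl

/-- Relations between tails persist after adding a common prefix, since the prefix only selects
which blocks remain. Positivity of the blocks is kept for the use of `distSum_cons_zero`. -/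
theorem sum_distSum_append {ι : Type*} (J : Finset ι) (s : ι → k)
    (gs : ι → List ((ℕ → k) × ℕ)) (t : k) (gs₀ : List ((ℕ → k) × ℕ))
    (h : ∀ U : Multiset ℕ, (∀ x ∈ U, 0 < x) → ∑ j ∈ J, s j * distSum (gs j) U = t * distSum gs₀ U)
    (pre : List ((ℕ → k) × ℕ)) {U : Multiset ℕ} (hU : ∀ x ∈ U, 0 < x) :
    ∑ j ∈ J, s j * distSum (pre ++ gs j) U = t * distSum (pre ++ gs₀) U := by
  induction pre generalizing U with
  | nil => exact h U hU
  | cons g pre ih =>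
    simp only [List.cons_append, distSum_cons, ← Multiset.sum_map_mul_left]
    refine (Multiset.sum_map_sum_map _ _).trans ?_
    congr 1
    refine Multiset.map_congr rfl fun p hp => ?_
    rw [mem_antidiagonal] at hp
    have h1 := ih (U := p.2) fun x hx => hU x (hp ▸ Multiset.mem_add.mpr (Or.inr hx))
    split_ifs with h2
    · rw [mul_left_comm, ← h1, Finset.mul_sum]
      exact Finset.sum_congr rfl fun j _ => by ring
    · simp

theorem distSum_map_congr {w w' : ℕ → k} (bs : List ℕ) {U : Multiset ℕ}
    (h : ∀ x ∈ U, w x = w' x) :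
    distSum (bs.map fun b => (w, b)) U = distSum (bs.map fun b => (w', b)) U := by
  induction bs generalizing U with
  | nil => rfl
  | cons b bs ih =>
    simp only [List.map_cons, distSum_cons]
    congr 1
    refine Multiset.map_congr rfl fun p hp => ?_
    rw [mem_antidiagonal] at hp
    rw [ih fun x hx => h x (hp ▸ Multiset.mem_add.mpr (Or.inr hx)),
      Multiset.map_congr rfl fun x hx => h x (hp ▸ Multiset.mem_add.mpr (Or.inl hx))]

theorem distSum_map_eq_zero {w : ℕ → k} {a : ℕ} (ha : w a = 0) (bs : List ℕ) (U : Multiset ℕ) :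
    distSum (bs.map fun b => (w, b)) (a ::ₘ U) = 0 := by
  induction bs generalizing U with
  | nil => simp [distSum]
  | cons b bs ih => simp [distSum_cons, ih, ha]

/-- A block of weight zero in the later entries has to go to the first entry, where it uses up `a`
units of its size. -/
theorem distSum_cons_map_cons {w : ℕ → k} {a : ℕ} (ha : w a = 0) (b₀ : ℕ) (bs : List ℕ)
    (U : Multiset ℕ) :
    distSum ((1, b₀) :: bs.map fun b => (w, b)) (a ::ₘ U)
      = if a ≤ b₀ then distSum ((1, b₀ - a) :: bs.map fun b => (w, b)) U else 0 := by
  rw [distSum_cons, sum_antidiagonal_cons]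
  simp only [distSum_map_eq_zero ha, mul_zero, ite_self, Multiset.map_const', Multiset.sum_replicate,
    smul_zero, zero_add, Multiset.sum_cons, Multiset.map_cons, Multiset.prod_cons, Pi.one_apply,
    one_mul]
  split_ifs with h
  · rw [distSum_cons]
    congr 1
    refine Multiset.map_congr rfl fun p _ => ?_
    refine if_congr ?_ (by simp) rfl
    simp only
    omega
  · refine (congrArg Multiset.sum (Multiset.map_congr rfl (g := fun _ => (0 : k)) fun p _ => ?_)).trans
      (by simp)
    rw [if_neg]
    omega

/-- The number of distributions of signed blocks, with total size `z` of the zero block and with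
sizes `U` of the other blocks, which have the type `(b₀, bs)`. -/
def signedDist (z : ℕ) (U : Multiset ℕ) (b₀ : ℕ) (bs : List ℕ) : k :=
  if z ≤ b₀ then distSum ((1, b₀ - z) :: bs.map fun b => (2, b)) U else 0

/-- The combinatorial form of the compatibility of the characters with `β`: only the difference of
the zero block and the first part matters. -/
theorem signedDist_succ (z : ℕ) (U : Multiset ℕ) (b₀ : ℕ) (bs : List ℕ) :
    (signedDist (z + 1) U (b₀ + 1) bs : k) = signedDist z U b₀ bs := by
  simp [signedDist]

theorem signedDist_of_lt {z b₀ : ℕ} (h : b₀ < z) (U : Multiset ℕ) (bs : List ℕ) :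
    (signedDist z U b₀ bs : k) = 0 := if_neg (by omega)

/-- The weight `altWeight + 1` is `2` on odd and `0` on even block sizes. So the even blocks all
join the first entry, where together they act as a zero block, and the odd ones behave like signed
blocks. -/
theorem distSum_peak_eq_signedDist (b₀ : ℕ) (bs : List ℕ) (U : Multiset ℕ) :
    distSum ((1, b₀) :: bs.map fun b => ((altWeight + 1 : ℕ → k), b)) U
      = signedDist (U.filter fun x => Even x).sum (U.filter fun x => ¬ Even x) b₀ bs := by
  conv_lhs => rw [← Multiset.filter_add_not (fun x => Even x) U]
  have hO : ∀ x ∈ U.filter fun x => ¬ Even x, ¬ Even x := fun x hx => (Multiset.mem_filter.mp hx).2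
  have hE : ∀ x ∈ U.filter fun x => Even x, Even x := fun x hx => (Multiset.mem_filter.mp hx).2
  revert hO hE
  generalize (U.filter fun x => ¬ Even x) = O
  generalize (U.filter fun x => Even x) = E
  intro hO
  induction E using Multiset.induction_on generalizing b₀ with
  | empty =>
    intro _
    simp only [zero_add, signedDist, Multiset.sum_zero, Nat.zero_le, if_true, Nat.sub_zero,
      distSum_cons]
    congr 1
    refine Multiset.map_congr rfl fun p hp => ?_
    rw [mem_antidiagonal] at hp
    rw [distSum_map_congr bs fun x hx => ?_]
    have h1 : Even (x + 1) := Nat.even_add_one.mpr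
      (hO x (hp ▸ Multiset.mem_add.mpr (Or.inr hx)))
    simp [altWeight, h1.neg_one_pow, one_add_one_eq_two]
  | cons a E ih =>
    intro hE
    have ha : Even a := hE a (Multiset.mem_cons_self _ _)
    have hw : (altWeight + 1 : ℕ → k) a = 0 := by
      have h1 : Odd (a + 1) := ha.add_one
      simp [altWeight, h1.neg_one_pow]
    rw [Multiset.cons_add, distSum_cons_map_cons hw, Multiset.sum_cons]
    split_ifs with h
    · rw [ih _ fun x hx => hE x (Multiset.mem_cons_of_mem hx), signedDist, signedDist]
      refine if_ctx_congr (by omega) (fun _ => ?_) fun _ => rfl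
      rw [Nat.sub_sub]
    · rw [signedDist_of_lt (by omega)]

/-! ### Triangularity of the distribution numbers -/

theorem exists_of_sum_ne_zero {W : Multiset (Multiset ℕ × Multiset ℕ)}
    {F : Multiset ℕ × Multiset ℕ → k} (h : (W.map F).sum ≠ 0) : ∃ p ∈ W, F p ≠ 0 := by
  by_contra! h0
  exact h ((congrArg Multiset.sum (Multiset.map_congr rfl (g := fun _ => (0 : k)) h0)).trans
    (by simp))

/-- Every entry has positive size and needs at least one block; when the numbers agree, each entry
receives exactly one block of its own size. -/
theorem length_le_of_distSum_ne_zero {w : ℕ → k} {bs : List ℕ} (hbs : ∀ b ∈ bs, 0 < b)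
    {U : Multiset ℕ} (h : distSum (bs.map fun b => (w, b)) U ≠ 0) :
    bs.length ≤ U.card ∧ (U.card = bs.length → U = bs) := by
  induction bs generalizing U with
  | nil =>
    simp only [List.map_nil, distSum, ne_eq, ite_eq_right_iff, one_ne_zero, imp_false,
      not_not] at h
    simp [h]
  | cons b bs ih =>
    obtain ⟨p, hp, hne⟩ := exists_of_sum_ne_zero h
    rw [mem_antidiagonal] at hp
    simp only [ne_eq, ite_eq_right_iff, Classical.not_imp] at hne
    obtain ⟨hs, hne⟩ := hne
    obtain ⟨h1, h2⟩ := ih (fun b hb => hbs b (List.mem_cons_of_mem _ hb)) (right_ne_zero_of_mul hne)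
    have hb := hbs b List.mem_cons_self
    have h3 : p.1.card ≠ 0 := by
      intro h0
      rw [Multiset.card_eq_zero] at h0
      rw [h0] at hs
      simp at hs
      omega
    rw [← hp, Multiset.card_add, List.length_cons]
    refine ⟨by omega, fun hc => ?_⟩
    obtain ⟨x, hx⟩ := Multiset.card_eq_one.mp (by omega : p.1.card = 1)
    rw [hx] at hs
    simp only [Multiset.sum_singleton] at hs
    rw [hx, hs, h2 (by omega)]
    rfl

/-- The value is `2` to the number of parts times the product of the factorials of their
multiplicities. It is computed one entry at a time: there are `count b` choices of the block for the
entry `b`, each with weight `2`. -/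
theorem distSum_self_ne_zero (h2 : (2 : k) ≠ 0) {bs : List ℕ} (hbs : ∀ b ∈ bs, 0 < b)
    (hk : ∀ m : ℕ, 0 < m → m ≤ bs.length → (m : k) ≠ 0) :
    distSum (bs.map fun b => ((2 : ℕ → k), b)) (bs : Multiset ℕ) ≠ 0 := by
  induction bs with
  | nil => simp [distSum]
  | cons b bs ih =>
    have hbs' : ∀ b ∈ bs, 0 < b := fun b hb => hbs b (List.mem_cons_of_mem _ hb)
    have hb := hbs b List.mem_cons_self
    have h1 : distSum ((b :: bs).map fun b => ((2 : ℕ → k), b)) ((b :: bs : List ℕ) : Multiset ℕ)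
        = ((b :: bs : List ℕ) : Multiset ℕ).count b
          * (2 * distSum (bs.map fun b => ((2 : ℕ → k), b)) (bs : Multiset ℕ)) := by
      rw [← sum_antidiagonal_fst_eq_singleton, ← Multiset.sum_map_mul_right, List.map_cons,
        distSum_cons]
      congr 1
      refine Multiset.map_congr rfl fun p hp => ?_
      rw [mem_antidiagonal] at hp
      by_cases hp1 : p.1 = {b}
      · have hp2 : p.2 = bs := by
          rw [hp1, ← Multiset.cons_coe, ← Multiset.singleton_add] at hp
          exact add_left_cancel hp
        simp [hp1, hp2]
      -- The remaining entries need at least one block each, so only a single block is left for the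
      -- first entry.
      · rw [if_neg hp1, zero_mul]
        by_contra hne
        rw [ite_eq_right_iff, Classical.not_imp] at hne
        obtain ⟨hs, hne⟩ := hne
        obtain ⟨h3, -⟩ := length_le_of_distSum_ne_zero hbs' (right_ne_zero_of_mul hne)
        have h4 := congrArg Multiset.card hp
        rw [Multiset.card_add, Multiset.coe_card, List.length_cons] at h4
        have h5 : p.1.card ≠ 0 := by
          intro h0
          rw [Multiset.card_eq_zero] at h0
          rw [h0] at hs
          simp at hs
          omega
        obtain ⟨x, hx⟩ := Multiset.card_eq_one.mp (by omega : p.1.card = 1)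
        rw [hx] at hs
        simp only [Multiset.sum_singleton] at hs
        exact hp1 (by rw [hx, hs])
    rw [h1]
    refine mul_ne_zero (hk _ ?_ ?_) (mul_ne_zero h2 (ih hbs' fun m hm hm' => hk m hm ?_))
    · exact Multiset.count_pos.mpr (by simp)
    · exact (Multiset.count_le_card _ _).trans (by simp)
    · rw [List.length_cons]
      omega

/-- Triangularity with respect to the number of nonzero blocks; equality of the numbers leaves no
block for the first part beyond the zero block. -/
theorem signedDist_ne_zero {z b₀ : ℕ} {U : Multiset ℕ} {bs : List ℕ} (hbs : ∀ b ∈ bs, 0 < b)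
    (h : (signedDist z U b₀ bs : k) ≠ 0) :
    z ≤ b₀ ∧ bs.length ≤ U.card ∧ (U.card = bs.length → z = b₀ ∧ U = bs) := by
  rw [signedDist] at h
  simp only [ne_eq, ite_eq_right_iff, Classical.not_imp] at h
  obtain ⟨hz, h⟩ := h
  obtain ⟨p, hp, hne⟩ := exists_of_sum_ne_zero h
  rw [mem_antidiagonal] at hp
  simp only [ne_eq, ite_eq_right_iff, Classical.not_imp] at hne
  obtain ⟨hs, hne⟩ := hne
  obtain ⟨h1, h2⟩ := length_le_of_distSum_ne_zero hbs (right_ne_zero_of_mul hne)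
  have h3 := congrArg Multiset.card hp
  rw [Multiset.card_add] at h3
  refine ⟨hz, by omega, fun hc => ?_⟩
  have h4 : p.1 = 0 := Multiset.card_eq_zero.mp (by omega)
  rw [h4, zero_add] at hp
  rw [h4, Multiset.sum_zero] at hs
  exact ⟨by omega, by rw [← hp]; exact h2 (by omega)⟩

theorem signedDist_self_ne_zero (h2 : (2 : k) ≠ 0) (z : ℕ) {bs : List ℕ} (hbs : ∀ b ∈ bs, 0 < b)
    (hk : ∀ m : ℕ, 0 < m → m ≤ bs.length → (m : k) ≠ 0) :
    (signedDist z (bs : Multiset ℕ) z bs : k) ≠ 0 := by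
  rw [signedDist, if_pos le_rfl, Nat.sub_self, distSum_cons_zero _ _ (by simpa using hbs)]
  exact distSum_self_ne_zero h2 hbs hk

end DistSum

/-! ### Counting functions which are constant on blocks -/

section Count

variable {k : Type*} [Field k] {L : Type*} [DecidableEq L]

theorem sum_antidiagonal_map {R : Type*} [AddCommMonoid R] (ν : L → ℕ) (S : Finset L)
    (F : Multiset ℕ × Multiset ℕ → R) :
    ((Multiset.antidiagonal (S.val.map ν)).map F).sum
      = ∑ T ∈ S.powerset, F (T.val.map ν, (S \ T).val.map ν) := by
  induction S using Finset.induction_on generalizing F with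
  | empty => simp
  | insert a S ha ih =>
    rw [Finset.insert_val_of_notMem ha, Multiset.map_cons, sum_antidiagonal_cons, ih, ih,
      Finset.sum_powerset_insert ha]
    congr 1
    · refine Finset.sum_congr rfl fun T hT => ?_
      have hT' : a ∉ T := fun h => ha (Finset.mem_powerset.mp hT h)
      rw [Finset.insert_sdiff_of_notMem _ hT', Finset.insert_val_of_notMem (by simp [ha]),
        Multiset.map_cons]
    · refine Finset.sum_congr rfl fun T hT => ?_
      have hT' : a ∉ T := fun h => ha (Finset.mem_powerset.mp hT h)
      have h1 : insert a S \ insert a T = S \ T := by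
        ext x
        simp only [Finset.mem_sdiff, Finset.mem_insert]
        constructor
        · tauto
        · rintro ⟨h2, h3⟩
          refine ⟨Or.inr h2, ?_⟩
          rintro (rfl | h4)
          · exact ha h2
          · exact h3 h4
      rw [h1, Finset.insert_val_of_notMem hT', Multiset.map_cons]

/-- Distributions are encoded as functions `p` from labels to entry indices, with the dummy value
`0` outside `S`. The induction separates the set `T` of labels sent to the first entry. -/
theorem sum_piFinset_eq_distSum [Fintype L] (ν : L → ℕ) (G : List (k × ℕ)) (S : Finset L) :
    (∑ p ∈ Fintype.piFinset (fun s => if s ∈ S then Finset.range G.length else {0}),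
      if ∀ r < G.length, ∑ s ∈ S with p s = r, ν s = (G.getD r (0, 0)).2
        then ∏ s ∈ S, (G.getD (p s) (0, 0)).1 else 0)
      = distSum (G.map fun g => ((fun _ => g.1), g.2)) (S.val.map ν) := by
  induction G generalizing S with
  | nil =>
    simp only [List.length_nil, Finset.range_zero, not_lt_zero, IsEmpty.forall_iff, implies_true,
      if_true, List.map_nil, distSum, Multiset.map_eq_zero, Finset.val_eq_zero]
    rcases S.eq_empty_or_nonempty with rfl | ⟨s, hs⟩
    · simp
    · rw [if_neg (Finset.ne_empty_of_mem hs)]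
      refine (Finset.sum_eq_zero fun p hp => ?_)
      have := Fintype.mem_piFinset.mp hp s
      simp [hs] at this
  | cons g G ih =>
    rw [List.map_cons, distSum_cons]
    refine Eq.trans ?_ (sum_antidiagonal_map ν S _).symm
    have hmaps : ∀ p ∈ Fintype.piFinset (fun s => if s ∈ S then Finset.range (g :: G).length
        else {0}), (S.filter fun s => p s = 0) ∈ S.powerset := fun p _ =>
      Finset.mem_powerset.mpr (Finset.filter_subset (fun s => p s = 0) S)
    rw [← Finset.sum_fiberwise_of_maps_to hmaps]
    refine Finset.sum_congr rfl fun T hT => ?_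
    rw [Finset.mem_powerset] at hT
    simp only
    rw [← ih (S \ T)]
    have hsum : (T.val.map ν).sum = ∑ s ∈ T, ν s := rfl
    have hprod : ((T.val.map ν).map fun _ => g.1).prod = ∏ s ∈ T, g.1 := by
      rw [Multiset.map_map]; rfl
    rw [hsum, hprod]
    by_cases hc : ∑ s ∈ T, ν s = g.2
    swap
    · rw [if_neg hc]
      refine Finset.sum_eq_zero fun p hp => if_neg fun h => hc ?_
      have h1 := h 0 (by simp)
      rwa [(Finset.mem_filter.mp hp).2] at h1
    rw [if_pos hc, Finset.mul_sum]
    have hA : ∀ p ∈ (Fintype.piFinset (fun s => if s ∈ S then Finset.range (g :: G).length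
        else {0})).filter (fun p => S.filter (fun s => p s = 0) = T),
        (∀ s ∈ S, s ∉ T → 0 < p s ∧ p s < G.length + 1) ∧ (∀ s ∈ T, p s = 0) ∧
          ∀ s ∉ S, p s = 0 := by
      intro p hp
      obtain ⟨hp, hT'⟩ := Finset.mem_filter.mp hp
      rw [Fintype.mem_piFinset] at hp
      refine ⟨fun s hs hsT => ⟨?_, ?_⟩, fun s hs => ?_, fun s hs => ?_⟩
      · rw [Nat.pos_iff_ne_zero]
        exact fun h0 => hsT (hT' ▸ Finset.mem_filter.mpr ⟨hs, h0⟩)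
      · simpa [hs] using hp s
      · rw [← hT'] at hs
        exact (Finset.mem_filter.mp hs).2
      · simpa [hs] using hp s
    -- Dropping the first entry lowers the indices on `S \ T` by one; truncated subtraction leaves
    -- the dummy value `0` elsewhere.
    refine Finset.sum_bij' (fun p _ s => p s - 1)
      (fun p _ s => if s ∈ S \ T then p s + 1 else 0) ?_ ?_ ?_ ?_ ?_
    · intro p hp
      obtain ⟨h1, h2, h3⟩ := hA p hp
      rw [Fintype.mem_piFinset]
      intro s
      by_cases hs : s ∈ S \ T
      · rw [if_pos hs, Finset.mem_range]
        obtain ⟨hs1, hs2⟩ := Finset.mem_sdiff.mp hs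
        have := h1 s hs1 hs2
        omega
      · rw [if_neg hs, Finset.mem_singleton]
        by_cases hs1 : s ∈ S
        · have hs2 : s ∈ T := by
            by_contra h
            exact hs (Finset.mem_sdiff.mpr ⟨hs1, h⟩)
          rw [h2 s hs2]
        · rw [h3 s hs1]
    · intro p hp
      rw [Fintype.mem_piFinset] at hp
      rw [Finset.mem_filter, Fintype.mem_piFinset]
      constructor
      · intro s
        have := hp s
        by_cases hs : s ∈ S \ T
        · rw [if_pos hs, Finset.mem_range] at this
          rw [if_pos (Finset.mem_sdiff.mp hs).1, if_pos hs]
          simpa using this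
        · rw [if_neg hs]
          split_ifs <;> simp
      · ext s
        rw [Finset.mem_filter]
        constructor
        · rintro ⟨h1, h2⟩
          by_contra h3
          simp [h1, h3] at h2
        · intro h
          exact ⟨hT h, by simp [h]⟩
    · intro p hp
      obtain ⟨h1, h2, h3⟩ := hA p hp
      funext s
      simp only
      by_cases hs1 : s ∈ S
      · by_cases hs2 : s ∈ T
        · simp [hs2, h2 s hs2]
        · have := h1 s hs1 hs2
          rw [if_pos (Finset.mem_sdiff.mpr ⟨hs1, hs2⟩)]
          omega
      · simp [hs1, h3 s hs1]
    · intro p hp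
      rw [Fintype.mem_piFinset] at hp
      funext s
      have := hp s
      by_cases hs : s ∈ S \ T
      · simp only [if_pos hs, Nat.add_sub_cancel]
      · rw [if_neg hs, Finset.mem_singleton] at this
        simp only [if_neg hs, this]
    · intro p hp
      obtain ⟨h1, h2, h3⟩ := hA p hp
      have hfil : ∀ r, S.filter (fun s => p s = r + 1) = (S \ T).filter fun s => p s - 1 = r := by
        intro r
        ext s
        simp only [Finset.mem_filter, Finset.mem_sdiff]
        constructor
        · rintro ⟨h4, h5⟩
          refine ⟨⟨h4, fun h6 => ?_⟩, by omega⟩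
          have := h2 s h6
          omega
        · rintro ⟨⟨h4, h5⟩, h6⟩
          have := h1 s h4 h5
          exact ⟨h4, by omega⟩
      have hcond : (∀ r < (g :: G).length, ∑ s ∈ S with p s = r, ν s
            = ((g :: G).getD r (0, 0)).2) ↔
          ∀ r < G.length, ∑ s ∈ S \ T with p s - 1 = r, ν s = (G.getD r (0, 0)).2 := by
        constructor
        · intro h r hr
          rw [← hfil, h (r + 1) (by simpa using hr)]
          simp
        · intro h r hr
          rcases r with _ | r
          · rw [(Finset.mem_filter.mp hp).2, hc]
            simp
          · rw [hfil, h r (by simpa using hr)]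
            simp
      rw [if_congr hcond rfl rfl, mul_ite, mul_zero]
      congr 1
      rw [← Finset.prod_sdiff hT, mul_comm]
      congr 1
      · refine Finset.prod_congr rfl fun s hs => ?_
        rw [h2 s hs]
        simp
      · refine Finset.prod_congr rfl fun s hs => ?_
        obtain ⟨hs1, hs2⟩ := Finset.mem_sdiff.mp hs
        obtain ⟨r, hr⟩ : ∃ r, p s = r + 1 := ⟨p s - 1, by have := h1 s hs1 hs2; omega⟩
        simp [hr]

/-- The number of integer functions which are constant on the blocks of `lab`, vanish on the blocks
outside `S`, have values in `Al r` in absolute value `r`, and prescribed fiber sizes. -/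
theorem ncard_blockFun_eq_distSum {ι : Type*} [Fintype ι] [Fintype L] (lab : ι → L)
    (S : Finset L) (hlab : ∀ s ∈ S, ∃ i, lab i = s) (Al : ℕ → Finset ℤ)
    (hAl : ∀ r, ∀ x ∈ Al r, x.natAbs = r) (b₀ : ℕ) (bs : List ℕ)
    (h0 : (Al 0).card = 1) (w : ℕ) (hw : ∀ r, (Al (r + 1)).card = w) :
    (Set.ncard {g : ι → ℤ | (∀ i j, lab i = lab j → g i = g j) ∧ (∀ i, lab i ∉ S → g i = 0) ∧
        (∀ i, lab i ∈ S → g i ∈ Al (g i).natAbs) ∧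
        ∀ r, (Finset.univ.filter fun i => (g i).natAbs = r).card = (b₀ :: bs).getD r 0} : k)
      = if (Finset.univ.filter fun i => lab i ∉ S).card ≤ b₀ then
          distSum ((1, b₀ - (Finset.univ.filter fun i => lab i ∉ S).card) ::
              bs.map fun b => ((fun _ => (w : k)), b))
            (S.val.map fun s => (Finset.univ.filter fun i => lab i = s).card)
        else 0 := by
  classical
  set z := (Finset.univ.filter fun i => lab i ∉ S).card with hz
  set ν : L → ℕ := fun s => (Finset.univ.filter fun i => lab i = s).card with hν
  set m := (b₀ :: bs).length with hm
  -- Block functions are replaced by functions of the labels. The blocks outside `S` have value `0`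
  -- and contribute their total size `z` to the fiber of `0`.
  set Q : Finset (L → ℤ) := (Fintype.piFinset fun s =>
      if s ∈ S then (Finset.range m).biUnion Al else {0}).filter fun q =>
    ∀ r < m, (if r = 0 then z else 0) + ∑ s ∈ S with (q s).natAbs = r, ν s
      = (b₀ :: bs).getD r 0 with hQ
  have hfib : ∀ (q : L → ℤ), (∀ s ∉ S, q s = 0) → ∀ r,
      (Finset.univ.filter fun i => (q (lab i)).natAbs = r).card
        = (if r = 0 then z else 0) + ∑ s ∈ S with (q s).natAbs = r, ν s := by
    intro q hq r
    rw [← Finset.card_filter_add_card_filter_not (p := fun i => lab i ∉ S), Finset.filter_filter,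
      Finset.filter_filter]
    congr 1
    · split_ifs with hr
      · rw [hz]
        congr 1
        ext i
        simp only [Finset.mem_filter, Finset.mem_univ, true_and, and_iff_right_iff_imp]
        intro hi
        rw [hq _ hi, hr]
        rfl
      · rw [Finset.card_eq_zero, Finset.filter_eq_empty_iff]
        rintro i - ⟨h1, h2⟩
        rw [hq _ h2] at h1
        exact hr h1.symm
    · rw [Finset.card_eq_sum_card_fiberwise (f := lab) (t := S.filter fun s => (q s).natAbs = r)]
      · refine Finset.sum_congr rfl fun s hs => ?_
        rw [hν, Finset.filter_filter]
        congr 1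
        ext i
        simp only [Finset.mem_filter, Finset.mem_univ, true_and, not_not]
        constructor
        · exact fun h => h.2
        · rintro rfl
          exact ⟨⟨(Finset.mem_filter.mp hs).2, (Finset.mem_filter.mp hs).1⟩, rfl⟩
      · intro i hi
        simp only [not_not, Finset.coe_filter, Finset.mem_univ, true_and] at hi ⊢
        exact ⟨hi.2, hi.1⟩
  have hset : {g : ι → ℤ | (∀ i j, lab i = lab j → g i = g j) ∧ (∀ i, lab i ∉ S → g i = 0) ∧
        (∀ i, lab i ∈ S → g i ∈ Al (g i).natAbs) ∧
        ∀ r, (Finset.univ.filter fun i => (g i).natAbs = r).card = (b₀ :: bs).getD r 0}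
      = (fun (q : L → ℤ) i => q (lab i)) '' (Q : Set (L → ℤ)) := by
    ext g
    constructor
    · rintro ⟨h1, h2, h3, h4⟩
      choose sec hsec using hlab
      set q : L → ℤ := fun s => if hs : s ∈ S then g (sec s hs) else 0 with hq
      have hqS : ∀ s (hs : s ∈ S), q s = g (sec s hs) := fun s hs => dif_pos hs
      have hq0 : ∀ s ∉ S, q s = 0 := fun s hs => dif_neg hs
      have hg : ∀ i, q (lab i) = g i := fun i => by
        by_cases hi : lab i ∈ S
        · rw [hqS _ hi]
          exact h1 _ _ (hsec _ hi)
        · rw [hq0 _ hi, h2 _ hi]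
      have hlt : ∀ i, (g i).natAbs < m := by
        intro i
        by_contra hle
        have h5 := h4 (g i).natAbs
        rw [List.getD_eq_default _ _ (by omega), Finset.card_eq_zero,
          Finset.filter_eq_empty_iff] at h5
        exact h5 (Finset.mem_univ i) rfl
      refine ⟨q, ?_, funext hg⟩
      rw [Finset.mem_coe, hQ, Finset.mem_filter, Fintype.mem_piFinset]
      refine ⟨fun s => ?_, fun r hr => ?_⟩
      · split_ifs with hs
        · rw [Finset.mem_biUnion]
          rw [hqS _ hs]
          exact ⟨_, Finset.mem_range.mpr (hlt _), h3 _ (by rwa [hsec])⟩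
        · simpa using hq0 s hs
      · rw [← hfib _ hq0, ← h4]
        simp only [hg]
    · rintro ⟨q, hq, rfl⟩
      rw [Finset.mem_coe, hQ, Finset.mem_filter, Fintype.mem_piFinset] at hq
      obtain ⟨h1, h2⟩ := hq
      have h3 : ∀ s ∉ S, q s = 0 := fun s hs => by simpa [hs] using h1 s
      have h4 : ∀ s ∈ S, ∃ r < m, q s ∈ Al r := fun s hs => by
        have := h1 s
        rw [if_pos hs, Finset.mem_biUnion] at this
        obtain ⟨r, hr, hr'⟩ := this
        exact ⟨r, Finset.mem_range.mp hr, hr'⟩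
      refine ⟨fun i j hij => by simp only [hij], fun i hi => h3 _ hi, fun i hi => ?_, fun r => ?_⟩
      · obtain ⟨r, -, hr⟩ := h4 _ hi
        rwa [hAl _ _ hr]
      · rw [hfib q h3]
        by_cases hr : r < m
        · exact h2 r hr
        · rw [List.getD_eq_default _ _ (by omega), if_neg (by rw [hm, List.length_cons] at hr; omega),
            Finset.filter_false_of_mem, Finset.sum_empty, add_zero]
          intro s hs hsr
          obtain ⟨r', hr', hx⟩ := h4 s hs
          have := hAl _ _ hx
          omega
  have hinj : Set.InjOn (fun (q : L → ℤ) i => q (lab i)) Q := fun q hq q' hq' h => by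
    rw [Finset.mem_coe, hQ, Finset.mem_filter, Fintype.mem_piFinset] at hq hq'
    funext s
    by_cases hs : s ∈ S
    · obtain ⟨i, rfl⟩ := hlab s hs
      exact congrFun h i
    · have h1 := hq.1 s
      have h2 := hq'.1 s
      rw [if_neg hs, Finset.mem_singleton] at h1 h2
      rw [h1, h2]
  rw [hset, hinj.ncard_image, Set.ncard_coe_finset]
  -- The label functions are grouped by their absolute values `p`. For fixed `p` the values are
  -- chosen independently, in one way where `p` is `0` and in `w` ways elsewhere.
  rw [Finset.card_eq_sum_card_fiberwise (f := fun (q : L → ℤ) s => (q s).natAbs)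
    (t := Fintype.piFinset fun s => if s ∈ S then Finset.range m else {0})]
  swap
  · intro q hq
    rw [Finset.mem_coe, hQ, Finset.mem_filter, Fintype.mem_piFinset] at hq
    rw [Finset.mem_coe, Fintype.mem_piFinset]
    intro s
    have := hq.1 s
    split_ifs with hs
    · rw [if_pos hs, Finset.mem_biUnion] at this
      obtain ⟨r, hr, hr'⟩ := this
      simp only
      rwa [hAl _ _ hr']
    · rw [if_neg hs, Finset.mem_singleton] at this
      simp [this]
  rw [Nat.cast_sum]
  have hcard : ∀ p ∈ Fintype.piFinset (fun s => if s ∈ S then Finset.range m else {0}),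
      ((Q.filter fun q => (fun s => (q s).natAbs) = p).card : k)
        = if z ≤ b₀ then
            (if ∀ r < m, ∑ s ∈ S with p s = r, ν s
                = ((((1 : k), b₀ - z) :: bs.map fun b => ((w : k), b)).getD r (0, 0)).2
              then ∏ s ∈ S, ((((1 : k), b₀ - z) :: bs.map fun b => ((w : k), b)).getD (p s) (0, 0)).1
              else 0) else 0 := by
    intro p hp
    rw [Fintype.mem_piFinset] at hp
    have hG2 : ∀ r, ((((1 : k), b₀ - z) :: bs.map fun b => ((w : k), b)).getD (r + 1) (0, 0)).2
        = bs.getD r 0 := by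
      intro r
      simp only [List.getD_eq_getElem?_getD, List.getElem?_cons_succ, List.getElem?_map]
      cases bs[r]? <;> rfl
    have hG1 : ∀ r < bs.length,
        ((((1 : k), b₀ - z) :: bs.map fun b => ((w : k), b)).getD (r + 1) (0, 0)).1 = w := by
      intro r hr
      simp [List.getD_eq_getElem?_getD, hr]
    have hC : (∀ r < m, (if r = 0 then z else 0) + ∑ s ∈ S with p s = r, ν s
          = (b₀ :: bs).getD r 0) ↔ (z ≤ b₀ ∧ ∀ r < m, ∑ s ∈ S with p s = r, ν s
                = ((((1 : k), b₀ - z) :: bs.map fun b => ((w : k), b)).getD r (0, 0)).2) := by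
      constructor
      · intro h
        have h5 := h 0 (by simp [hm])
        simp only [if_true, List.getD_cons_zero] at h5
        refine ⟨by omega, fun r hr => ?_⟩
        rcases r with _ | r
        · simp only [List.getD_cons_zero]
          omega
        · rw [hG2]
          simpa using h (r + 1) hr
      · rintro ⟨h5, h6⟩ r hr
        have h7 := h6 r hr
        rcases r with _ | r
        · simp only [List.getD_cons_zero] at h7
          simp only [if_true, List.getD_cons_zero]
          omega
        · rw [hG2] at h7
          simpa using h7
    rw [← ite_and, ← if_congr hC rfl rfl]
    split_ifs with h
    · have hfil : (Q.filter fun q => (fun s => (q s).natAbs) = p)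
          = Fintype.piFinset fun s => if s ∈ S then Al (p s) else {0} := by
        ext q
        rw [Finset.mem_filter, hQ, Finset.mem_filter, Fintype.mem_piFinset, Fintype.mem_piFinset]
        constructor
        · rintro ⟨⟨h1, h2⟩, rfl⟩ s
          have := h1 s
          split_ifs with hs
          · rw [if_pos hs, Finset.mem_biUnion] at this
            obtain ⟨r, -, hr⟩ := this
            simp only
            rwa [hAl _ _ hr]
          · rwa [if_neg hs] at this
        · intro h1
          have h2 : (fun s => (q s).natAbs) = p := by
            funext s
            have h3 := h1 s
            have h4 := hp s
            by_cases hs : s ∈ S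
            · rw [if_pos hs] at h3
              exact hAl _ _ h3
            · rw [if_neg hs, Finset.mem_singleton] at h3 h4
              rw [h3, h4]
              rfl
          refine ⟨⟨fun s => ?_, fun r hr => ?_⟩, h2⟩
          · have h3 := h1 s
            have h4 := hp s
            split_ifs with hs
            · rw [if_pos hs] at h3 h4
              exact Finset.mem_biUnion.mpr ⟨_, h4, h3⟩
            · rwa [if_neg hs] at h3
          · rw [← h r hr]
            simp only [← h2]
      rw [hfil, Fintype.card_piFinset, Nat.cast_prod,
        ← Finset.prod_subset (Finset.subset_univ S) fun s _ hs => by simp [hs]]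
      refine Finset.prod_congr rfl fun s hs => ?_
      have h4 := hp s
      rw [if_pos hs, Finset.mem_range] at h4
      rw [if_pos hs]
      rcases hps : p s with _ | r
      · simp [h0]
      · rw [hG1 r (by rw [hps, hm, List.length_cons] at h4; omega), hw]
    · rw [Finset.filter_false_of_mem, Finset.card_empty, Nat.cast_zero]
      rintro q hq rfl
      exact h (Finset.mem_filter.mp hq).2
  rw [Finset.sum_congr rfl hcard]
  split_ifs with hzb
  · have hlen : m = (((1 : k), b₀ - z) :: bs.map fun b => ((w : k), b)).length := by simp [hm]
    rw [hlen]
    refine (sum_piFinset_eq_distSum ν _ S).trans ?_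
    congr 1
    simp
    rfl
  · simp

end Count

/-! ### Compositions as lists -/

/-- The index of the part of the composition `cs` which contains the position `i`. -/
def blk : List ℕ → ℕ → ℕ
  | [], _ => 0
  | c :: cs, i => if i < c then 0 else blk cs (i - c) + 1

theorem blk_cons_of_lt {c : ℕ} (cs : List ℕ) {i : ℕ} (h : i < c) : blk (c :: cs) i = 0 := by
  simp [blk, h]

theorem blk_cons_add (c : ℕ) (cs : List ℕ) (i : ℕ) : blk (c :: cs) (c + i) = blk cs i + 1 := by
  simp [blk]

theorem blk_succ_cons_succ (c : ℕ) (cs : List ℕ) (i : ℕ) :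
    blk ((c + 1) :: cs) (i + 1) = blk (c :: cs) i := by
  simp [blk]

theorem blk_succ_cons_zero (c : ℕ) (cs : List ℕ) : blk ((c + 1) :: cs) 0 = 0 := by
  simp [blk]

theorem blk_mono (cs : List ℕ) : Monotone (blk cs) := by
  induction cs with
  | nil => exact fun i j _ => le_rfl
  | cons c cs ih =>
    intro i j hij
    rw [blk, blk]
    split_ifs
    · exact le_rfl
    · exact Nat.zero_le _
    · omega
    · exact Nat.succ_le_succ (ih (by omega))

theorem blk_lt_length {cs : List ℕ} {i : ℕ} (h : i < cs.sum) : blk cs i < cs.length := by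
  induction cs generalizing i with
  | nil => simp at h
  | cons c cs ih =>
    rw [List.sum_cons] at h
    rw [blk, List.length_cons]
    split_ifs
    · omega
    · have := @ih (i - c) (by omega)
      omega

theorem card_blk_eq (cs : List ℕ) (r : ℕ) :
    ((Finset.range cs.sum).filter fun i => blk cs i = r).card = cs.getD r 0 := by
  induction cs generalizing r with
  | nil => simp
  | cons c cs ih =>
    rw [List.sum_cons, Finset.range_eq_Ico,
      ← Finset.Ico_union_Ico_eq_Ico (Nat.zero_le c) (Nat.le_add_right c cs.sum),
      Finset.filter_union, Finset.card_union_of_disjoint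
        (Finset.disjoint_filter_filter (Finset.Ico_disjoint_Ico_consecutive _ _ _))]
    have h1 : ((Finset.Ico 0 c).filter fun i => blk (c :: cs) i = r).card
        = if r = 0 then c else 0 := by
      split_ifs with hr
      · rw [Finset.filter_true_of_mem, Nat.card_Ico, Nat.sub_zero]
        intro i hi
        rw [blk_cons_of_lt _ (Finset.mem_Ico.mp hi).2, hr]
      · rw [Finset.filter_false_of_mem, Finset.card_empty]
        intro i hi
        rw [blk_cons_of_lt _ (Finset.mem_Ico.mp hi).2]
        exact Ne.symm hr
    have h2 : ((Finset.Ico c (c + cs.sum)).filter fun i => blk (c :: cs) i = r).card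
        = ((Finset.range cs.sum).filter fun i => blk cs i + 1 = r).card := by
      refine Eq.trans ?_ (Finset.card_image_of_injective _ (add_right_injective c))
      congr 1
      ext i
      simp only [Finset.mem_filter, Finset.mem_Ico, Finset.mem_image, Finset.mem_range]
      constructor
      · rintro ⟨⟨h3, h4⟩, h5⟩
        refine ⟨i - c, ⟨by omega, ?_⟩, by omega⟩
        rw [← h5, ← blk_cons_add]
        congr 1
        omega
      · rintro ⟨j, ⟨h3, h4⟩, rfl⟩
        exact ⟨⟨by omega, by omega⟩, by rw [blk_cons_add, h4]⟩
    rw [h1, h2]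
    rcases r with _ | r
    · simp
    · simp only [Nat.add_right_cancel_iff, ih]
      simp

theorem card_fin_blk_eq {n : ℕ} {cs : List ℕ} (h : cs.sum = n) (r : ℕ) :
    (Finset.univ.filter fun i : Fin n => blk cs i = r).card = cs.getD r 0 := by
  rw [← card_blk_eq, h, ← Finset.card_map Fin.valEmbedding]
  congr 1
  ext i
  simp only [Finset.mem_map, Finset.mem_filter, Finset.mem_univ, true_and, Fin.valEmbedding_apply,
    Finset.mem_range]
  exact ⟨fun ⟨j, hj, hji⟩ => hji ▸ ⟨j.2, hj⟩, fun ⟨hi, h⟩ => ⟨⟨i, hi⟩, h, rfl⟩⟩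

/-- The positions at which the parts `bs` of a composition begin, the first of them at `o`. -/
def cuts : ℕ → List ℕ → Finset ℕ
  | _, [] => ∅
  | o, b :: bs => insert o (cuts (o + b) bs)

theorem le_of_mem_cuts {o p : ℕ} {bs : List ℕ} (h : p ∈ cuts o bs) : o ≤ p := by
  induction bs generalizing o with
  | nil => simp [cuts] at h
  | cons b bs ih =>
    rcases Finset.mem_insert.mp h with rfl | h
    · exact le_rfl
    · have := ih h
      omega

theorem add_mem_cuts_iff (s : ℕ) {o p : ℕ} {bs : List ℕ} :
    p + s ∈ cuts (o + s) bs ↔ p ∈ cuts o bs := by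
  induction bs generalizing o with
  | nil => simp [cuts]
  | cons b bs ih =>
    rw [cuts, cuts, Finset.mem_insert, Finset.mem_insert, add_right_comm, ih]
    simp

theorem cuts_add (s o : ℕ) (bs : List ℕ) : cuts (o + s) bs = (cuts o bs).image (· + s) := by
  induction bs generalizing o with
  | nil => rfl
  | cons b bs ih => rw [cuts, cuts, Finset.image_insert, add_right_comm, ih]

theorem cuts_subset {o : ℕ} {bs : List ℕ} (hbs : ∀ b ∈ bs, 0 < b) :
    cuts o bs ⊆ Finset.range (o + bs.sum) := by
  induction bs generalizing o with
  | nil => simp [cuts]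
  | cons b bs ih =>
    rw [cuts, Finset.insert_subset_iff, List.sum_cons, ← add_assoc]
    have := hbs b (by simp)
    exact ⟨Finset.mem_range.mpr (by omega), ih fun x hx => hbs x (by simp [hx])⟩

theorem card_cuts {o : ℕ} {bs : List ℕ} (hbs : ∀ b ∈ bs, 0 < b) :
    (cuts o bs).card = bs.length := by
  induction bs generalizing o with
  | nil => rfl
  | cons b bs ih =>
    rw [cuts, Finset.card_insert_of_notMem, ih fun x hx => hbs x (by simp [hx]), List.length_cons]
    intro h
    have := le_of_mem_cuts h
    have := hbs b (by simp)
    omega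

theorem zero_mem_cuts_iff {o : ℕ} {bs : List ℕ} (hbs : ∀ b ∈ bs, 0 < b) (h : 0 < o + bs.sum) :
    0 ∈ cuts o bs ↔ o = 0 := by
  constructor
  · intro h0
    have := le_of_mem_cuts h0
    omega
  · rintro rfl
    rcases bs with _ | ⟨b, bs⟩
    · simp at h
    · exact Finset.mem_insert_self _ _

theorem exists_eq_cuts {n : ℕ} {J : Finset ℕ} (hJ : J ⊆ Finset.range n) :
    ∃ b₀ bs, (∀ b ∈ bs, 0 < b) ∧ b₀ + bs.sum = n ∧ J = cuts b₀ bs := by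
  induction n generalizing J with
  | zero => exact ⟨0, [], by simp, by simp, by simpa [cuts] using hJ⟩
  | succ n ih =>
    have hJ' : (J.erase 0).image (· - 1) ⊆ Finset.range n := by
      intro p hp
      obtain ⟨q, hq, rfl⟩ := Finset.mem_image.mp hp
      obtain ⟨hq0, hq⟩ := Finset.mem_erase.mp hq
      have := Finset.mem_range.mp (hJ hq)
      rw [Finset.mem_range]
      omega
    obtain ⟨b₀, bs, hbs, hsum, h⟩ := ih hJ'
    have h1 : J.erase 0 = cuts (b₀ + 1) bs := by
      rw [cuts_add, ← h, Finset.image_image]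
      ext p
      rw [Finset.mem_image]
      constructor
      · intro hp
        have := (Finset.mem_erase.mp hp).1
        exact ⟨p, hp, by simp only [Function.comp_apply]; omega⟩
      · rintro ⟨q, hq, rfl⟩
        have := (Finset.mem_erase.mp hq).1
        rwa [Function.comp_apply, Nat.sub_add_cancel (by omega)]
    by_cases h0 : 0 ∈ J
    · refine ⟨0, (b₀ + 1) :: bs, ?_, ?_, ?_⟩
      · intro b hb
        rcases List.mem_cons.mp hb with rfl | hb
        · omega
        · exact hbs b hb
      · rw [List.sum_cons]
        omega
      · rw [cuts, zero_add, ← h1, Finset.insert_erase h0]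
    · exact ⟨b₀ + 1, bs, hbs, by omega, by rw [← h1, Finset.erase_eq_of_notMem h0]⟩

/-- The first part is `b₀ + 1` because an artificial position `0` is put in front, matching the
convention `w(0) = 0`; position `i` of `Fin n` becomes `i + 1`. -/
theorem blk_lt_blk_succ_iff {b₀ : ℕ} {bs : List ℕ} (hbs : ∀ b ∈ bs, 0 < b) {p : ℕ}
    (hp : p < b₀ + bs.sum) :
    blk ((b₀ + 1) :: bs) p < blk ((b₀ + 1) :: bs) (p + 1) ↔ p ∈ cuts b₀ bs := by
  induction bs generalizing b₀ p with
  | nil =>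
    rw [List.sum_nil] at hp
    simp [blk, cuts, show p < b₀ + 1 by omega, show p + 1 < b₀ + 1 by omega]
  | cons b bs ih =>
    have hb := hbs b (by simp)
    rw [cuts, Finset.mem_insert]
    rcases lt_trichotomy p b₀ with h | rfl | h
    · rw [blk_cons_of_lt _ (by omega), blk_cons_of_lt _ (by omega)]
      simp only [lt_irrefl, false_iff, not_or]
      exact ⟨by omega, fun h1 => by have := le_of_mem_cuts h1; omega⟩
    · rw [blk_cons_of_lt _ (by omega), ← Nat.add_zero (p + 1), blk_cons_add]
      simp
    · obtain ⟨q, rfl⟩ : ∃ q, p = (b₀ + 1) + q := ⟨p - (b₀ + 1), by omega⟩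
      obtain ⟨b, rfl⟩ : ∃ a, b = a + 1 := ⟨b - 1, by omega⟩
      rw [add_assoc (b₀ + 1), blk_cons_add, blk_cons_add, Nat.add_lt_add_iff_right,
        ih (fun x hx => hbs x (by simp [hx])) (by rw [List.sum_cons] at hp; omega),
        ← add_mem_cuts_iff (b₀ + 1), show b + (b₀ + 1) = b₀ + (b + 1) by omega,
        show q + (b₀ + 1) = b₀ + 1 + q by omega]
      constructor
      · exact Or.inr
      · rintro (h1 | h1)
        · omega
        · exact h1

/-- Two nondecreasing functions with the same jumps have the same order relations. -/
theorem lt_iff_lt_of_jumps {α β : Type*} [LinearOrder α] [LinearOrder β] {n : ℕ} {F : ℕ → α}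
    {B : ℕ → β} (hF : ∀ p < n, F p ≤ F (p + 1)) (hB : ∀ p < n, B p ≤ B (p + 1))
    (h : ∀ p < n, F p < F (p + 1) ↔ B p < B (p + 1)) {p q : ℕ} (hp : p ≤ n) (hq : q ≤ n) :
    F p < F q ↔ B p < B q := by
  have key : ∀ p q, p ≤ q → q ≤ n → F p ≤ F q ∧ B p ≤ B q ∧ (F p < F q ↔ B p < B q) := by
    intro p q hpq
    induction q, hpq using Nat.le_induction with
    | base => exact fun _ => by simp
    | succ q hpq ih =>
      intro hq
      obtain ⟨h1, h2, h3⟩ := ih (by omega)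
      have h4 := hF q (by omega)
      have h5 := hB q (by omega)
      have h6 := h q (by omega)
      refine ⟨h1.trans h4, h2.trans h5, ?_⟩
      rw [h1.trans h4 |>.lt_iff_ne, h2.trans h5 |>.lt_iff_ne]
      rw [h1.lt_iff_ne, h2.lt_iff_ne] at h3
      rw [h4.lt_iff_ne, h5.lt_iff_ne] at h6
      have e1 : F p = F (q + 1) ↔ F p = F q ∧ F q = F (q + 1) :=
        ⟨fun e => ⟨le_antisymm h1 (e ▸ h4), le_antisymm h4 (e ▸ h1)⟩, fun e => e.1.trans e.2⟩
      have e2 : B p = B (q + 1) ↔ B p = B q ∧ B q = B (q + 1) :=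
        ⟨fun e => ⟨le_antisymm h2 (e ▸ h5), le_antisymm h5 (e ▸ h2)⟩, fun e => e.1.trans e.2⟩
      rw [Ne, Ne, e1, e2, not_iff_not.mp h3, not_iff_not.mp h6]
  rcases le_total p q with hpq | hpq
  · exact (key p q hpq hq).2.2
  · obtain ⟨h1, h2, -⟩ := key q p hpq hp
    exact iff_of_false h1.not_gt h2.not_gt

/-- Being increasing on the blocks of a nondecreasing function is a local condition. -/
theorem strictMono_on_blocks_iff {α : Type*} [Preorder α] {n : ℕ} {B : ℕ → ℕ} (hB : Monotone B)
    (a : ℕ → α) :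
    (∀ p q, p < q → q ≤ n → B p = B q → a p < a q) ↔
      ∀ p < n, B p = B (p + 1) → a p < a (p + 1) := by
  refine ⟨fun h p hp => h p (p + 1) (by omega) (by omega), fun h p q hpq => ?_⟩
  induction q, hpq using Nat.le_induction with
  | base => exact fun hq => h p (by omega)
  | succ q hpq ih =>
    intro hq e
    have h1 : B p ≤ B q := hB (by omega)
    have h2 : B q ≤ B (q + 1) := hB (by omega)
    exact (ih (by omega) (by omega)).trans (h q (by omega) (by omega))

/-- Two functions on finite types with the same fiber sizes differ by a bijection. -/
theorem exists_equiv_comp_eq {α β : Type*} [Fintype α] [DecidableEq β] (f g : α → β)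
    (h : ∀ r, (Finset.univ.filter fun i => f i = r).card
      = (Finset.univ.filter fun i => g i = r).card) :
    ∃ σ : Equiv.Perm α, ∀ i, f (σ i) = g i := by
  have e : ∀ r, Nonempty ({i // g i = r} ≃ {i // f i = r}) := fun r => by
    rw [← Fintype.card_eq, Fintype.card_subtype, Fintype.card_subtype, h]
  refine ⟨(Equiv.sigmaFiberEquiv g).symm.trans
    ((Equiv.sigmaCongrRight fun r => (e r).some).trans (Equiv.sigmaFiberEquiv f)), fun i => ?_⟩
  exact ((e (g i)).some ⟨i, rfl⟩).2

/-! ### The hyperplane faces of type `B` -/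

/-- Pairs separated by `f` are already ordered as in `c`, so the chamber `w⁻¹ • c` matters only
inside the level sets of `f`. -/
theorem SignFace.ofFun_mul_inv_smul_iff {G X : Type*} [Group G] [MulAction G X] [Finite X]
    {V : AddSubgroup (X → ℤ)} [IsStableSubgroup G V] {f c : X → ℤ} {hf : f ∈ V} {hc : c ∈ V}
    (hinj : Function.Injective c) (hfc : ofFun f hf * ofFun c hc = ofFun c hc) (w : G) :
    ofFun f hf * (w⁻¹ • ofFun c hc) = ofFun c hc ↔
      ∀ x y, f x = f y → c x < c y → c (w • x) < c (w • y) := by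
  constructor
  · intro h x y hxy hc'
    have h1 := congrArg (fun s => s.sgn x y) h
    simp only [mul_sgn, smul_ofFun, ofFun_sgn, hxy, sub_self, sign_zero, if_true, inv_inv] at h1
    rwa [(sign_eq_neg_one_iff (a := c x - c y)).mpr (by omega), sign_eq_neg_one_iff,
      sub_neg] at h1
  · intro h
    ext x y
    simp only [mul_sgn, smul_ofFun, inv_inv]
    split_ifs with h0
    · rw [ofFun_sgn_eq_zero] at h0
      rw [ofFun_sgn, ofFun_sgn]
      rcases lt_trichotomy (c x) (c y) with h1 | h1 | h1
      · have h2 := h x y h0 h1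
        rw [sign_neg (by omega), sign_neg (by omega)]
      · rw [hinj h1]
        simp
      · have h2 := h y x h0.symm h1
        rw [sign_pos (by omega), sign_pos (by omega)]
    · have h1 := congrArg (fun s => s.sgn x y) hfc
      simpa only [mul_sgn, if_neg h0] using h1

/-- The set `{±1, …, ±n}` of signed indices. -/
@[ext]
structure SignedIdx (n : ℕ) where
  /-- The absolute value (minus one). -/
  idx : Fin n
  /-- The sign. -/
  sgn : ℤˣ

namespace SignedIdx

variable {n : ℕ}

instance : Fintype (SignedIdx n) :=
  Fintype.ofEquiv (Fin n × ℤˣ) ⟨fun x => ⟨x.1, x.2⟩, fun x => (x.idx, x.sgn), fun _ => rfl, fun _ => rfl⟩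

instance : MulAction (SignedPerm n) (SignedIdx n) where
  smul w x := ⟨w.right x.idx, w.left (w.right x.idx) * x.sgn⟩
  one_smul x := SignedIdx.ext rfl (one_mul _)
  mul_smul v w x := by
    refine SignedIdx.ext rfl ?_
    change (v * w).left ((v * w).right x.idx) * x.sgn
      = v.left (v.right (w.right x.idx)) * (w.left (w.right x.idx) * x.sgn)
    have : (mulAutArrow v.right w.left) (v.right (w.right x.idx)) = w.left (w.right x.idx) := by
      change w.left (v.right⁻¹ • v.right (w.right x.idx)) = _
      simp [Equiv.Perm.smul_def]
    rw [SemidirectProduct.mul_left, SemidirectProduct.mul_right, Equiv.Perm.mul_apply, Pi.mul_apply,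
      this, mul_assoc]

theorem smul_def (w : SignedPerm n) (i : Fin n) (s : ℤˣ) :
    w • (⟨i, s⟩ : SignedIdx n) = ⟨w.right i, w.left (w.right i) * s⟩ := rfl

/-- The odd extension of a function on `{1, …, n}`. -/
def oddExt (h : Fin n → ℤ) (x : SignedIdx n) : ℤ := (x.sgn : ℤ) * h x.idx

theorem oddExt_mk (h : Fin n → ℤ) (i : Fin n) (s : ℤˣ) : oddExt h ⟨i, s⟩ = s * h i := rfl

theorem oddExt_injective : Function.Injective (oddExt (n := n)) := fun h h' e => by
  funext i
  have := congrFun e ⟨i, 1⟩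
  simpa [oddExt_mk] using this

variable (n) in
/-- The odd functions on the signed indices. -/
def oddFun : AddSubgroup (SignedIdx n → ℤ) where
  carrier := Set.range oddExt
  add_mem' := by
    rintro _ _ ⟨f, rfl⟩ ⟨g, rfl⟩
    exact ⟨f + g, funext fun x => mul_add _ _ _⟩
  zero_mem' := ⟨0, funext fun x => mul_zero _⟩
  neg_mem' := by
    rintro _ ⟨f, rfl⟩
    exact ⟨-f, funext fun x => mul_neg _ _⟩

theorem oddExt_mem (h : Fin n → ℤ) : oddExt h ∈ oddFun n := ⟨h, rfl⟩

theorem exists_oddExt {f : SignedIdx n → ℤ} (hf : f ∈ oddFun n) : ∃ h, oddExt h = f := hf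

instance : IsStableSubgroup (SignedPerm n) (oddFun n) where
  comp_mem := by
    rintro w _ ⟨f, rfl⟩
    refine ⟨fun i => oddExt f (w⁻¹ • (⟨i, 1⟩ : SignedIdx n)), funext fun ⟨i, s⟩ => ?_⟩
    simp only [smul_def, oddExt_mk]
    push_cast
    ring

variable (n) in
/-- The function `±i ↦ ±i`. -/
def idFun : SignedIdx n → ℤ := oddExt fun i => (i : ℕ) + 1

theorem idFun_injective : Function.Injective (idFun n) := by
  rintro ⟨i, s⟩ ⟨j, t⟩ h
  simp only [idFun, oddExt_mk] at h
  have h1 : i = j ∧ s = t := by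
    rcases Int.units_eq_one_or s with rfl | rfl <;> rcases Int.units_eq_one_or t with rfl | rfl <;>
      simp only [Units.val_one, Units.val_neg, one_mul, neg_mul] at h
    · exact ⟨Fin.ext (by omega), rfl⟩
    · omega
    · omega
    · exact ⟨Fin.ext (by omega), rfl⟩
  rw [h1.1, h1.2]

variable (n) in
theorem idFun_mem : idFun n ∈ oddFun n := oddExt_mem _

variable (n) in
/-- The fundamental chamber. -/
def chamber : SignFace (oddFun n) := SignFace.ofFun (idFun n) (idFun_mem n)

theorem idFun_lt_iff {i j : Fin n} {s t : ℤˣ} :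
    idFun n ⟨i, s⟩ < idFun n ⟨j, t⟩ ↔
      (s = 1 ∧ t = 1 ∧ i < j) ∨ (s = -1 ∧ t = -1 ∧ j < i) ∨ (s = -1 ∧ t = 1) := by
  simp only [idFun, oddExt_mk, Fin.lt_def]
  rcases Int.units_eq_one_or s with rfl | rfl <;> rcases Int.units_eq_one_or t with rfl | rfl <;>
    simp <;> omega

-- An injective odd function has nonzero values with distinct absolute values. Sorting these and
-- recording the signs gives the signed permutation.
variable (n) in
theorem isChamberSystem : IsChamberSystem (SignedPerm n) (chamber n) := by
  refine SignFace.isChamberSystem idFun_injective ?_ ?_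
  · intro w hw
    have h1 : ∀ i, w.right i = i := fun i => congrArg SignedIdx.idx (hw ⟨i, 1⟩)
    have h2 : ∀ i, w.left i = 1 := fun i => by
      have := congrArg SignedIdx.sgn (hw ⟨i, 1⟩)
      simpa [smul_def, h1] using this
    exact SemidirectProduct.ext (funext h2) (Equiv.ext h1)
  · rintro _ ⟨f, rfl⟩ hinj
    have hf0 : ∀ i, f i ≠ 0 := fun i h => by
      have h1 : oddExt f ⟨i, 1⟩ = oddExt f ⟨i, -1⟩ := by simp [oddExt_mk, h]
      have h2 : (1 : ℤˣ) = -1 := congrArg SignedIdx.sgn (hinj h1)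
      exact absurd h2 (by decide)
    have hfi : Function.Injective fun i => |f i| := fun i j h => by
      rcases abs_eq_abs.mp h with h1 | h1
      · exact congrArg SignedIdx.idx (hinj (a₁ := ⟨i, 1⟩) (a₂ := ⟨j, 1⟩) (by simp [oddExt_mk, h1]))
      · exact congrArg SignedIdx.idx (hinj (a₁ := ⟨i, 1⟩) (a₂ := ⟨j, -1⟩) (by simp [oddExt_mk, h1]))
    set σ := Tuple.sort fun i => |f i|
    have hmono : StrictMono ((fun i => |f i|) ∘ σ) :=
      (Tuple.monotone_sort _).strictMono_of_injective (hfi.comp σ.injective)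
    refine ⟨⟨fun i => if f i < 0 then -1 else 1, σ⟩, ?_⟩
    have hval : ∀ i s, oddExt f ((⟨fun i => if f i < 0 then -1 else 1, σ⟩ : SignedPerm n) •
        (⟨i, s⟩ : SignedIdx n)) = s * |f (σ i)| := by
      intro i s
      simp only [smul_def, oddExt_mk]
      split_ifs with h
      · rw [abs_of_neg h]
        simp
      · rw [abs_of_nonneg (not_lt.mp h)]
        simp
    rintro ⟨i, s⟩ ⟨j, t⟩ hij
    rw [hval, hval]
    have hi := abs_pos.mpr (hf0 (σ i))
    have hj := abs_pos.mpr (hf0 (σ j))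
    rcases idFun_lt_iff.mp hij with ⟨rfl, rfl, h⟩ | ⟨rfl, rfl, h⟩ | ⟨rfl, rfl⟩
    · have : |f (σ i)| < |f (σ j)| := hmono h
      simpa using this
    · have : |f (σ j)| < |f (σ i)| := hmono h
      simpa using this
    · simp only [Units.val_one, Units.val_neg, one_mul, neg_mul]
      omega

/-- The face of the fundamental chamber given by a pseudocomposition. -/
def face (n b₀ : ℕ) (bs : List ℕ) : SignFace (oddFun n) :=
  SignFace.ofFun (oddExt fun i => (blk (b₀ :: bs) i : ℤ)) (oddExt_mem _)

theorem face_mul_chamber (b₀ : ℕ) (bs : List ℕ) : face n b₀ bs * chamber n = chamber n := by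
  rw [face, chamber, SignFace.ofFun_mul_eq_right_iff idFun_injective]
  rintro ⟨i, s⟩ ⟨j, t⟩ h
  simp only [oddExt_mk]
  rcases idFun_lt_iff.mp h with ⟨rfl, rfl, h'⟩ | ⟨rfl, rfl, h'⟩ | ⟨rfl, rfl⟩
  · simpa using blk_mono _ (Fin.le_def.mp h'.le)
  · simpa using blk_mono _ (Fin.le_def.mp h'.le)
  · simp only [Units.val_one, Units.val_neg, one_mul, neg_mul]
    omega

/-- An odd function that is monotone along `idFun` is nonnegative and nondecreasing on the positive
indices, and its signs depend only on where it jumps, including the jump from `0`. -/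
theorem exists_eq_face {a : SignFace (oddFun n)} (ha : a * chamber n = chamber n) :
    ∃ b₀ bs, (∀ b ∈ bs, 0 < b) ∧ b₀ + bs.sum = n ∧ a = face n b₀ bs := by
  obtain ⟨f', hf', rfl⟩ := a.exists_ofFun
  obtain ⟨f, rfl⟩ : ∃ f, oddExt f = f' := exists_oddExt hf'
  rw [chamber, SignFace.ofFun_mul_eq_right_iff idFun_injective] at ha
  have h0 : ∀ i, 0 ≤ f i := fun i => by
    have := ha ⟨i, -1⟩ ⟨i, 1⟩ (idFun_lt_iff.mpr (by simp))
    simp only [oddExt_mk, Units.val_one, Units.val_neg, one_mul, neg_mul] at this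
    omega
  have h1 : ∀ i j, i < j → f i ≤ f j := fun i j hij => by
    simpa [oddExt_mk] using ha ⟨i, 1⟩ ⟨j, 1⟩ (idFun_lt_iff.mpr (by simp [hij]))
  -- Positions are shifted by one so that `F 0 = 0` stands for the origin; a jump at `0` means an
  -- empty first part.
  set F : ℕ → ℤ := fun p => if h : 0 < p ∧ p ≤ n then f ⟨p - 1, by omega⟩ else 0 with hF
  have hF1 : ∀ i : Fin n, F (i + 1) = f i := fun i => by
    rw [hF]
    simp only
    rw [dif_pos ⟨by omega, by omega⟩]
    rfl
  have hFm : ∀ p < n, F p ≤ F (p + 1) := by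
    intro p hp
    rw [hF1 ⟨p, hp⟩]
    rcases p with _ | p
    · simpa [hF] using h0 _
    · rw [hF1 ⟨p, by omega⟩]
      exact h1 _ _ (by simp)
  obtain ⟨b₀, bs, hbs, hsum, hJ⟩ := exists_eq_cuts
    (Finset.filter_subset (fun p => F p < F (p + 1)) (Finset.range n))
  refine ⟨b₀, bs, hbs, hsum, ?_⟩
  have key : ∀ p q, p ≤ n → q ≤ n →
      (F p < F q ↔ blk ((b₀ + 1) :: bs) p < blk ((b₀ + 1) :: bs) q) := by
    intro p q hp hq
    refine lt_iff_lt_of_jumps hFm (fun p _ => blk_mono _ (Nat.le_succ p)) (fun p hp => ?_) hp hq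
    rw [blk_lt_blk_succ_iff hbs (by omega), ← hJ, Finset.mem_filter, Finset.mem_range]
    exact ⟨fun h => ⟨hp, h⟩, fun h => h.2⟩
  have k1 : ∀ i j : Fin n, f i < f j ↔ blk (b₀ :: bs) i < blk (b₀ :: bs) j := fun i j => by
    rw [← hF1, ← hF1, key _ _ (by omega) (by omega), blk_succ_cons_succ, blk_succ_cons_succ]
  have k2 : ∀ i : Fin n, 0 < f i ↔ 0 < blk (b₀ :: bs) i := fun i => by
    have h2 : F 0 = 0 := by simp [hF]
    rw [← hF1, ← h2, key _ _ (by omega) (by omega), blk_succ_cons_succ, blk_succ_cons_zero]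
  ext ⟨i, s⟩ ⟨j, t⟩
  have e1 := k1 i j
  have e2 := k1 j i
  have e3 := k2 i
  have e4 := k2 j
  have e5 := h0 i
  have e6 := h0 j
  rw [face, SignFace.ofFun_sgn, SignFace.ofFun_sgn, oddExt_mk, oddExt_mk, oddExt_mk, oddExt_mk]
  have hsign : ∀ {x y : ℤ}, (0 < x ↔ 0 < y) → (x < 0 ↔ y < 0) →
      SignType.sign x = SignType.sign y := by
    intro x y h1 h2
    simp only [sign_apply, h1, h2]
  apply hsign <;>
  rcases Int.units_eq_one_or s with rfl | rfl <;> rcases Int.units_eq_one_or t with rfl | rfl <;>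
    simp only [Units.val_one, Units.val_neg, one_mul, neg_mul] <;> omega

end SignedIdx

/-! ### The descent algebra of type `B` and its characters -/

namespace SignedIdx

variable {n : ℕ}

theorem apply_succ (w : SignedPerm n) (i : Fin n) :
    w.apply (i + 1) = w.left (w.right i) * ((w.right i : ℕ) + 1) := by
  have h : 0 < (i : ℕ) + 1 ∧ (i : ℕ) + 1 ≤ n := by omega
  simp only [SignedPerm.apply, dif_pos h, Nat.add_sub_cancel]

theorem apply_zero (w : SignedPerm n) : w.apply 0 = 0 := by simp [SignedPerm.apply]

theorem idFun_smul (w : SignedPerm n) (i : Fin n) (s : ℤˣ) :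
    idFun n (w • (⟨i, s⟩ : SignedIdx n)) = s * w.apply (i + 1) := by
  rw [apply_succ, smul_def, idFun, oddExt_mk]
  push_cast
  ring

theorem natAbs_apply_succ (w : SignedPerm n) (i : Fin n) :
    (w.apply (i + 1)).natAbs = (w.right i : ℕ) + 1 := by
  rw [apply_succ, Int.natAbs_mul, Int.units_natAbs]
  omega

theorem apply_ne_apply_succ (w : SignedPerm n) {p : ℕ} (hp : p < n) :
    w.apply p ≠ w.apply (p + 1) := by
  intro h
  have h1 := natAbs_apply_succ w ⟨p, hp⟩
  rcases p with _ | p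
  · rw [← h, apply_zero] at h1
    simp at h1
  · have h2 := natAbs_apply_succ w ⟨p, by omega⟩
    simp only at h1 h2
    rw [← h, h2] at h1
    have h3 := w.right.injective (Fin.ext (Nat.succ_injective h1))
    simp [Fin.ext_iff] at h3

/-- Monotonicity on the signed blocks reduces to consecutive positions `p, p + 1` with `p` not a
cut. The zero block, which contains both `i` and `-i`, accounts for the comparison with `w(0) = 0`.
-/
theorem face_mul_inv_smul_iff {b₀ : ℕ} {bs : List ℕ} (hbs : ∀ b ∈ bs, 0 < b)
    (hsum : b₀ + bs.sum = n) (w : SignedPerm n) :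
    face n b₀ bs * (w⁻¹ • chamber n) = chamber n ↔ w.des ⊆ cuts b₀ bs := by
  have hJ : ∀ p < n, blk ((b₀ + 1) :: bs) p = blk ((b₀ + 1) :: bs) (p + 1) ↔ p ∉ cuts b₀ bs := by
    intro p hp
    rw [← blk_lt_blk_succ_iff hbs (by omega), (blk_mono _ (Nat.le_succ p)).lt_iff_ne, not_not]
  rw [face, chamber, SignFace.ofFun_mul_inv_smul_iff idFun_injective (face_mul_chamber b₀ bs)]
  constructor
  · intro h p hp
    rw [SignedPerm.des, Finset.mem_filter, Finset.mem_range] at hp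
    obtain ⟨hp, hlt⟩ := hp
    by_contra hpJ
    have hB := (hJ p hp).mpr hpJ
    rw [blk_succ_cons_succ] at hB
    rcases p with _ | p
    · rw [blk_succ_cons_zero] at hB
      have h1 := h ⟨⟨0, hp⟩, -1⟩ ⟨⟨0, hp⟩, 1⟩ (by simp [oddExt_mk, ← hB])
        (idFun_lt_iff.mpr (by simp))
      rw [idFun_smul, idFun_smul] at h1
      rw [apply_zero] at hlt
      simp only [Units.val_one, Units.val_neg, one_mul, neg_mul] at h1
      omega
    · rw [blk_succ_cons_succ] at hB
      have h1 := h ⟨⟨p, by omega⟩, 1⟩ ⟨⟨p + 1, hp⟩, 1⟩ (by simp [oddExt_mk, hB])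
        (idFun_lt_iff.mpr (by simp))
      rw [idFun_smul, idFun_smul] at h1
      simp only [Units.val_one, one_mul] at h1
      omega
  · intro h
    have key := (strictMono_on_blocks_iff (n := n) (blk_mono ((b₀ + 1) :: bs)) w.apply).mpr
      fun p hp hB => by
        have h1 : p ∉ w.des := fun h2 => (hJ p hp).mp hB (h h2)
        rw [SignedPerm.des, Finset.mem_filter, Finset.mem_range] at h1
        have h2 := apply_ne_apply_succ w hp
        have h3 : ¬ w.apply (p + 1) < w.apply p := fun h3 => h1 ⟨hp, h3⟩
        omega
    have key' : ∀ i j : Fin n, i < j → blk (b₀ :: bs) i = blk (b₀ :: bs) j →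
        w.apply (i + 1) < w.apply (j + 1) := fun i j hij hB =>
      key _ _ (by simpa using hij) (by omega) (by rwa [blk_succ_cons_succ, blk_succ_cons_succ])
    have key0 : ∀ i : Fin n, blk (b₀ :: bs) i = 0 → 0 < w.apply (i + 1) := fun i hB => by
      rw [← apply_zero w]
      exact key _ _ (by omega) (by omega) (by rw [blk_succ_cons_succ, blk_succ_cons_zero, hB])
    rintro ⟨i, s⟩ ⟨j, t⟩ hB hlt
    rw [idFun_smul, idFun_smul]
    rw [oddExt_mk, oddExt_mk] at hB
    rcases idFun_lt_iff.mp hlt with ⟨rfl, rfl, h'⟩ | ⟨rfl, rfl, h'⟩ | ⟨rfl, rfl⟩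
    · simp only [Units.val_one, one_mul] at hB ⊢
      exact key' i j h' (by omega)
    · simp only [Units.val_one, Units.val_neg, one_mul, neg_mul] at hB ⊢
      have := key' j i h' (by omega)
      omega
    · simp only [Units.val_one, Units.val_neg, one_mul, neg_mul] at hB ⊢
      have h1 := key0 i (by omega)
      have h2 := key0 j (by omega)
      omega

variable (k : Type*) [Field k]

theorem descentX_cuts {b₀ : ℕ} {bs : List ℕ} (hbs : ∀ b ∈ bs, 0 < b) (hsum : b₀ + bs.sum = n) :
    descentX k n (cuts b₀ bs) = descentSum (SignedPerm n) k (chamber n) (face n b₀ bs) := by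
  classical
  rw [descentX, descentSum]
  refine Finset.sum_congr ?_ fun _ _ => rfl
  ext w
  simp only [Finset.mem_filter, Finset.mem_univ, true_and]
  exact (face_mul_inv_smul_iff hbs hsum w).symm

theorem descentAlg_eq_descentSpan :
    Subalgebra.toSubmodule ((isChamberSystem n).descentAlg k) = descentSpan k n := by
  rw [IsChamberSystem.descentAlg_eq_span, descentSpan]
  congr 1
  ext x
  constructor
  · rintro ⟨a, ha, rfl⟩
    obtain ⟨b₀, bs, hbs, hsum, rfl⟩ := exists_eq_face ha
    exact ⟨⟨cuts b₀ bs, hsum ▸ cuts_subset hbs⟩, descentX_cuts k hbs hsum⟩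
  · rintro ⟨⟨J, hJ⟩, rfl⟩
    obtain ⟨b₀, bs, hbs, hsum, rfl⟩ := exists_eq_cuts hJ
    exact ⟨_, face_mul_chamber b₀ bs, (descentX_cuts k hbs hsum).symm⟩

/-- Solomon's theorem: the span of the `X_J` already underlies a subalgebra, so adjoining products
adds nothing. -/
theorem solB_eq : solB k n = (isChamberSystem n).descentAlg k := by
  rw [solB, ← descentAlg_eq_descentSpan]
  exact Algebra.adjoin_eq _

theorem card_filter_comp_perm {α : Type*} [Fintype α] (P : α → Prop) [DecidablePred P]
    (σ : Equiv.Perm α) :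
    (Finset.univ.filter fun i => P (σ i)).card = (Finset.univ.filter P).card := by
  rw [← Finset.card_map σ.toEmbedding]
  congr 1
  ext i
  simp only [Finset.mem_map, Finset.mem_filter, Finset.mem_univ, true_and,
    Equiv.coe_toEmbedding]
  exact ⟨fun ⟨j, hj, hji⟩ => hji ▸ hj, fun h => ⟨σ.symm i, by simpa using h, by simp⟩⟩

/-- Signed permutations can rearrange the entries and choose all signs freely, so only the multiset
of absolute values is invariant. -/
theorem orbit_face_eq {b₀ : ℕ} {bs : List ℕ} (hsum : b₀ + bs.sum = n) (h : Fin n → ℤ) :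
    (∃ w : SignedPerm n, oddExt h
        = fun x => oddExt (fun i => (blk (b₀ :: bs) i : ℤ)) (w⁻¹ • x)) ↔
      ∀ r, (Finset.univ.filter fun i => (h i).natAbs = r).card = (b₀ :: bs).getD r 0 := by
  have hsum' : (b₀ :: bs).sum = n := by rw [List.sum_cons, hsum]
  constructor
  · rintro ⟨w, hw⟩ r
    have h1 : ∀ i, (h i).natAbs = blk (b₀ :: bs) (w⁻¹.right i) := fun i => by
      have h2 := congrArg Int.natAbs (congrFun hw ⟨i, 1⟩)
      simpa only [smul_def, oddExt_mk, Int.natAbs_mul, Int.units_natAbs, one_mul,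
        Int.natAbs_natCast] using h2
    simp only [h1]
    rw [card_filter_comp_perm (fun i : Fin n => blk (b₀ :: bs) i = r) w⁻¹.right,
      card_fin_blk_eq hsum']
  · intro hr
    obtain ⟨σ, hσ⟩ := exists_equiv_comp_eq (fun i => (h i).natAbs)
      (fun i : Fin n => blk (b₀ :: bs) i) fun r => by rw [hr, card_fin_blk_eq hsum']
    refine ⟨⟨fun i => if h i < 0 then -1 else 1, σ⟩, funext fun x => ?_⟩
    set w : SignedPerm n := ⟨fun i => if h i < 0 then -1 else 1, σ⟩ with hw
    obtain ⟨⟨i, s⟩, rfl⟩ : ∃ y, w • y = x := ⟨w⁻¹ • x, smul_inv_smul _ _⟩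
    rw [inv_smul_smul, smul_def, oddExt_mk, oddExt_mk]
    rw [← hσ i]
    simp only [hw]
    split_ifs with h2
    · push_cast
      rw [abs_of_neg h2]
      ring
    · push_cast
      rw [abs_of_nonneg (not_lt.mp h2)]
      ring

/-- The functions counted are odd and constant on the signed blocks of `(z, us)`. They vanish on the
zero block, and every other block takes a value `±r`, that is, it is sent to the part `r` with two
signs unless `r = 0`. -/
theorem char_face_descentX {z b₀ : ℕ} {us bs : List ℕ} (hus : ∀ u ∈ us, 0 < u)
    (hzsum : z + us.sum = n) (hbs : ∀ b ∈ bs, 0 < b) (hsum : b₀ + bs.sum = n)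
    (hm : descentX k n (cuts b₀ bs) ∈ (isChamberSystem n).descentAlg k) :
    (isChamberSystem n).char k (face n z us) ⟨descentX k n (cuts b₀ bs), hm⟩
      = signedDist z us b₀ bs := by
  classical
  have hzsum' : (z :: us).sum = n := by rw [List.sum_cons, hzsum]
  revert hm
  rw [descentX_cuts k hbs hsum]
  intro hm
  rw [IsChamberSystem.char_descentSum (isChamberSystem n) (face_mul_chamber b₀ bs)]
  have h1 := SignFace.card_descent_eq_ncard (isChamberSystem n) (face_mul_chamber b₀ bs)
    (face n z us)
  refine (congrArg (Nat.cast (R := k)) h1).trans ?_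
  -- Label `0` is the (possibly empty) zero block. The set `Al r` is a singleton for `r = 0` and has
  -- two elements otherwise, which explains the weights `1` and `2`.
  set lab : Fin n → Fin (us.length + 1) := fun i =>
    ⟨blk (z :: us) i, by simpa using blk_lt_length (cs := z :: us) (by rw [hzsum']; exact i.2)⟩
    with hlab
  set S : Finset (Fin (us.length + 1)) := Finset.univ.map ⟨Fin.succ, Fin.succ_injective _⟩ with hS
  set Al : ℕ → Finset ℤ := fun r => {(r : ℤ), -(r : ℤ)} with hAl
  have hmemS : ∀ s, s ∈ S ↔ s ≠ 0 := fun s => by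
    rw [hS, Finset.mem_map]
    constructor
    · rintro ⟨t, -, rfl⟩
      exact Fin.succ_ne_zero t
    · exact fun hs => ⟨s.pred hs, Finset.mem_univ _, Fin.succ_pred s hs⟩
  have hlabS : ∀ i, lab i ∉ S ↔ blk (z :: us) i = 0 := fun i => by
    rw [hmemS, not_not, hlab, Fin.ext_iff]
    rfl
  have hcard : ∀ s : Fin (us.length + 1),
      (Finset.univ.filter fun i => lab i = s).card = (z :: us).getD s 0 := fun s => by
    rw [← card_fin_blk_eq hzsum']
    congr 1
    ext i
    simp [hlab, Fin.ext_iff]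
  have h2 := ncard_blockFun_eq_distSum (k := k) lab S (fun s hs => ?_) Al ?_ b₀ bs ?_ 2 ?_
  rotate_left
  · by_contra hne
    push Not at hne
    have h3 := hcard s
    rw [Finset.filter_false_of_mem fun i _ => hne i, Finset.card_empty] at h3
    obtain ⟨t, rfl⟩ := Fin.exists_succ_eq.mpr ((hmemS s).mp hs)
    have h4 := hus us[t] (List.getElem_mem _)
    rw [Fin.val_succ, List.getD_cons_succ, List.getD_eq_getElem _ _ t.2] at h3
    exact h4.ne h3
  · intro r x hx
    rcases Finset.mem_insert.mp hx with rfl | hx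
    · simp
    · rw [Finset.mem_singleton.mp hx]
      simp
  · simp [hAl]
  · intro r
    rw [hAl, Finset.card_pair]
    omega
  have hz : (Finset.univ.filter fun i => lab i ∉ S).card = z := by
    simp only [hlabS]
    rw [card_fin_blk_eq hzsum']
    rfl
  have hU : S.val.map (fun s => (Finset.univ.filter fun i => lab i = s).card)
      = (us : Multiset ℕ) := by
    rw [hS, Finset.map_val, Multiset.map_map]
    simp only [hcard, Function.comp_def, Function.Embedding.coeFn_mk, Fin.val_succ,
      List.getD_cons_succ]
    rw [Fin.univ_val_map]
    congr 1
    apply List.ext_getElem <;> simp +contextual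
  rw [hz, hU] at h2
  rw [signedDist]
  refine Eq.trans ?_ (h2.trans (by push_cast; rfl))
  congr 1
  rw [← Set.ncard_image_of_injective _ oddExt_injective]
  congr 1
  ext g
  constructor
  · rintro ⟨⟨w, hw⟩, hg⟩
    obtain ⟨h, rfl⟩ := exists_oddExt (f := g) (by
      rw [hw]
      exact IsStableSubgroup.comp_mem w _ (oddExt_mem _))
    refine ⟨h, ⟨fun i j hij => ?_, fun i hi => ?_, fun i _ => ?_,
      (orbit_face_eq hsum h).mp ⟨w, hw⟩⟩, rfl⟩
    · have h3 : blk (z :: us) i = blk (z :: us) j := congrArg Fin.val hij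
      simpa [oddExt_mk] using hg ⟨i, 1⟩ ⟨j, 1⟩
        (SignFace.ofFun_sgn_eq_zero.mpr (by simp [oddExt_mk, h3]))
    · rw [hlabS] at hi
      have := hg ⟨i, 1⟩ ⟨i, -1⟩ (SignFace.ofFun_sgn_eq_zero.mpr (by simp [oddExt_mk, hi]))
      simp only [oddExt_mk, Units.val_one, Units.val_neg, one_mul, neg_mul] at this
      omega
    · rw [hAl, Finset.mem_insert, Finset.mem_singleton]
      omega
  · rintro ⟨h, ⟨h3, h4, -, h5⟩, rfl⟩
    refine ⟨(orbit_face_eq hsum h).mpr h5, ?_⟩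
    rintro ⟨i, s⟩ ⟨j, t⟩ hxy
    have h6 := SignFace.ofFun_sgn_eq_zero.mp hxy
    rw [oddExt_mk, oddExt_mk] at h6 ⊢
    have h7 : blk (z :: us) i = blk (z :: us) j → h i = h j := fun e => h3 i j (Fin.ext e)
    have h8 : ∀ i : Fin n, blk (z :: us) i = 0 → h i = 0 := fun i e => h4 i ((hlabS i).mpr e)
    rcases Int.units_eq_one_or s with rfl | rfl <;> rcases Int.units_eq_one_or t with rfl | rfl <;>
      simp only [Units.val_one, Units.val_neg, one_mul, neg_mul] at h6 ⊢
    · exact h7 (by omega)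
    · rw [h8 i (by omega), h8 j (by omega), neg_zero]
    · rw [h8 i (by omega), h8 j (by omega), neg_zero]
    · rw [h7 (by omega)]

end SignedIdx

/-! ### The hyperplane faces of type `A` -/

namespace PermFace

variable {n : ℕ}

instance : IsStableSubgroup (Equiv.Perm (Fin n)) (⊤ : AddSubgroup (Fin n → ℤ)) where
  comp_mem _ _ _ := AddSubgroup.mem_top _

variable (n) in
/-- The inclusion of `Fin n` in the integers. -/
def idFun : Fin n → ℤ := fun i => (i : ℕ)

theorem idFun_injective : Function.Injective (idFun n) := fun i j h => Fin.ext (by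
  simpa [idFun] using h)

theorem idFun_lt_iff {i j : Fin n} : idFun n i < idFun n j ↔ i < j := by
  simp [idFun]

variable (n) in
/-- The fundamental chamber. -/
def chamber : SignFace (⊤ : AddSubgroup (Fin n → ℤ)) :=
  SignFace.ofFun (idFun n) (AddSubgroup.mem_top _)

variable (n) in
theorem isChamberSystem : IsChamberSystem (Equiv.Perm (Fin n)) (chamber n) := by
  refine SignFace.isChamberSystem idFun_injective (fun g hg => Equiv.ext hg) fun f _ hf => ?_
  refine ⟨Tuple.sort f, fun x y hxy => ?_⟩
  exact (Tuple.monotone_sort f).strictMono_of_injective (hf.comp (Equiv.injective _))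
    (idFun_lt_iff.mp hxy)

/-- The face of the fundamental chamber given by a composition. -/
def face (n : ℕ) (cs : List ℕ) : SignFace (⊤ : AddSubgroup (Fin n → ℤ)) :=
  SignFace.ofFun (fun i => (blk cs i : ℤ)) (AddSubgroup.mem_top _)

theorem face_mul_chamber (cs : List ℕ) : face n cs * chamber n = chamber n := by
  rw [face, chamber, SignFace.ofFun_mul_eq_right_iff idFun_injective]
  intro i j h
  exact_mod_cast blk_mono cs (Fin.le_def.mp (idFun_lt_iff.mp h).le)

theorem exists_eq_face {a : SignFace (⊤ : AddSubgroup (Fin n → ℤ))}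
    (ha : a * chamber n = chamber n) :
    ∃ us : List ℕ, (∀ u ∈ us, 0 < u) ∧ us.sum = n ∧ a = face n us := by
  obtain ⟨f, hf, rfl⟩ := a.exists_ofFun
  rw [chamber, SignFace.ofFun_mul_eq_right_iff idFun_injective] at ha
  simp only [idFun_lt_iff] at ha
  rcases n with _ | m
  · exact ⟨[], by simp, rfl, SignFace.ext (funext fun i => i.elim0)⟩
  -- There is no artificial position in type A: the `m + 1` positions have `m` gaps, and the first
  -- part `b₀ + 1` is automatically positive.
  set F : ℕ → ℤ := fun p => if h : p < m + 1 then f ⟨p, h⟩ else 0 with hF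
  have hF1 : ∀ i : Fin (m + 1), F i = f i := fun i => dif_pos i.2
  have hFm : ∀ p < m, F p ≤ F (p + 1) := by
    intro p hp
    rw [hF1 ⟨p, by omega⟩, hF1 ⟨p + 1, by omega⟩]
    exact ha _ _ (by simp)
  obtain ⟨b₀, bs, hbs, hsum, hJ⟩ := exists_eq_cuts
    (Finset.filter_subset (fun p => F p < F (p + 1)) (Finset.range m))
  refine ⟨(b₀ + 1) :: bs, ?_, by rw [List.sum_cons]; omega, ?_⟩
  · intro u hu
    rcases List.mem_cons.mp hu with rfl | hu
    · omega
    · exact hbs u hu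
  have key : ∀ i j : Fin (m + 1), f i < f j ↔
      blk ((b₀ + 1) :: bs) i < blk ((b₀ + 1) :: bs) j := by
    intro i j
    rw [← hF1, ← hF1]
    refine lt_iff_lt_of_jumps hFm (fun p _ => blk_mono _ (Nat.le_succ p)) (fun p hp => ?_)
      (Nat.lt_succ_iff.mp i.2) (Nat.lt_succ_iff.mp j.2)
    rw [blk_lt_blk_succ_iff hbs (by omega), ← hJ, Finset.mem_filter, Finset.mem_range]
    exact ⟨fun h => ⟨hp, h⟩, fun h => h.2⟩
  ext i j
  rw [face, SignFace.ofFun_sgn, SignFace.ofFun_sgn]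
  have e1 := key i j
  have e2 := key j i
  rcases lt_trichotomy (f i) (f j) with h | h | h
  · rw [sign_neg (by omega), sign_neg (by omega)]
  · rw [show f i - f j = 0 by omega,
      show (blk ((b₀ + 1) :: bs) i : ℤ) - blk ((b₀ + 1) :: bs) j = 0 by omega]
  · rw [sign_pos (by omega), sign_pos (by omega)]

theorem face_mul_inv_smul_iff (cs : List ℕ) (σ : Equiv.Perm (Fin n)) :
    face n cs * (σ⁻¹ • chamber n) = chamber n ↔
      ∀ i j : Fin n, i < j → blk cs i = blk cs j → σ i < σ j := by
  rw [face, chamber, SignFace.ofFun_mul_inv_smul_iff idFun_injective (face_mul_chamber cs)]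
  simp only [idFun_lt_iff, Nat.cast_inj, Equiv.Perm.smul_def]
  exact ⟨fun h i j hij hb => h i j hb hij, fun h i j hb hij => h i j hij hb⟩

theorem orbit_face_eq {cs : List ℕ} (hsum : cs.sum = n) (h : Fin n → ℤ) :
    (∃ σ : Equiv.Perm (Fin n), h = fun x => (blk cs (σ⁻¹ • x : Fin n) : ℤ)) ↔
      (∀ i, h i = (h i).natAbs) ∧
      ∀ r, (Finset.univ.filter fun i => (h i).natAbs = r).card = cs.getD r 0 := by
  constructor
  · rintro ⟨σ, rfl⟩
    refine ⟨fun i => by simp, fun r => ?_⟩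
    rw [← card_fin_blk_eq hsum,
      ← SignedIdx.card_filter_comp_perm (fun i : Fin n => blk cs i = r) σ⁻¹]
    simp only [Int.natAbs_natCast, Equiv.Perm.smul_def]
  · rintro ⟨hpos, hr⟩
    obtain ⟨σ, hσ⟩ := exists_equiv_comp_eq (fun i => (h i).natAbs)
      (fun i : Fin n => blk cs i) fun r => by rw [hr, card_fin_blk_eq hsum]
    refine ⟨σ, funext fun x => ?_⟩
    rw [← hσ, hpos x, Equiv.Perm.smul_def, ← Equiv.Perm.mul_apply, mul_inv_cancel]
    rfl

variable (k : Type*) [Field k]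

/-- The count of type B without zero block and without signs. The parts in `b₀ :: bs` may be zero,
which is needed when valleys are split. -/
theorem char_face_descentSum {b₀ : ℕ} {us bs : List ℕ} (hus : ∀ u ∈ us, 0 < u)
    (husum : us.sum = n) (hsum : b₀ + bs.sum = n)
    (hm : descentSum (Equiv.Perm (Fin n)) k (chamber n) (face n (b₀ :: bs))
      ∈ (isChamberSystem n).descentAlg k) :
    (isChamberSystem n).char k (face n us) ⟨_, hm⟩
      = distSum ((b₀ :: bs).map fun b => ((1 : ℕ → k), b)) us := by
  classical
  have hsum' : (b₀ :: bs).sum = n := by rw [List.sum_cons, hsum]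
  rw [IsChamberSystem.char_descentSum (isChamberSystem n) (face_mul_chamber (b₀ :: bs))]
  have h1 := SignFace.card_descent_eq_ncard (isChamberSystem n) (face_mul_chamber (b₀ :: bs))
    (face n us)
  refine (congrArg (Nat.cast (R := k)) h1).trans ?_
  set lab : Fin n → Fin us.length := fun i =>
    ⟨blk us i, blk_lt_length (by rw [husum]; exact i.2)⟩ with hlab
  set Al : ℕ → Finset ℤ := fun r => {(r : ℤ)} with hAl
  have hcard : ∀ s : Fin us.length,
      (Finset.univ.filter fun i => lab i = s).card = us.getD s 0 := fun s => by
    rw [← card_fin_blk_eq husum]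
    congr 1
    ext i
    simp [hlab, Fin.ext_iff]
  have h2 := ncard_blockFun_eq_distSum (k := k) lab Finset.univ (fun s _ => ?_) Al ?_ b₀ bs ?_ 1 ?_
  rotate_left
  · by_contra hne
    push Not at hne
    have h3 := hcard s
    rw [Finset.filter_false_of_mem fun i _ => hne i, Finset.card_empty] at h3
    have h4 := hus us[s] (List.getElem_mem _)
    rw [List.getD_eq_getElem _ _ s.2] at h3
    exact h4.ne h3
  · intro r x hx
    rw [Finset.mem_singleton.mp hx, Int.natAbs_natCast]
  · simp [hAl]
  · simp [hAl]
  have hU : (Finset.univ : Finset (Fin us.length)).val.map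
      (fun s => (Finset.univ.filter fun i => lab i = s).card) = (us : Multiset ℕ) := by
    simp only [hcard]
    rw [Fin.univ_val_map]
    congr 1
    apply List.ext_getElem <;> simp +contextual
  rw [hU] at h2
  simp only [Finset.mem_univ, not_true_eq_false, Finset.filter_false, Finset.card_empty,
    Nat.zero_le, if_true, Nat.sub_zero, Nat.cast_one, IsEmpty.forall_iff, implies_true,
    true_and, forall_true_left] at h2
  refine Eq.trans ?_ (h2.trans rfl)
  congr 2
  ext h
  refine Iff.trans (and_congr (orbit_face_eq hsum' h) Iff.rfl) ?_
  constructor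
  · rintro ⟨⟨h3, h4⟩, h5⟩
    refine ⟨fun i j hij => h5 i j (SignFace.ofFun_sgn_eq_zero.mpr ?_), fun i => ?_, h4⟩
    · exact congrArg Nat.cast (congrArg Fin.val hij)
    · rw [hAl, Finset.mem_singleton]
      exact h3 i
  · rintro ⟨h3, h4, h5⟩
    refine ⟨⟨fun i => Finset.mem_singleton.mp (h4 i), h5⟩, fun i j hij => h3 i j (Fin.ext ?_)⟩
    exact_mod_cast SignFace.ofFun_sgn_eq_zero.mp hij

end PermFace

/-! ### Sums over permutations with prescribed shapes of the blocks -/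

/-- The shapes of a block of a word: increasing, decreasing, or first decreasing and then
increasing, where the last shape is counted with the number of possible turning points. -/
inductive BlockShape
  | inc
  | dec
  | valley

/-- The word is increasing on the `c` positions from `o` on. -/
def IncOn (a : ℕ → ℕ) (o c : ℕ) : Prop := ∀ p, p + 1 < c → a (o + p) < a (o + p + 1)

/-- The word is decreasing on the `c` positions from `o` on. -/
def DecOn (a : ℕ → ℕ) (o c : ℕ) : Prop := ∀ p, p + 1 < c → a (o + p + 1) < a (o + p)

theorem incOn_of_le_one (a : ℕ → ℕ) (o : ℕ) {c : ℕ} (hc : c ≤ 1) : IncOn a o c :=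
  fun p hp => by omega

theorem decOn_of_le_one (a : ℕ → ℕ) (o : ℕ) {c : ℕ} (hc : c ≤ 1) : DecOn a o c :=
  fun p hp => by omega

theorem incOn_succ_iff (a : ℕ → ℕ) (o c : ℕ) :
    IncOn a o (c + 2) ↔ IncOn a o (c + 1) ∧ a (o + c) < a (o + c + 1) := by
  constructor
  · exact fun h => ⟨fun p hp => h p (by omega), h c (by omega)⟩
  · rintro ⟨h1, h2⟩ p hp
    rcases Nat.lt_or_ge p c with h | h
    · exact h1 p (by omega)
    · obtain rfl : p = c := by omega
      exact h2

theorem decOn_succ_iff (a : ℕ → ℕ) (o c : ℕ) :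
    DecOn a o (c + 2) ↔ DecOn a o (c + 1) ∧ a (o + c + 1) < a (o + c) := by
  constructor
  · exact fun h => ⟨fun p hp => h p (by omega), h c (by omega)⟩
  · rintro ⟨h1, h2⟩ p hp
    rcases Nat.lt_or_ge p c with h | h
    · exact h1 p (by omega)
    · obtain rfl : p = c := by omega
      exact h2

theorem decOn_cons_iff (a : ℕ → ℕ) (o c : ℕ) :
    DecOn a o (c + 2) ↔ a (o + 1) < a o ∧ DecOn a (o + 1) (c + 1) := by
  constructor
  · refine fun h => ⟨h 0 (by omega), fun p hp => ?_⟩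
    have := h (p + 1) (by omega)
    rwa [show o + (p + 1) = o + 1 + p by omega] at this
  · rintro ⟨h1, h2⟩ p hp
    rcases p with _ | p
    · exact h1
    · have := h2 p (by omega)
      rwa [show o + 1 + p = o + (p + 1) by omega] at this

section Weights

variable (k : Type*) [Field k]

open Classical in
/-- The number of ways in which a block of a word has a given shape. -/
def shapeWeight (a : ℕ → ℕ) : BlockShape → ℕ → ℕ → k
  | .inc, o, c => if IncOn a o c then 1 else 0
  | .dec, o, c => if DecOn a o c then 1 else 0
  | .valley, o, c => ∑ i ∈ Finset.range (c + 1),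
      (if DecOn a o i then 1 else 0) * (if IncOn a (o + i) (c - i) then 1 else 0)

/-- The number of ways in which the consecutive blocks of a word have given shapes. -/
def shapesWeight (a : ℕ → ℕ) : ℕ → List (BlockShape × ℕ) → k
  | _, [] => 1
  | o, g :: gs => shapeWeight k a g.1 o g.2 * shapesWeight a (o + g.2) gs

variable {k}

theorem shapesWeight_append (a : ℕ → ℕ) (o : ℕ) (pre gs : List (BlockShape × ℕ)) :
    shapesWeight k a o (pre ++ gs)
      = shapesWeight k a o pre * shapesWeight k a (o + (pre.map Prod.snd).sum) gs := by
  induction pre generalizing o with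
  | nil => simp [shapesWeight]
  | cons g pre ih =>
    rw [List.cons_append, shapesWeight, shapesWeight, ih, List.map_cons, List.sum_cons, mul_assoc,
      add_assoc]

theorem shapesWeight_cons_zero (a : ℕ → ℕ) (o : ℕ) (s : BlockShape) (gs : List (BlockShape × ℕ)) :
    shapesWeight k a o ((s, 0) :: gs) = shapesWeight k a o gs := by
  rw [shapesWeight, add_zero]
  cases s <;> simp [shapeWeight, IncOn, DecOn]

/-- Inclusion-exclusion for ribbons: consecutive terms overlap in words whose increasing and
decreasing runs share a position, so the alternating sum telescopes. -/
theorem sum_alternating_shapesWeight {a : ℕ → ℕ} (ha : Function.Injective a) (o : ℕ) {c : ℕ}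
    (hc : 0 < c) (gs : List (BlockShape × ℕ)) :
    ∑ j ∈ Finset.range (c + 1),
      (-1) ^ j * shapesWeight k a o ((.inc, j) :: (.dec, c - j) :: gs) = 0 := by
  classical
  obtain ⟨m, rfl⟩ : ∃ m, c = m + 1 := ⟨c - 1, by omega⟩
  set R := shapesWeight k a (o + (m + 1)) gs
  -- The terms up to `j` add up to `(-1)^j * T j`, where both runs contain the position `o + j`; the
  -- last term of the full sum cancels `T m`.
  set T : ℕ → k := fun j => if IncOn a o (j + 1) ∧ DecOn a (o + j) (m + 1 - j) then 1 else 0 with hT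
  have h1 : ∀ j ∈ Finset.range (m + 1 + 1),
      (-1) ^ j * shapesWeight k a o ((.inc, j) :: (.dec, m + 1 - j) :: gs)
        = (-1) ^ j * (if IncOn a o j ∧ DecOn a (o + j) (m + 1 - j) then 1 else 0) * R := by
    intro j hj
    have := Finset.mem_range.mp hj
    rw [shapesWeight, shapesWeight, shapeWeight, shapeWeight, show o + j + (m + 1 - j) = o + (m + 1)
      by omega, ← mul_assoc, ← mul_assoc]
    congr 1
    rw [mul_assoc, ite_and]
    split_ifs <;> simp
  rw [Finset.sum_congr rfl h1, ← Finset.sum_mul]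
  have h2 : ∀ j ≤ m, ∑ i ∈ Finset.range (j + 1),
      (-1) ^ i * (if IncOn a o i ∧ DecOn a (o + i) (m + 1 - i) then (1 : k) else 0)
        = (-1) ^ j * T j := by
    intro j
    induction j with
    | zero =>
      intro _
      simp [hT, incOn_of_le_one]
    | succ j ih =>
      intro hj
      rw [Finset.sum_range_succ, ih (by omega)]
      obtain ⟨l, rfl⟩ : ∃ l, m = j + 1 + l := ⟨m - (j + 1), by omega⟩
      simp only [hT]
      rw [show j + 1 + l + 1 - j = l + 2 by omega, show j + 1 + l + 1 - (j + 1) = l + 1 by omega,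
        decOn_cons_iff, show j + 1 + 1 = j + 2 by rfl, incOn_succ_iff, pow_succ,
        show o + (j + 1) = o + j + 1 by rfl]
      have hne : a (o + j) ≠ a (o + j + 1) := fun h => by have := ha h; omega
      by_cases hI : IncOn a o (j + 1)
      · by_cases hD : DecOn a (o + j + 1) (l + 1)
        · rcases lt_or_gt_of_ne hne with h | h
          · simp [hI, hD, h, h.not_gt]
          · simp [hI, hD, h, h.not_gt]
        · simp [hD]
      · simp [hI]
  rw [Finset.sum_range_succ, h2 m le_rfl]
  by_cases hI : IncOn a o (m + 1) <;> simp [hT, decOn_of_le_one, pow_succ, hI]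

theorem shapesWeight_valley (a : ℕ → ℕ) (o c : ℕ) (gs : List (BlockShape × ℕ)) :
    ∑ j ∈ Finset.range (c + 1), shapesWeight k a o ((.dec, j) :: (.inc, c - j) :: gs)
      = shapesWeight k a o ((.valley, c) :: gs) := by
  rw [shapesWeight, shapeWeight, Finset.sum_mul]
  refine Finset.sum_congr rfl fun j hj => ?_
  have := Finset.mem_range.mp hj
  rw [shapesWeight, shapesWeight, shapeWeight, shapeWeight,
    show o + j + (c - j) = o + c by omega, mul_assoc]

open Classical in
theorem shapesWeight_inc (a : ℕ → ℕ) (o : ℕ) (cs : List ℕ) :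
    shapesWeight k a o (cs.map fun c => (.inc, c))
      = if ∀ p, p + 1 < cs.sum → blk cs p = blk cs (p + 1) → a (o + p) < a (o + p + 1)
        then 1 else 0 := by
  induction cs generalizing o with
  | nil => simp [shapesWeight]
  | cons c cs ih =>
    rw [List.map_cons, shapesWeight, shapeWeight, ih, ite_zero_mul_ite_zero, mul_one]
    refine if_congr ?_ rfl rfl
    rw [List.sum_cons]
    constructor
    · rintro ⟨h1, h2⟩ p hp hB
      rcases lt_trichotomy (p + 1) c with h | h | h
      · exact h1 p h
      · exfalso
        subst h
        have h3 := blk_cons_add (p + 1) cs 0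
        rw [add_zero] at h3
        rw [h3, blk_cons_of_lt _ (by omega)] at hB
        omega
      · obtain ⟨q, rfl⟩ : ∃ q, p = c + q := ⟨p - c, by omega⟩
        rw [add_assoc, blk_cons_add, blk_cons_add, add_left_inj] at hB
        have := h2 q (by omega) hB
        rwa [add_assoc o] at this
    · intro h
      refine ⟨fun p hp => h p (by omega) ?_, fun q hq hB => ?_⟩
      · rw [blk_cons_of_lt _ hp, blk_cons_of_lt _ (by omega)]
      · have := h (c + q) (by omega) (by rw [add_assoc, blk_cons_add, blk_cons_add, hB])
        rwa [← add_assoc o] at this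

end Weights

/-! ### Characters at sums over permutations with prescribed block shapes -/

namespace PermFace

variable {n : ℕ}

/-- The values of a permutation of `Fin n`, extended to an injective function. -/
def vals (σ : Equiv.Perm (Fin n)) (p : ℕ) : ℕ := if h : p < n then (σ ⟨p, h⟩ : ℕ) else p

theorem vals_coe (σ : Equiv.Perm (Fin n)) (i : Fin n) : vals σ i = σ i := dif_pos i.2

theorem vals_of_lt (σ : Equiv.Perm (Fin n)) {p : ℕ} (h : p < n) : vals σ p = σ ⟨p, h⟩ := dif_pos h

theorem vals_injective (σ : Equiv.Perm (Fin n)) : Function.Injective (vals σ) := by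
  intro p q h
  rw [vals, vals] at h
  split_ifs at h with hp hq hq
  · have := σ.injective (Fin.ext h)
    simpa using this
  · have := (σ ⟨p, hp⟩).2
    omega
  · have := (σ ⟨q, hq⟩).2
    omega
  · exact h

variable (k : Type*) [Field k]

variable (n) in
/-- The sum of the permutations whose blocks have prescribed shapes. -/
def shapeSum (gs : List (BlockShape × ℕ)) : MonoidAlgebra k (Equiv.Perm (Fin n)) :=
  ∑ σ : Equiv.Perm (Fin n), shapesWeight k (vals σ) 0 gs • MonoidAlgebra.of k _ σ

theorem shapeSum_coeff (gs : List (BlockShape × ℕ)) (σ : Equiv.Perm (Fin n)) :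
    (shapeSum n k gs).coeff σ = shapesWeight k (vals σ) 0 gs := by
  classical
  have : (shapeSum n k gs).coeff σ
      = ∑ τ : Equiv.Perm (Fin n), (if τ = σ then shapesWeight k (vals τ) 0 gs else 0) := by
    simp [shapeSum, MonoidAlgebra.of_apply, Finsupp.single_apply]
  rw [this, Finset.sum_ite_eq']
  simp

theorem shapeSum_inc {cs : List ℕ} (hsum : cs.sum = n) :
    shapeSum n k (cs.map fun c => (.inc, c))
      = descentSum (Equiv.Perm (Fin n)) k (chamber n) (face n cs) := by
  classical
  ext σ
  rw [shapeSum_coeff, descentSum_coeff, shapesWeight_inc]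
  refine if_congr ?_ rfl rfl
  rw [face_mul_inv_smul_iff, hsum]
  simp only [zero_add]
  have h1 := strictMono_on_blocks_iff (n := n - 1) (blk_mono cs) (vals σ)
  constructor
  · intro h i j hij hB
    have := h1.mpr (fun p hp => h p (by omega)) i j hij (by omega) hB
    rwa [vals_coe, vals_coe, ← Fin.lt_def] at this
  · intro h p hp hB
    have := h ⟨p, by omega⟩ ⟨p + 1, hp⟩ (by simp) hB
    rwa [vals_of_lt σ (by omega), vals_of_lt σ hp, ← Fin.lt_def]

/-- The function on the multisets of level sizes which corresponds to a block shape. -/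
def shapeFactor : BlockShape → ℕ → k
  | .inc => 1
  | .dec => altWeight
  | .valley => altWeight + 1

theorem shapeFactor_inc : shapeFactor k .inc = 1 := rfl

theorem shapeFactor_dec : shapeFactor k .dec = altWeight := rfl

theorem shapeFactor_valley : shapeFactor k .valley = altWeight + 1 := rfl

/-- The types of the faces of the fundamental chamber. -/
abbrev FaceType (n : ℕ) : Type := {us : List ℕ // (∀ u ∈ us, 0 < u) ∧ us.sum = n}

variable (n) in
/-- The graph of the map from the descent algebra to the values of its characters. -/
def charGraph : Submodule k (MonoidAlgebra k (Equiv.Perm (Fin n)) × (FaceType n → k)) :=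
  LinearMap.range (LinearMap.prod ((isChamberSystem n).descentAlg k).val.toLinearMap
    (LinearMap.pi fun us => ((isChamberSystem n).char k (face n us.1)).toLinearMap))

/-- Since the graph is a subspace, membership in the descent algebra and the values of the
characters can be carried through linear relations simultaneously. -/
theorem mem_charGraph_iff (x : MonoidAlgebra k (Equiv.Perm (Fin n))) (v : FaceType n → k) :
    (x, v) ∈ charGraph n k ↔ ∃ hx : x ∈ (isChamberSystem n).descentAlg k,
      ∀ us, (isChamberSystem n).char k (face n us.1) ⟨x, hx⟩ = v us := by
  constructor
  · rintro ⟨y, hy⟩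
    obtain ⟨rfl, rfl⟩ := Prod.ext_iff.mp hy
    exact ⟨y.2, fun us => rfl⟩
  · rintro ⟨hx, h⟩
    exact ⟨⟨x, hx⟩, Prod.ext rfl (funext h)⟩

variable (n) in
/-- A sum of permutations together with the expected values of the characters at it. -/
def shapePair (gs : List (BlockShape × ℕ)) :
    MonoidAlgebra k (Equiv.Perm (Fin n)) × (FaceType n → k) :=
  (shapeSum n k gs, fun us => distSum (gs.map fun g => (shapeFactor k g.1, g.2)) us.1)

/-- The weights of words and the numbers `distSum` obey parallel relations; a relation that holds
for both holds for the pairs, after any prefix. -/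
theorem sum_shapePair {ι : Type*} (J : Finset ι) (s : ι → k) (gs : ι → List (BlockShape × ℕ))
    (t : k) (gs₀ : List (BlockShape × ℕ))
    (h1 : ∀ (a : ℕ → ℕ) (o : ℕ), Function.Injective a →
      ∑ j ∈ J, s j * shapesWeight k a o (gs j) = t * shapesWeight k a o gs₀)
    (h2 : ∀ U : Multiset ℕ, (∀ x ∈ U, 0 < x) →
      ∑ j ∈ J, s j * distSum ((gs j).map fun g => (shapeFactor k g.1, g.2)) U
        = t * distSum (gs₀.map fun g => (shapeFactor k g.1, g.2)) U)
    (pre : List (BlockShape × ℕ)) :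
    ∑ j ∈ J, s j • shapePair n k (pre ++ gs j) = t • shapePair n k (pre ++ gs₀) := by
  refine Prod.ext ?_ ?_
  · rw [Prod.fst_sum]
    ext σ
    simp only [shapePair, Prod.smul_fst, MonoidAlgebra.coeff_sum, Finsupp.finsetSum_apply,
      MonoidAlgebra.coeff_smul, Finsupp.smul_apply, shapeSum_coeff, shapesWeight_append,
      smul_eq_mul]
    rw [mul_left_comm, ← h1 _ _ (vals_injective σ), Finset.mul_sum]
    exact Finset.sum_congr rfl fun _ _ => mul_left_comm _ _ _
  · rw [Prod.snd_sum]
    funext us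
    have := sum_distSum_append J s _ t _ h2 (pre.map fun g => (shapeFactor k g.1, g.2))
      (U := us.1) (fun x hx => us.2.1 x hx)
    simpa [shapePair] using this

/-- All shapes are reduced to increasing blocks, for which `char_face_descentSum` applies. A valley
is a sum of decreasing-increasing pairs, and decreasing blocks are removed by the alternating
relation. The increasing blocks produced are absorbed into the prefix `bs`. -/
theorem shapePair_mem (b₀ : ℕ) (bs : List ℕ) (gs : List (BlockShape × ℕ))
    (hsum : b₀ + bs.sum + (gs.map Prod.snd).sum = n) :
    shapePair n k ((b₀ :: bs).map (fun b => (.inc, b)) ++ gs) ∈ charGraph n k := by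
  induction gs generalizing bs with
  | nil =>
    simp only [List.map_nil, List.sum_nil, add_zero] at hsum
    rw [List.append_nil, shapePair, mem_charGraph_iff,
      shapeSum_inc k (by rw [List.sum_cons, hsum])]
    refine ⟨(isChamberSystem n).descentSum_mem (face_mul_chamber _), fun us => ?_⟩
    rw [char_face_descentSum k us.2.1 us.2.2 hsum, List.map_map]
    rfl
  | cons g gs ih =>
    have hinc : ∀ (bs : List ℕ) (c : ℕ), b₀ + bs.sum + (c + (gs.map Prod.snd).sum) = n →
        shapePair n k ((b₀ :: bs).map (fun b => (.inc, b)) ++ (.inc, c) :: gs)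
          ∈ charGraph n k := by
      intro bs c h
      have := ih (bs ++ [c]) (by rw [List.sum_append, List.sum_singleton]; omega)
      simpa using this
    have hdec : ∀ (gs : List (BlockShape × ℕ)), (∀ (bs : List ℕ),
        b₀ + bs.sum + (gs.map Prod.snd).sum = n →
          shapePair n k ((b₀ :: bs).map (fun b => (.inc, b)) ++ gs) ∈ charGraph n k) →
        ∀ (c : ℕ) (bs : List ℕ), b₀ + bs.sum + (c + (gs.map Prod.snd).sum) = n →
        shapePair n k ((b₀ :: bs).map (fun b => (.inc, b)) ++ (.dec, c) :: gs)
          ∈ charGraph n k := by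
      intro gs ih c
      induction c using Nat.strong_induction_on with
      | _ c ihc =>
        intro bs h
        rcases Nat.eq_zero_or_pos c with rfl | hc
        · have h1 := sum_shapePair (n := n) k {()} (fun _ => 1) (fun _ => gs) 1 ((.dec, 0) :: gs)
            (fun a o _ => by simp [shapesWeight_cons_zero])
            (fun U hU => by simp [distSum_cons_zero _ _ hU])
            ((b₀ :: bs).map (fun b => (.inc, b)))
          rw [Finset.sum_singleton, one_smul, one_smul] at h1
          rw [← h1]
          exact ih bs (by omega)
        -- The alternating relation is solved for its term `j = 0`. In the other terms, indexed by
        -- `j + 1`, the decreasing block is shorter.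
        · have h1 := sum_shapePair (n := n) k (Finset.range c) (fun j => (-1) ^ (j + 1))
            (fun j => (.inc, j + 1) :: (.dec, c - (j + 1)) :: gs) (-1) ((.dec, c) :: gs)
            (fun a o ha => by
              have h2 := sum_alternating_shapesWeight (k := k) ha o hc gs
              rw [Finset.sum_range_succ', shapesWeight_cons_zero] at h2
              linear_combination h2)
            (fun U hU => by
              have h2 := sum_alternating_distSum (k := k) hc
                (gs.map fun g => (shapeFactor k g.1, g.2)) U
              rw [Finset.sum_range_succ', distSum_cons_zero _ _ hU] at h2
              simp only [List.map_cons, shapeFactor_inc, shapeFactor_dec]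
              simp only [pow_zero, one_mul, Nat.sub_zero] at h2
              linear_combination h2)
            ((b₀ :: bs).map (fun b => (.inc, b)))
          rw [neg_one_smul, eq_neg_iff_add_eq_zero, ← neg_eq_iff_add_eq_zero] at h1
          rw [← h1]
          refine neg_mem (Submodule.sum_mem _ fun j hj => Submodule.smul_mem _ _ ?_)
          have hj := Finset.mem_range.mp hj
          have := ihc (c - (j + 1)) (by omega) (bs ++ [j + 1])
            (by rw [List.sum_append, List.sum_singleton]; omega)
          simpa using this
    obtain ⟨s, c⟩ := g
    rw [List.map_cons, List.sum_cons] at hsum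
    cases s with
    | inc => exact hinc bs c hsum
    | dec => exact hdec gs ih c bs hsum
    | valley =>
      have h1 := sum_shapePair (n := n) k (Finset.range (c + 1)) (fun j => 1)
        (fun j => (.dec, j) :: (.inc, c - j) :: gs) 1 ((.valley, c) :: gs)
        (fun a o _ => by simp only [one_mul, shapesWeight_valley])
        (fun U hU => by
          simp only [one_mul, List.map_cons, shapeFactor_inc, shapeFactor_dec, shapeFactor_valley]
          exact sum_distSum_cons_cons _ _ _ _ _)
        ((b₀ :: bs).map (fun b => (.inc, b)))
      rw [one_smul] at h1
      rw [← h1]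
      refine Submodule.sum_mem _ fun j hj => Submodule.smul_mem _ _ ?_
      have hj := Finset.mem_range.mp hj
      simp only at hsum
      refine hdec _ (fun bs h => hinc bs _ ?_) j bs ?_
      · simpa using h
      · simp only [List.map_cons, List.sum_cons]
        omega

end PermFace

/-! ### Forgetting the signs -/

/-- The value at `p` of a word is forced to be positive if the word increases at `p` with respect
to the absolute values, and has no descent there. -/
def PlusForced (a : ℕ → ℕ) (J : Finset ℕ) (p : ℕ) : Prop := p ∉ J ∧ (p = 0 ∨ a (p - 1) < a p)

/-- The value at `p` of a word is forced to be negative if the word decreases after `p` with respect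
to the absolute values, and has no descent there. -/
def MinusForced (n : ℕ) (a : ℕ → ℕ) (J : Finset ℕ) (p : ℕ) : Prop :=
  p + 1 < n ∧ p + 1 ∉ J ∧ a (p + 1) < a p

section

variable (k : Type*) [Field k]

open Classical in
/-- The number of possible signs of the value at `p`. -/
def signCount (n : ℕ) (a : ℕ → ℕ) (J : Finset ℕ) (p : ℕ) : k :=
  (if MinusForced n a J p then 0 else 1) + (if PlusForced a J p then 0 else 1)

variable {k}

-- A block of a signed permutation without internal descents has negative values with decreasing
-- absolute values followed by positive values with increasing ones; the turning point is the number
-- of minus signs. In the induction `P m` counts the choices with a positive last value, and the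
-- other term the choice with all values negative.
open Classical in
theorem prod_eq_shapeWeight_valley {a : ℕ → ℕ} (ha : Function.Injective a) (o m : ℕ) :
    (∏ j ∈ Finset.range m, ((if a (o + j + 1) < a (o + j) then 0 else 1)
        + (if j ≠ 0 ∧ a (o + (j - 1)) < a (o + j) then 0 else 1)))
      * (1 + (if m ≠ 0 ∧ a (o + (m - 1)) < a (o + m) then 0 else 1))
      = shapeWeight k a .valley o (m + 1) := by
  set P : ℕ → k := fun m => ∏ j ∈ Finset.range m, ((if a (o + j + 1) < a (o + j) then 0 else 1)
        + (if j ≠ 0 ∧ a (o + (j - 1)) < a (o + j) then 0 else 1)) with hP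
  have key : ∀ m, (if DecOn a o (m + 1) then (1 : k) else 0)
        = P m * (if m ≠ 0 ∧ a (o + (m - 1)) < a (o + m) then 0 else 1) ∧
      ∑ i ∈ Finset.range (m + 1), (if DecOn a o i then (1 : k) else 0)
        * (if IncOn a (o + i) (m + 1 - i) then 1 else 0) = P m := by
    intro m
    induction m with
    | zero =>
      have hd : DecOn a o 0 := decOn_of_le_one a o (by omega)
      have hd' : DecOn a o 1 := decOn_of_le_one a o le_rfl
      have hi : IncOn a o 1 := incOn_of_le_one a o le_rfl
      simp only [hP, zero_add, Finset.sum_range_one, Finset.prod_range_zero, add_zero, Nat.sub_zero,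
        if_pos hd, if_pos hd', if_pos hi, ne_eq, not_true_eq_false, false_and, if_false, mul_one,
        and_self]
    | succ m ih =>
      obtain ⟨ih1, ih2⟩ := ih
      have hne : a (o + m) ≠ a (o + m + 1) := fun h => by have := ha h; omega
      have hP' : P (m + 1) = P m * ((if a (o + m + 1) < a (o + m) then 0 else 1)
          + (if m ≠ 0 ∧ a (o + (m - 1)) < a (o + m) then 0 else 1)) := Finset.prod_range_succ _ _
      constructor
      · rw [hP', decOn_succ_iff]
        rw [Nat.add_sub_cancel, show o + (m + 1) = o + m + 1 by rfl]
        rcases lt_or_gt_of_ne hne with h | h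
        · simp [h, h.not_gt]
        · simp only [h, h.not_gt, and_true, if_true, zero_add, and_false, if_false, mul_one, ih1]
      · rw [Finset.sum_range_succ, ih1]
        have h1 : ∀ i ∈ Finset.range (m + 1), (if DecOn a o i then (1 : k) else 0)
              * (if IncOn a (o + i) (m + 1 + 1 - i) then 1 else 0)
            = (if DecOn a o i then (1 : k) else 0) * (if IncOn a (o + i) (m + 1 - i) then 1 else 0)
              * (if a (o + m + 1) < a (o + m) then 0 else 1) := by
          intro i hi
          have := Finset.mem_range.mp hi
          obtain ⟨l, rfl⟩ : ∃ l, m = i + l := ⟨m - i, by omega⟩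
          rw [show i + l + 1 + 1 - i = l + 2 by omega, show i + l + 1 - i = l + 1 by omega,
            incOn_succ_iff, ← add_assoc]
          rw [← add_assoc] at hne
          rcases lt_or_gt_of_ne hne with h | h
          · simp [h, h.not_gt]
          · simp [h, h.not_gt]
        have hi : IncOn a (o + (m + 1)) (m + 1 + 1 - (m + 1)) := incOn_of_le_one _ _ (by omega)
        rw [Finset.sum_congr rfl h1, ← Finset.sum_mul, ih2, hP', if_pos hi, mul_one, ← mul_add]
  obtain ⟨h1, h2⟩ := key m
  have hi : IncOn a (o + (m + 1)) (m + 1 - (m + 1)) := incOn_of_le_one _ _ (by omega)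
  rw [shapeWeight, Finset.sum_range_succ, h2, h1, if_pos hi, mul_one, mul_add, mul_one]

-- The first block comes after `w(0) = 0` without a descent, so all its values are positive: there
-- is one lift if the word increases and none otherwise.
open Classical in
theorem prod_eq_shapeWeight_inc {a : ℕ → ℕ} (ha : Function.Injective a) (m : ℕ) :
    (∏ j ∈ Finset.range m, ((if a (j + 1) < a j then 0 else 1)
        + (if j = 0 ∨ a (j - 1) < a j then 0 else 1)))
      * (1 + (if m = 0 ∨ a (m - 1) < a m then 0 else 1))
      = shapeWeight k a .inc 0 (m + 1) := by
  have h0 : ∀ m, IncOn a 0 (m + 1) → (m = 0 ∨ a (m - 1) < a m) := by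
    intro m h
    rcases m with _ | m
    · exact Or.inl rfl
    · exact Or.inr (by simpa using h m (by omega))
  have key : ∀ m, ∏ j ∈ Finset.range m, ((if a (j + 1) < a j then 0 else 1)
        + (if j = 0 ∨ a (j - 1) < a j then 0 else 1)) = if IncOn a 0 (m + 1) then (1 : k) else 0 := by
    intro m
    induction m with
    | zero => simp [incOn_of_le_one]
    | succ m ih =>
      have hne : a m ≠ a (m + 1) := fun h => by have := ha h; omega
      rw [Finset.prod_range_succ, ih, incOn_succ_iff, zero_add]
      by_cases h : IncOn a 0 (m + 1)
      · rw [if_pos (h0 m h)]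
        rcases lt_or_gt_of_ne hne with h1 | h1 <;> simp [h, h1, h1.not_gt]
      · simp [h]
  rw [key, shapeWeight]
  by_cases h : IncOn a 0 (m + 1)
  · simp [h, h0 m h]
  · simp [h]

/-- The sign counts factor over the blocks. Agreement of `J` with the cuts is required only from `o`
on, so that the induction may forget earlier blocks. -/
theorem prod_signCount_valley {n : ℕ} {a : ℕ → ℕ} (ha : Function.Injective a) {o : ℕ} {bs : List ℕ}
    (hbs : ∀ b ∈ bs, 0 < b) (hsum : o + bs.sum = n) (J : Finset ℕ)
    (hJ : ∀ p, o ≤ p → (p ∈ J ↔ p ∈ cuts o bs)) :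
    ∏ j ∈ Finset.range bs.sum, signCount k n a J (o + j)
      = shapesWeight k a o (bs.map fun b => (.valley, b)) := by
  classical
  induction bs generalizing o with
  | nil => simp [shapesWeight]
  | cons b bs ih =>
    obtain ⟨m, rfl⟩ : ∃ m, b = m + 1 := ⟨b - 1, by have := hbs b (by simp); omega⟩
    rw [List.sum_cons] at hsum ⊢
    rw [List.map_cons, shapesWeight, Finset.prod_range_add]
    have hrest := ih (o := o + (m + 1)) (fun b hb => hbs b (by simp [hb])) (by omega) fun p hp => by
      rw [hJ p (by omega), cuts, Finset.mem_insert]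
      exact or_iff_right (by omega)
    simp only [← add_assoc] at hrest ⊢
    rw [hrest]
    congr 1
    rw [← prod_eq_shapeWeight_valley ha, Finset.prod_range_succ]
    have hin : ∀ j, 0 < j → j < m + 1 → o + j ∉ J := by
      intro j h1 h2 h3
      rw [hJ _ (by omega), cuts, Finset.mem_insert] at h3
      rcases h3 with h3 | h3
      · omega
      · have := le_of_mem_cuts h3
        omega
    have ho : o ∈ J := by
      rw [hJ o le_rfl]
      exact Finset.mem_insert_self _ _
    have hplus : ∀ j, j < m + 1 →
        (PlusForced a J (o + j) ↔ j ≠ 0 ∧ a (o + (j - 1)) < a (o + j)) := by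
      intro j hj
      rcases j with _ | j
      · simp [PlusForced, ho]
      · have := hin (j + 1) (by omega) hj
        simp only [PlusForced, this, not_false_eq_true, true_and, Nat.add_sub_cancel]
        rw [show o + (j + 1) - 1 = o + j by omega]
        constructor
        · rintro (h | h)
          · omega
          · exact ⟨by omega, h⟩
        · exact fun h => Or.inr h.2
    have hminus : ∀ j, j < m → (MinusForced n a J (o + j) ↔ a (o + j + 1) < a (o + j)) := by
      intro j hj
      rw [MinusForced, add_assoc]
      exact ⟨fun h => h.2.2, fun h => ⟨by omega, hin _ (by omega) (by omega), h⟩⟩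
    -- The position after the end of a block is a cut or lies beyond `n`, so it imposes no
    -- condition.
    have hlast : ¬ MinusForced n a J (o + m) := by
      rintro ⟨h1, h2, -⟩
      apply h2
      rw [hJ _ (by omega), cuts, Finset.mem_insert]
      right
      rcases bs with _ | ⟨b, bs⟩
      · simp at hsum
        omega
      · exact Finset.mem_insert_self _ _
    congr 1
    · refine Finset.prod_congr rfl fun j hj => ?_
      have hj := Finset.mem_range.mp hj
      rw [signCount, if_congr (hminus j hj) rfl rfl, if_congr (hplus j (by omega)) rfl rfl]
    · rw [signCount, if_neg hlast, if_congr (hplus m (by omega)) rfl rfl]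

theorem prod_signCount_cuts {n : ℕ} {a : ℕ → ℕ} (ha : Function.Injective a) {b₀ : ℕ} {bs : List ℕ}
    (hbs : ∀ b ∈ bs, 0 < b) (hsum : b₀ + bs.sum = n) :
    ∏ p ∈ Finset.range n, signCount k n a (cuts b₀ bs) p
      = shapesWeight k a 0 ((.inc, b₀) :: bs.map fun b => (.valley, b)) := by
  classical
  rw [shapesWeight, zero_add, ← prod_signCount_valley ha hbs hsum (cuts b₀ bs) fun _ _ => Iff.rfl,
    ← hsum, Finset.prod_range_add]
  congr 1
  rcases b₀ with _ | m
  · simp [shapeWeight, incOn_of_le_one]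
  simp only at hsum ⊢
  rw [← prod_eq_shapeWeight_inc ha, Finset.prod_range_succ]
  have hin : ∀ j, j < m + 1 → j ∉ cuts (m + 1) bs := by
    intro j h1 h2
    have := le_of_mem_cuts h2
    omega
  have hplus : ∀ j, j < m + 1 →
      (PlusForced a (cuts (m + 1) bs) j ↔ j = 0 ∨ a (j - 1) < a j) := by
    intro j hj
    rw [PlusForced, and_iff_right (hin j hj)]
  have hminus : ∀ j, j < m → (MinusForced (m + 1 + bs.sum) a (cuts (m + 1) bs) j ↔
      a (j + 1) < a j) := by
    intro j hj
    rw [MinusForced]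
    exact ⟨fun h => h.2.2, fun h => ⟨by omega, hin _ (by omega), h⟩⟩
  have hlast : ¬ MinusForced (m + 1 + bs.sum) a (cuts (m + 1) bs) m := by
    rintro ⟨h1, h2, -⟩
    apply h2
    rcases bs with _ | ⟨b, bs⟩
    · simp at h1
    · exact Finset.mem_insert_self _ _
  congr 1
  · refine Finset.prod_congr rfl fun j hj => ?_
    have hj := Finset.mem_range.mp hj
    rw [signCount, if_congr (hminus j hj) rfl rfl, if_congr (hplus j (by omega)) rfl rfl]
  · rw [signCount, if_neg hlast, if_congr (hplus m (by omega)) rfl rfl]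

end

/-! ### The fibers of the map that forgets the signs -/

section Forget

variable (k : Type*) [Field k] {n : ℕ}

variable (n) in
/-- The homomorphism of group algebras which forgets the signs. -/
def forget : MonoidAlgebra k (SignedPerm n) →ₐ[k] MonoidAlgebra k (Equiv.Perm (Fin n)) :=
  MonoidAlgebra.mapDomainAlgHom k k
    (SemidirectProduct.rightHom : SignedPerm n →* Equiv.Perm (Fin n))

theorem forget_of (w : SignedPerm n) :
    forget k n (MonoidAlgebra.of k _ w) = MonoidAlgebra.of k _ w.right := by
  simp [forget, MonoidAlgebra.of_apply]

/-- In a comparison of neighbouring values only the sign of the one with larger absolute value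
matters. So the absence of a descent forces one sign, and the conditions at different positions are
independent. Since `left` is indexed by values, the signs `s` of positions are moved by `σ⁻¹`. -/
theorem des_subset_iff (σ : Equiv.Perm (Fin n)) (s : Fin n → ℤˣ) (J : Finset ℕ) :
    SignedPerm.des (⟨fun i => s (σ⁻¹ i), σ⟩ : SignedPerm n) ⊆ J ↔
      ∀ p : Fin n, (PlusForced (PermFace.vals σ) J p → s p = 1) ∧
        (MinusForced n (PermFace.vals σ) J p → s p = -1) := by
  set w : SignedPerm n := ⟨fun i => s (σ⁻¹ i), σ⟩ with hw
  set a := PermFace.vals σ with ha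
  have happ : ∀ p (hp : p < n), w.apply (p + 1) = s ⟨p, hp⟩ * (a p + 1) := by
    intro p hp
    rw [SignedIdx.apply_succ w ⟨p, hp⟩, ha, PermFace.vals_of_lt σ hp]
    simp [hw]
  have h0 : w.des ⊆ J ↔ ∀ p < n, p ∉ J → w.apply p < w.apply (p + 1) := by
    constructor
    · intro h p hp hpJ
      by_contra hlt
      refine hpJ (h ?_)
      rw [SignedPerm.des, Finset.mem_filter, Finset.mem_range]
      have := SignedIdx.apply_ne_apply_succ w hp
      exact ⟨hp, by omega⟩
    · intro h p hp
      rw [SignedPerm.des, Finset.mem_filter, Finset.mem_range] at hp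
      by_contra hpJ
      have := h p hp.1 hpJ
      omega
  have hz : ∀ hp : 0 < n, w.apply 0 < w.apply (0 + 1) ↔ s ⟨0, hp⟩ = 1 := by
    intro hp
    rw [SignedIdx.apply_zero, happ 0 hp]
    rcases Int.units_eq_one_or (s ⟨0, hp⟩) with h | h <;> rw [h]
    · simp only [Units.val_one, one_mul, iff_true]
      omega
    · simp only [Units.val_neg, Units.val_one, neg_mul, one_mul]
      exact iff_of_false (by omega) (by decide)
  have hs1 : ∀ p (hp : p + 1 < n), a p < a (p + 1) →
      (w.apply (p + 1) < w.apply (p + 1 + 1) ↔ s ⟨p + 1, hp⟩ = 1) := by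
    intro p hp hlt
    rw [happ p (by omega), happ (p + 1) hp]
    rcases Int.units_eq_one_or (s ⟨p + 1, hp⟩) with h | h <;> rw [h] <;>
    rcases Int.units_eq_one_or (s ⟨p, by omega⟩) with h' | h' <;> rw [h'] <;>
      simp only [Units.val_neg, Units.val_one, neg_mul, one_mul]
    · exact iff_of_true (by omega) trivial
    · exact iff_of_true (by omega) trivial
    · exact iff_of_false (by omega) (by decide)
    · exact iff_of_false (by omega) (by decide)
  have hs2 : ∀ p (hp : p + 1 < n), a (p + 1) < a p →
      (w.apply (p + 1) < w.apply (p + 1 + 1) ↔ s ⟨p, by omega⟩ = -1) := by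
    intro p hp hlt
    rw [happ p (by omega), happ (p + 1) hp]
    rcases Int.units_eq_one_or (s ⟨p + 1, hp⟩) with h | h <;> rw [h] <;>
    rcases Int.units_eq_one_or (s ⟨p, by omega⟩) with h' | h' <;> rw [h'] <;>
      simp only [Units.val_neg, Units.val_one, neg_mul, one_mul]
    · exact iff_of_false (by omega) (by decide)
    · exact iff_of_true (by omega) trivial
    · exact iff_of_false (by omega) (by decide)
    · exact iff_of_true (by omega) trivial
  rw [h0]
  constructor
  · rintro h ⟨p, hp⟩
    constructor
    · rintro ⟨h1, h2⟩
      rcases p with _ | p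
      · exact (hz hp).mp (h 0 hp h1)
      · exact (hs1 p hp (by simpa using h2)).mp (h (p + 1) hp h1)
    · rintro ⟨h1, h2, h3⟩
      exact (hs2 p h1 h3).mp (h (p + 1) h1 h2)
  · intro h p hp hpJ
    rcases p with _ | p
    · exact (hz hp).mpr ((h ⟨0, hp⟩).1 ⟨hpJ, Or.inl rfl⟩)
    · have hne : a p ≠ a (p + 1) := fun h => by
        have := PermFace.vals_injective σ h
        omega
      rcases lt_or_gt_of_ne hne with h1 | h1
      · exact (hs1 p hp h1).mpr ((h ⟨p + 1, hp⟩).1 ⟨hpJ, Or.inr (by simpa using h1)⟩)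
      · exact (hs2 p hp h1).mpr ((h ⟨p, by omega⟩).2 ⟨hp, hpJ, h1⟩)

theorem forget_descentX_coeff (J : Finset ℕ) (σ : Equiv.Perm (Fin n)) :
    (forget k n (descentX k n J)).coeff σ
      = ∏ p ∈ Finset.range n, signCount k n (PermFace.vals σ) J p := by
  classical
  have h1 : (forget k n (descentX k n J)).coeff σ
      = ((Finset.univ.filter fun w : SignedPerm n => w.des ⊆ J ∧ w.right = σ).card : k) := by
    rw [descentX, map_sum, Finset.sum_congr rfl fun w _ => forget_of k w]
    simp only [MonoidAlgebra.coeff_sum, Finsupp.finsetSum_apply, MonoidAlgebra.of_apply]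
    simp [Finsupp.single_apply, Finset.filter_filter]
  have h2 : (Finset.univ.filter fun w : SignedPerm n => w.des ⊆ J ∧ w.right = σ).card
      = (Fintype.piFinset fun p : Fin n => Finset.univ.filter fun s : ℤˣ =>
          (PlusForced (PermFace.vals σ) J p → s = 1) ∧
            (MinusForced n (PermFace.vals σ) J p → s = -1)).card := by
    refine Finset.card_nbij' (fun w p => w.left (σ p)) (fun s => ⟨fun i => s (σ⁻¹ i), σ⟩) ?_ ?_ ?_ ?_
    · intro w hw
      obtain ⟨hw, rfl⟩ := (Finset.mem_filter.mp hw).2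
      rw [Finset.mem_coe, Fintype.mem_piFinset]
      intro p
      rw [Finset.mem_filter]
      refine ⟨Finset.mem_univ _, ?_⟩
      refine (des_subset_iff w.right (fun p => w.left (w.right p)) J).mp ?_ p
      convert hw using 2
      simp
    · intro s hs
      rw [Finset.mem_coe, Fintype.mem_piFinset] at hs
      rw [Finset.mem_coe, Finset.mem_filter]
      exact ⟨Finset.mem_univ _, (des_subset_iff σ s J).mpr fun p => (Finset.mem_filter.mp (hs p)).2,
        rfl⟩
    · intro w hw
      obtain ⟨hw, rfl⟩ := (Finset.mem_filter.mp hw).2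
      simp
    · intro s hs
      simp
  rw [h1, h2, Fintype.card_piFinset, Nat.cast_prod, Finset.prod_range]
  refine Finset.prod_congr rfl fun p _ => ?_
  rw [signCount]
  have h3 : (Finset.univ : Finset ℤˣ) = {1, -1} := rfl
  rw [h3]
  by_cases hp : PlusForced (PermFace.vals σ) J p <;>
    by_cases hm : MinusForced n (PermFace.vals σ) J p <;>
    simp [hp, hm, Finset.filter_insert, Finset.filter_singleton]
  norm_num

theorem forget_descentX_cuts {b₀ : ℕ} {bs : List ℕ} (hbs : ∀ b ∈ bs, 0 < b)
    (hsum : b₀ + bs.sum = n) :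
    forget k n (descentX k n (cuts b₀ bs))
      = PermFace.shapeSum n k ((.inc, b₀) :: bs.map fun b => (.valley, b)) := by
  ext σ
  rw [forget_descentX_coeff, PermFace.shapeSum_coeff,
    prod_signCount_cuts (PermFace.vals_injective σ) hbs hsum]

end Forget

/-! ### Peaks and the image of the descent algebra -/

theorem isSparse_peak {n : ℕ} (σ : Equiv.Perm (Fin n)) : IsSparse n (peak σ) := by
  refine ⟨Finset.filter_subset _ _, fun i hi hi' => ?_⟩
  rw [peak, Finset.mem_filter] at hi hi'
  have h1 := hi.2.2
  have h2 := hi'.2.1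
  rw [Nat.add_sub_cancel] at h2
  omega

theorem permApply_succ {n : ℕ} (σ : Equiv.Perm (Fin n)) {p : ℕ} (hp : p < n) :
    permApply σ (p + 1) = PermFace.vals σ p + 1 := by
  have h : 0 < p + 1 ∧ p + 1 ≤ n := by omega
  simp only [permApply, dif_pos h, PermFace.vals_of_lt σ hp, Nat.add_sub_cancel]

theorem succ_mem_peak_iff {n : ℕ} (σ : Equiv.Perm (Fin n)) (p : ℕ) :
    p + 1 ∈ peak σ ↔ p + 1 < n ∧
      (p = 0 ∨ PermFace.vals σ (p - 1) < PermFace.vals σ p) ∧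
        PermFace.vals σ (p + 1) < PermFace.vals σ p := by
  rw [peak, Finset.mem_filter, Finset.mem_Icc, Nat.add_sub_cancel]
  by_cases hp : p + 1 < n
  · rw [permApply_succ σ hp, permApply_succ σ (by omega : p < n)]
    rcases p with _ | p
    · have : permApply σ 0 = 0 := by simp [permApply]
      rw [this]
      simp only [true_or, true_and]
      omega
    · rw [permApply_succ σ (by omega : p < n)]
      simp only [Nat.add_sub_cancel]
      omega
  · exact iff_of_false (by omega) (by omega)

theorem zero_notMem_peak {n : ℕ} (σ : Equiv.Perm (Fin n)) : 0 ∉ peak σ := fun h => by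
  simpa using (isSparse_peak σ).1 h

/-- The set of possible peaks which is given by a set of descents. -/
def peakSet (J : Finset ℕ) : Finset ℕ := J ∪ J.image (· + 1)

theorem mem_peakSet {J : Finset ℕ} {p : ℕ} : p ∈ peakSet J ↔ p ∈ J ∨ ∃ q ∈ J, q + 1 = p := by
  simp [peakSet]

theorem succ_mem_peakSet {J : Finset ℕ} {p : ℕ} : p + 1 ∈ peakSet J ↔ p + 1 ∈ J ∨ p ∈ J := by
  simp [mem_peakSet]

section

variable (k : Type*) [Field k] {n : ℕ}

/-- Every `p ∉ J` forces exactly one sign: plus at `p` on an ascent (or at `p = 0`), minus at `p -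
1` on a descent. Unless some position is forced both ways, exactly `J.card` positions stay free,
each with two signs. -/
theorem prod_signCount_eq (σ : Equiv.Perm (Fin n)) {J : Finset ℕ} (hJ : J ⊆ Finset.range n) :
    ∏ p ∈ Finset.range n, signCount k n (PermFace.vals σ) J p
      = if peak σ ⊆ peakSet J then 2 ^ J.card else 0 := by
  classical
  set a := PermFace.vals σ with ha
  split_ifs with hT
  · have hnot : ∀ p, PlusForced a J p → ¬ MinusForced n a J p := by
      rintro p ⟨h1, h2⟩ ⟨h3, h4, h5⟩
      have := hT ((succ_mem_peak_iff σ p).mpr ⟨h3, h2, h5⟩)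
      rw [succ_mem_peakSet] at this
      tauto
    have h1 : ∀ p ∈ Finset.range n, signCount k n a J p
        = 2 ^ (if PlusForced a J p ∨ MinusForced n a J p then 0 else 1) := by
      intro p _
      rw [signCount]
      by_cases h2 : PlusForced a J p
      · simp [h2, hnot p h2]
      · by_cases h3 : MinusForced n a J p
        · simp [h2, h3]
        · simp [h2, h3]
          norm_num
    rw [Finset.prod_congr rfl h1, Finset.prod_pow_eq_pow_sum]
    congr 1
    have h2 : ∀ p, (if PlusForced a J p ∨ MinusForced n a J p then 0 else 1)
        + ((if PlusForced a J p then 1 else 0) + (if MinusForced n a J p then 1 else 0)) = 1 := by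
      intro p
      have := hnot p
      by_cases h2 : PlusForced a J p
      · simp [h2, this h2]
      · by_cases h3 : MinusForced n a J p <;> simp [h2, h3]
    -- Minus signs are recharged to the next position, which is the one missing from `J`.
    have h3 : ∑ p ∈ Finset.range n, (if MinusForced n a J p then 1 else 0)
        = ∑ p ∈ Finset.range n, if p ≠ 0 ∧ p ∉ J ∧ a p < a (p - 1) then 1 else 0 := by
      rcases n with _ | m
      · simp
      · rw [Finset.sum_range_succ, Finset.sum_range_succ', if_neg (fun h => by have := h.1; omega),
          if_neg (by simp)]
        congr 1
        refine Finset.sum_congr rfl fun p hp => if_congr ?_ rfl rfl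
        have := Finset.mem_range.mp hp
        simp only [MinusForced, Nat.add_sub_cancel]
        constructor
        · exact fun h => ⟨by omega, h.2⟩
        · exact fun h => ⟨by omega, h.2⟩
    have h4 : ∀ p, (if PlusForced a J p then 1 else 0)
        + (if p ≠ 0 ∧ p ∉ J ∧ a p < a (p - 1) then 1 else 0) = if p ∈ J then 0 else 1 := by
      intro p
      by_cases hp : p ∈ J
      · simp [PlusForced, hp]
      · rcases p with _ | p
        · simp [PlusForced, hp]
        · have hne : a p ≠ a (p + 1) := fun h => by
            have := PermFace.vals_injective σ h
            omega
          simp only [PlusForced, hp, Nat.add_sub_cancel]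
          rcases lt_or_gt_of_ne hne with h | h <;> simp [h, h.not_gt]
    have h5 := Finset.sum_congr (rfl : Finset.range n = _) fun p _ => h2 p
    have h6 := Finset.sum_congr (rfl : Finset.range n = _) fun p _ => h4 p
    rw [Finset.sum_add_distrib, Finset.sum_add_distrib, h3] at h5
    rw [Finset.sum_add_distrib] at h6
    have h7 : ∑ p ∈ Finset.range n, (if p ∈ J then 0 else 1) + J.card = n := by
      have h8 : J.card = ∑ p ∈ Finset.range n, if p ∈ J then 1 else 0 := by
        rw [Finset.sum_boole, Finset.filter_mem_eq_inter, Finset.inter_eq_right.mpr hJ]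
        rfl
      rw [h8, ← Finset.sum_add_distrib]
      refine (Finset.sum_congr rfl fun p _ => ?_).trans
        (by simp : ∑ p ∈ Finset.range n, 1 = n)
      split_ifs <;> rfl
    rw [Finset.sum_const, Finset.card_range, smul_eq_mul, mul_one] at h5
    omega
  · obtain ⟨i, hi, hiT⟩ := Finset.not_subset.mp hT
    obtain ⟨p, rfl⟩ : ∃ p, i = p + 1 := ⟨i - 1, by
      have : i ≠ 0 := fun h => zero_notMem_peak σ (h ▸ hi)
      omega⟩
    obtain ⟨h1, h2, h3⟩ := (succ_mem_peak_iff σ p).mp hi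
    rw [succ_mem_peakSet, not_or] at hiT
    refine Finset.prod_eq_zero (Finset.mem_range.mpr (by omega : p < n)) ?_
    rw [signCount, if_pos ⟨h1, hiT.1, h3⟩, if_pos ⟨hiT.2, h2⟩, add_zero]

variable (n) in
instance : Fintype {F : Finset ℕ // IsSparse n F} := by
  classical
  exact Fintype.subtype ((Finset.Icc 1 (n - 1)).powerset.filter (IsSparse n)) fun F => by
    rw [Finset.mem_filter, Finset.mem_powerset]
    exact ⟨fun h => h.2, fun h => ⟨h.1, h⟩⟩

variable (n) in
/-- The sum of the permutations whose peaks are in `T`. -/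
def peakSum (T : Finset ℕ) : peakSpan k n :=
  ∑ F : {F : Finset ℕ // IsSparse n F} with F.1 ⊆ T, peakBasis k n F

theorem peakBasis_coe (F : {F : Finset ℕ // IsSparse n F}) :
    (peakBasis k n F : MonoidAlgebra k (Equiv.Perm (Fin n))) = peakP k n F := by
  exact congrArg Subtype.val (Module.Basis.span_apply (peakP_linearIndependent k n) F)

theorem descentBasis_coe (J : {J : Finset ℕ // J ⊆ Finset.range n}) :
    (descentBasis k n J : MonoidAlgebra k (SignedPerm n)) = descentX k n J := by
  exact congrArg Subtype.val (Module.Basis.span_apply (descentX_linearIndependent k n) J)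

theorem peakSum_coeff (T : Finset ℕ) (σ : Equiv.Perm (Fin n)) :
    (peakSum k n T : MonoidAlgebra k (Equiv.Perm (Fin n))).coeff σ
      = if peak σ ⊆ T then 1 else 0 := by
  classical
  rw [peakSum, AddSubmonoidClass.coe_finsetSum]
  simp only [MonoidAlgebra.coeff_sum, Finsupp.finsetSum_apply, peakBasis_coe, peakP_coeff]
  rw [Finset.sum_filter, Finset.sum_eq_single ⟨peak σ, isSparse_peak σ⟩]
  · simp
  · rintro ⟨F, hF⟩ - hne
    rw [if_neg fun h : peak σ = F => hne (Subtype.ext h.symm), ite_self]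
  · exact fun h => absurd (Finset.mem_univ _) h

theorem forget_descentX {J : Finset ℕ} (hJ : J ⊆ Finset.range n) :
    forget k n (descentX k n J) = (2 ^ J.card : k) • (peakSum k n (peakSet J) : peakSpan k n) := by
  ext σ
  rw [forget_descentX_coeff, prod_signCount_eq k σ hJ]
  simp only [MonoidAlgebra.coeff_smul, Finsupp.smul_apply, peakSum_coeff, smul_eq_mul, mul_ite,
    mul_one, mul_zero]

variable {k}

/-- Each element of `F'` or its successor lies in `F`, and sparseness of `F'` makes this assignment
injective. It never decreases elements, so the sum of the elements orders sparse sets triangularly.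
-/
theorem sum_le_of_isSparse {F F' : Finset ℕ} (hF : IsSparse n F) (hF' : IsSparse n F')
    (hsub : F' ⊆ peakSet (F.image (· - 1))) :
    ∑ x ∈ F', x ≤ ∑ x ∈ F, x ∧ (∑ x ∈ F', x = ∑ x ∈ F, x → F' = F) := by
  classical
  have h1 : ∀ x ∈ F, 1 ≤ x := fun x hx => (Finset.mem_Icc.mp (hF.1 hx)).1
  have hmem : ∀ x ∈ F', x ∈ F ∨ x + 1 ∈ F := by
    intro x hx
    rcases mem_peakSet.mp (hsub hx) with h | ⟨q, hq, rfl⟩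
    · obtain ⟨y, hy, rfl⟩ := Finset.mem_image.mp h
      right
      rwa [Nat.sub_add_cancel (h1 y hy)]
    · obtain ⟨y, hy, rfl⟩ := Finset.mem_image.mp hq
      left
      rwa [Nat.sub_add_cancel (h1 y hy)]
  set g : ℕ → ℕ := fun x => if x ∈ F then x else x + 1 with hg
  have hgF : ∀ x ∈ F', g x ∈ F := by
    intro x hx
    simp only [hg]
    split_ifs with h
    · exact h
    · exact (hmem x hx).resolve_left h
  have hgx : ∀ x, x ≤ g x := by
    intro x
    simp only [hg]
    split_ifs <;> omega
  have hinj : Set.InjOn g F' := by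
    intro x hx y hy hxy
    simp only [hg] at hxy
    split_ifs at hxy with h2 h3 h3
    · exact hxy
    · exact absurd (hxy ▸ hx) (hF'.2 y hy)
    · exact absurd (hxy ▸ hy) (hF'.2 x hx)
    · omega
  have himg : F'.image g ⊆ F := Finset.image_subset_iff.mpr hgF
  have hle1 : ∑ x ∈ F', x ≤ ∑ x ∈ F', g x := Finset.sum_le_sum fun x _ => hgx x
  have hle2 : ∑ x ∈ F', g x ≤ ∑ x ∈ F, x := by
    rw [← Finset.sum_image (f := fun x => x) hinj]
    exact Finset.sum_le_sum_of_subset himg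
  refine ⟨hle1.trans hle2, fun heq => ?_⟩
  have heq1 : ∑ x ∈ F', x = ∑ x ∈ F', g x := by omega
  have h2 := (Finset.sum_eq_sum_iff_of_le fun x _ => hgx x).mp heq1
  have hsub' : F' ⊆ F := fun x hx => by
    rw [h2 x hx]
    exact hgF x hx
  by_contra hne
  have hlt : ∑ x ∈ F', x < ∑ x ∈ F, x := by
    obtain ⟨y, hy, hy'⟩ := Finset.exists_of_ssubset (Finset.ssubset_iff_subset_ne.mpr ⟨hsub', hne⟩)
    exact Finset.sum_lt_sum_of_subset hsub' hy hy' (h1 y hy) fun _ _ _ => Nat.zero_le _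
  omega

/-- For `J = F - 1` the image of `X_J` is a power of `2` times `P_F` plus terms `P_F'` with a
smaller sum of elements. As `2` is invertible, every `P_F` is reached by induction. -/
theorem map_forget_descentSpan (h2 : (2 : k) ≠ 0) :
    (descentSpan k n).map (forget k n).toLinearMap = peakSpan k n := by
  classical
  apply le_antisymm
  · rw [descentSpan, Submodule.map_span, Submodule.span_le]
    rintro _ ⟨_, ⟨⟨J, hJ⟩, rfl⟩, rfl⟩
    change forget k n (descentX k n J) ∈ peakSpan k n
    rw [forget_descentX k hJ]
    exact (peakSpan k n).smul_mem _ (Subtype.prop _)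
  · rw [peakSpan, Submodule.span_le]
    rintro _ ⟨⟨F, hF⟩, rfl⟩
    change peakP k n F ∈ _
    induction hs : ∑ x ∈ F, x using Nat.strong_induction_on generalizing F with
    | _ s ih =>
      set J := F.image (· - 1)
      have hJ : J ⊆ Finset.range n := by
        intro x hx
        obtain ⟨y, hy, rfl⟩ := Finset.mem_image.mp hx
        have := Finset.mem_Icc.mp (hF.1 hy)
        rw [Finset.mem_range]
        omega
      have hFJ : F ⊆ peakSet J := by
        intro x hx
        have := Finset.mem_Icc.mp (hF.1 hx)
        exact mem_peakSet.mpr (Or.inr ⟨x - 1, Finset.mem_image_of_mem _ hx, by omega⟩)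
      have h1 : (peakSum k n (peakSet J) : MonoidAlgebra k (Equiv.Perm (Fin n)))
          ∈ (descentSpan k n).map (forget k n).toLinearMap := by
        rw [← Submodule.smul_mem_iff _ (pow_ne_zero J.card h2), ← forget_descentX k hJ]
        exact Submodule.mem_map_of_mem (descentX_mem k hJ)
      rw [peakSum, AddSubmonoidClass.coe_finsetSum,
        ← Finset.add_sum_erase _ _ (Finset.mem_filter.mpr ⟨Finset.mem_univ ⟨F, hF⟩, hFJ⟩),
        peakBasis_coe] at h1
      refine (Submodule.add_mem_iff_left _ ?_).mp h1
      refine Submodule.sum_mem _ fun F' hF' => ?_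
      obtain ⟨hne, hF'⟩ := Finset.mem_erase.mp hF'
      rw [Finset.mem_filter] at hF'
      rw [peakBasis_coe]
      obtain ⟨h3, h4⟩ := sum_le_of_isSparse hF F'.2 hF'.2
      refine ih _ ?_ F'.1 F'.2 rfl
      have : ∑ x ∈ F'.1, x ≠ ∑ x ∈ F, x := fun h => hne (Subtype.ext (h4 h))
      omega

end

/-! ### The maps `β` and `π` -/

section

variable (k : Type*) [Field k] {n : ℕ}

theorem descentX_cuts_mem {b₀ : ℕ} {bs : List ℕ} (hbs : ∀ b ∈ bs, 0 < b)
    (hsum : b₀ + bs.sum = n) : descentX k n (cuts b₀ bs) ∈ descentSpan k n :=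
  descentX_mem k (hsum ▸ cuts_subset hbs)

theorem beta_descentBasis (hn : n ≠ 0) (J : {J : Finset ℕ // J ⊆ Finset.range n}) :
    (beta k n (descentBasis k n J) : MonoidAlgebra k (SignedPerm (n - 1)))
      = if 0 ∈ J.1 then 0 else descentX k (n - 1) (J.1.image fun i => i - 1) := by
  rw [beta, if_neg hn, Module.Basis.constr_basis]
  split_ifs <;> rfl

theorem descentX_eq_basis {J : Finset ℕ} (hJ : J ⊆ Finset.range n) :
    (⟨descentX k n J, descentX_mem k hJ⟩ : descentSpan k n) = descentBasis k n ⟨J, hJ⟩ :=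
  Subtype.ext (descentBasis_coe k ⟨J, hJ⟩).symm

theorem beta_descentX_zero {bs : List ℕ} (hbs : ∀ b ∈ bs, 0 < b) (hsum : 0 + bs.sum = n)
    (hm : descentX k n (cuts 0 bs) ∈ descentSpan k n) :
    beta k n ⟨descentX k n (cuts 0 bs), hm⟩ = 0 := by
  by_cases hn : n = 0
  · rw [beta, if_pos hn, LinearMap.zero_apply]
  · apply Subtype.ext
    rw [descentX_eq_basis k (hsum ▸ cuts_subset hbs), beta_descentBasis k hn,
      if_pos ((zero_mem_cuts_iff hbs (by omega)).mpr rfl)]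
    rfl

theorem beta_descentX_succ {b₀ : ℕ} {bs : List ℕ} (hbs : ∀ b ∈ bs, 0 < b)
    (hsum : b₀ + 1 + bs.sum = n)
    (hm : descentX k n (cuts (b₀ + 1) bs) ∈ descentSpan k n) :
    (beta k n ⟨descentX k n (cuts (b₀ + 1) bs), hm⟩ : MonoidAlgebra k (SignedPerm (n - 1)))
      = descentX k (n - 1) (cuts b₀ bs) := by
  rw [descentX_eq_basis k (hsum ▸ cuts_subset hbs), beta_descentBasis k (by omega),
    if_neg (fun h => by have := (zero_mem_cuts_iff hbs (by omega)).mp h; omega)]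
  change descentX k (n - 1) ((cuts (b₀ + 1) bs).image fun i => i - 1) = _
  congr 1
  rw [cuts_add, Finset.image_image]
  exact (Finset.image_congr fun x _ => by simp).trans Finset.image_id

theorem piMap_peakBasis (hn : 2 ≤ n) (F : {F : Finset ℕ // IsSparse n F}) :
    (piMap k n (peakBasis k n F) : MonoidAlgebra k (Equiv.Perm (Fin (n - 2))))
      = if 2 ∈ F.1 then 0 else (if 1 ∈ F.1 then (-1 : k) else 1) •
          peakP k (n - 2) ((F.1.erase 1).image fun i => i - 2) := by
  rw [piMap, if_neg (by omega), Module.Basis.constr_basis]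
  split_ifs <;> rfl

theorem piMap_peakSum_coe (hn : 2 ≤ n) (T : Finset ℕ) :
    (piMap k n (peakSum k n T) : MonoidAlgebra k (Equiv.Perm (Fin (n - 2))))
      = ∑ F : {F : Finset ℕ // IsSparse n F} with F.1 ⊆ T,
          if 2 ∈ F.1 then 0 else (if 1 ∈ F.1 then (-1 : k) else 1) •
            peakP k (n - 2) ((F.1.erase 1).image fun i => i - 2) := by
  rw [peakSum, map_sum, AddSubmonoidClass.coe_finsetSum]
  exact Finset.sum_congr rfl fun F _ => piMap_peakBasis k hn F

/-- Sets containing `2` contribute nothing; the others cancel in pairs by inserting or removing `1`,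
which changes the sign. -/
theorem piMap_peakSum_eq_zero (hn : 2 ≤ n) {T : Finset ℕ} (hT : 1 ∈ T) :
    piMap k n (peakSum k n T) = 0 := by
  apply Subtype.ext
  rw [piMap_peakSum_coe k hn]
  have hins : ∀ F : {F : Finset ℕ // IsSparse n F}, 2 ∉ F.1 → IsSparse n (insert 1 F.1) := by
    rintro ⟨F, hF⟩ h2
    refine ⟨Finset.insert_subset (Finset.mem_Icc.mpr (by omega)) hF.1, fun i hi hi' => ?_⟩
    rcases Finset.mem_insert.mp hi with rfl | hi
    · rcases Finset.mem_insert.mp hi' with h | h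
      · omega
      · exact h2 h
    · have := Finset.mem_Icc.mp (hF.1 hi)
      rcases Finset.mem_insert.mp hi' with h | h
      · omega
      · exact hF.2 i hi h
  have her : ∀ F : {F : Finset ℕ // IsSparse n F}, IsSparse n (F.1.erase 1) := fun F =>
    ⟨(Finset.erase_subset _ _).trans F.2.1, fun i hi hi' =>
      F.2.2 i (Finset.mem_of_mem_erase hi) (Finset.mem_of_mem_erase hi')⟩
  refine Finset.sum_involution (fun F _ => if h2 : 2 ∈ F.1 then F else
    if 1 ∈ F.1 then ⟨F.1.erase 1, her F⟩ else ⟨insert 1 F.1, hins F h2⟩) ?_ ?_ ?_ ?_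
  · intro F _
    by_cases h2 : 2 ∈ F.1
    · simp [h2]
    · by_cases h1 : 1 ∈ F.1
      · simp [h2, h1]
      · simp [h2, h1]
  · intro F _ hne
    by_cases h2 : 2 ∈ F.1
    · simp [h2] at hne
    · by_cases h1 : 1 ∈ F.1
      · simp only [h2, h1, dite_false, if_true]
        intro h
        have := congrArg Subtype.val h
        simp only at this
        rw [← this] at h1
        simp at h1
      · simp only [h2, h1, dite_false, if_false]
        intro h
        have := congrArg Subtype.val h
        simp only at this
        rw [← this] at h1
        simp at h1
  · intro F hF
    rw [Finset.mem_filter] at hF ⊢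
    refine ⟨Finset.mem_univ _, ?_⟩
    split_ifs
    · exact hF.2
    · exact (Finset.erase_subset _ _).trans hF.2
    · exact Finset.insert_subset hT hF.2
  · intro F _
    by_cases h2 : 2 ∈ F.1
    · simp [h2]
    · by_cases h1 : 1 ∈ F.1
      · simp [h2, h1]
      · simp [h2, h1]

/-- With first part at least `2` the peak `1` is not allowed and sets containing `2` vanish, so what
survives is a shift by two. -/
theorem piMap_peakSum_cuts (hn : 2 ≤ n) {b₀ : ℕ} {bs : List ℕ} :
    piMap k n (peakSum k n (peakSet (cuts (b₀ + 2) bs)))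
      = peakSum k (n - 2) (peakSet (cuts b₀ bs)) := by
  have hiff : ∀ x, x + 2 ∈ peakSet (cuts (b₀ + 2) bs) ↔ x ∈ peakSet (cuts b₀ bs) := by
    intro x
    have h1 : ∀ y, y ∈ cuts (b₀ + 2) bs → 2 ≤ y := fun y hy => by
      have := le_of_mem_cuts hy
      omega
    rw [mem_peakSet, mem_peakSet, add_mem_cuts_iff]
    refine or_congr Iff.rfl ⟨?_, ?_⟩
    · rintro ⟨q, hq, hqx⟩
      have := h1 q hq
      refine ⟨q - 2, ?_, by omega⟩
      rw [← add_mem_cuts_iff 2, Nat.sub_add_cancel this]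
      exact hq
    · rintro ⟨q, hq, rfl⟩
      exact ⟨q + 2, (add_mem_cuts_iff 2).mpr hq, by omega⟩
  have h1 : 1 ∉ peakSet (cuts (b₀ + 2) bs) := by
    rw [← zero_add 1, succ_mem_peakSet]
    rintro (h | h) <;> have := le_of_mem_cuts h <;> omega
  have hup : ∀ F : {F : Finset ℕ // IsSparse (n - 2) F}, IsSparse n (F.1.image (· + 2)) := by
    rintro ⟨F, hF⟩
    constructor
    · intro x hx
      obtain ⟨y, hy, rfl⟩ := Finset.mem_image.mp hx
      have := Finset.mem_Icc.mp (hF.1 hy)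
      exact Finset.mem_Icc.mpr (by omega)
    · intro x hx hx'
      obtain ⟨y, hy, rfl⟩ := Finset.mem_image.mp hx
      obtain ⟨z, hz, hzy⟩ := Finset.mem_image.mp hx'
      obtain rfl : z = y + 1 := by omega
      exact hF.2 y hy hz
  apply Subtype.ext
  rw [piMap_peakSum_coe k hn, peakSum, AddSubmonoidClass.coe_finsetSum]
  symm
  refine Finset.sum_of_injOn (fun F => ⟨F.1.image (· + 2), hup F⟩) ?_ ?_ ?_ ?_
  · intro F _ F' _ h
    have := congrArg Subtype.val h
    exact Subtype.ext (Finset.image_injective (add_left_injective 2) this)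
  · intro F hF
    rw [Finset.mem_coe, Finset.mem_filter] at hF ⊢
    refine ⟨Finset.mem_univ _, Finset.image_subset_iff.mpr fun x hx => ?_⟩
    exact (hiff x).mpr (hF.2 hx)
  · intro F hF hF'
    rw [Finset.mem_filter] at hF
    by_cases h2 : 2 ∈ F.1
    · rw [if_pos h2]
    · exfalso
      apply hF'
      have h1F : 1 ∉ F.1 := fun h => h1 (hF.2 h)
      have hge : ∀ x ∈ F.1, 3 ≤ x := by
        intro x hx
        have := Finset.mem_Icc.mp (F.2.1 hx)
        have h3 : x ≠ 1 := fun h => h1F (h ▸ hx)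
        have h4 : x ≠ 2 := fun h => h2 (h ▸ hx)
        omega
      have hs := isSparse_shift F.2 h2
      rw [Finset.erase_eq_of_notMem h1F] at hs
      refine ⟨⟨_, hs⟩, ?_, Subtype.ext ?_⟩
      · rw [Finset.mem_coe, Finset.mem_filter]
        refine ⟨Finset.mem_univ _, Finset.image_subset_iff.mpr fun x hx => ?_⟩
        rw [← hiff, Nat.sub_add_cancel (by have := hge x hx; omega)]
        exact hF.2 hx
      · simp only
        rw [Finset.image_image]
        refine (Finset.image_congr fun x hx => ?_).trans Finset.image_id
        have := hge x hx
        simp only [Function.comp_apply, id_eq]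
        omega
  · rintro ⟨F, hF⟩ hFT
    have h3 : ∀ x ∈ F, 1 ≤ x := fun x hx => (Finset.mem_Icc.mp (hF.1 hx)).1
    have h2 : 2 ∉ F.image (· + 2) := fun h => by
      obtain ⟨y, hy, hy'⟩ := Finset.mem_image.mp h
      have := h3 y hy
      omega
    have h1' : 1 ∉ F.image (· + 2) := fun h => by
      obtain ⟨y, hy, hy'⟩ := Finset.mem_image.mp h
      omega
    rw [if_neg h2, if_neg h1', one_smul, peakBasis_coe, Finset.erase_eq_of_notMem h1',
      Finset.image_image]
    congr 1
    exact ((Finset.image_congr fun x _ => by simp).trans Finset.image_id).symm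

variable (n) in
/-- The map from the descent algebra to the peak algebra which forgets the signs. -/
def forgetSpan : descentSpan k n →ₗ[k] peakSpan k n :=
  (forget k n).toLinearMap.restrict fun x hx => by
    have h : descentSpan k n ≤ (peakSpan k n).comap (forget k n).toLinearMap := by
      rw [descentSpan, Submodule.span_le]
      rintro _ ⟨⟨J, hJ⟩, rfl⟩
      change forget k n (descentX k n J) ∈ peakSpan k n
      rw [forget_descentX k hJ]
      exact (peakSpan k n).smul_mem _ (Subtype.prop _)
    exact h hx

theorem forgetSpan_coe (x : descentSpan k n) :
    (forgetSpan k n x : MonoidAlgebra k (Equiv.Perm (Fin n))) = forget k n x := rfl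

theorem forgetSpan_cuts {b₀ : ℕ} {bs : List ℕ} (hbs : ∀ b ∈ bs, 0 < b) (hsum : b₀ + bs.sum = n)
    (hm : descentX k n (cuts b₀ bs) ∈ descentSpan k n) :
    forgetSpan k n ⟨descentX k n (cuts b₀ bs), hm⟩
      = (2 ^ bs.length : k) • peakSum k n (peakSet (cuts b₀ bs)) := by
  apply Subtype.ext
  rw [forgetSpan_coe, Submodule.coe_smul, forget_descentX k (hsum ▸ cuts_subset hbs),
    card_cuts hbs]

theorem forgetSpan_surjective (h2 : (2 : k) ≠ 0) : Function.Surjective (forgetSpan k n) := by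
  rintro ⟨x, hx⟩
  rw [← map_forget_descentSpan h2] at hx
  obtain ⟨y, hy, rfl⟩ := hx
  exact ⟨⟨y, hy⟩, rfl⟩

/-- A linear map on the descent algebra is determined by the images of the `X_b`. -/
theorem descentSpan_hom_ext {V : Type*} [AddCommMonoid V] [Module k V]
    {f g : descentSpan k n →ₗ[k] V}
    (h : ∀ b₀ bs (hbs : ∀ b ∈ bs, 0 < b) (hsum : b₀ + bs.sum = n),
      f ⟨_, descentX_cuts_mem k hbs hsum⟩ = g ⟨_, descentX_cuts_mem k hbs hsum⟩) : f = g := by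
  refine (descentBasis k n).ext fun J => ?_
  obtain ⟨J, hJ⟩ := J
  obtain ⟨b₀, bs, hbs, hsum, rfl⟩ := exists_eq_cuts hJ
  rw [← descentX_eq_basis]
  exact h b₀ bs hbs hsum

/-- Both sides vanish when `b₀ < 2`, and otherwise both lower `b₀` by two. The number of later
parts, hence the power of `2`, is unchanged. -/
theorem piMap_comp_forgetSpan :
    (piMap k n).comp (forgetSpan k n)
      = (forgetSpan k (n - 2)).comp ((beta k (n - 1)).comp (beta k n)) := by
  refine descentSpan_hom_ext k fun b₀ bs hbs hsum => ?_
  rw [LinearMap.comp_apply, LinearMap.comp_apply, LinearMap.comp_apply,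
    forgetSpan_cuts k hbs hsum, map_smul]
  have hbeta : ∀ b₀, ∀ hsum : b₀ + 1 + bs.sum = n, beta k n ⟨_, descentX_cuts_mem k hbs hsum⟩
      = ⟨_, descentX_cuts_mem (n := n - 1) k hbs (by omega : b₀ + bs.sum = n - 1)⟩ :=
    fun b₀ hsum => Subtype.ext (beta_descentX_succ k hbs hsum _)
  have hzero : b₀ < 2 → piMap k n (peakSum k n (peakSet (cuts b₀ bs))) = 0 := by
    intro h
    by_cases hn : 2 ≤ n
    · apply piMap_peakSum_eq_zero k hn
      rcases bs with _ | ⟨b, bs⟩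
      · simp at hsum
        omega
      · have h1 : b₀ ∈ cuts b₀ (b :: bs) := Finset.mem_insert_self _ _
        rw [← zero_add 1, succ_mem_peakSet]
        interval_cases b₀
        · exact Or.inr h1
        · exact Or.inl h1
    · rw [piMap, if_pos (by omega), LinearMap.zero_apply]
  rcases b₀ with _ | _ | b₀
  · rw [hzero (by omega), beta_descentX_zero k hbs hsum, smul_zero, map_zero, map_zero]
  · rw [hzero (by omega), hbeta 0 hsum, beta_descentX_zero k hbs (by omega), smul_zero, map_zero]
  · have h1 : beta k (n - 1) (beta k n ⟨_, descentX_cuts_mem k hbs hsum⟩)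
        = ⟨_, descentX_cuts_mem (n := n - 2) k hbs (by omega : b₀ + bs.sum = n - 2)⟩ := by
      rw [hbeta (b₀ + 1) hsum]
      exact Subtype.ext (beta_descentX_succ (n := n - 1) k hbs (by omega) _)
    rw [h1, piMap_peakSum_cuts k (by omega)]
    exact (forgetSpan_cuts (n := n - 2) k hbs (by omega) _).symm

theorem piIter_forgetSpan (m : ℕ) (x : descentSpan k n) :
    piIter k n m (forgetSpan k n x) = forgetSpan k (n - 2 * m) (betaIter k n (2 * m) x) := by
  induction m with
  | zero => rfl
  | succ m ih =>
    change piMap k (n - 2 * m) (piIter k n m (forgetSpan k n x)) = _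
    rw [ih]
    exact LinearMap.congr_fun (piMap_comp_forgetSpan k) _

end

/-! ### Triangular families of functionals -/

section Triangular

variable {k : Type*} [Field k] {T : Type*} [Fintype T]

/-- Row `t` is a nonzero multiple of the unit vector at `t` plus unit vectors of strictly larger
`r`, so descending induction on `r` applies. -/
theorem span_eq_top_of_triangular (r : T → ℕ) (v : T → T → k) (hd : ∀ t, v t t ≠ 0)
    (ht : ∀ t s, v t s ≠ 0 → r t ≤ r s ∧ (r t = r s → s = t)) :
    Submodule.span k (Set.range v) = ⊤ := by
  classical
  have key : ∀ N t, (Finset.univ.sup r) - r t = N →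
      Pi.single t (1 : k) ∈ Submodule.span k (Set.range v) := by
    intro N
    induction N using Nat.strong_induction_on with
    | _ N ih =>
      rintro t rfl
      have h1 : v t t • Pi.single t (1 : k)
          = v t - ∑ s ∈ Finset.univ.erase t, v t s • Pi.single s (1 : k) := by
        rw [eq_sub_iff_add_eq, Finset.add_sum_erase _ (fun s => v t s • Pi.single s (1 : k))
          (Finset.mem_univ t)]
        exact (pi_eq_sum_univ' (v t)).symm
      rw [← Submodule.smul_mem_iff _ (hd t), h1]
      refine sub_mem (Submodule.subset_span ⟨t, rfl⟩) (Submodule.sum_mem _ fun s hs => ?_)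
      by_cases h0 : v t s = 0
      · rw [h0, zero_smul]
        exact Submodule.zero_mem _
      · obtain ⟨h2, h3⟩ := ht t s h0
        have h4 : r t ≠ r s := fun h => Finset.ne_of_mem_erase hs (h3 h)
        have h5 : r s ≤ Finset.univ.sup r := Finset.le_sup (Finset.mem_univ s)
        exact Submodule.smul_mem _ _ (ih _ (by omega) s rfl)
  rw [eq_top_iff]
  rintro x -
  rw [pi_eq_sum_univ' x]
  exact Submodule.sum_mem _ fun t _ => Submodule.smul_mem _ _ (key _ t rfl)

/-- The functionals cut out the radical inside `I`, and triangularity makes their joint map onto `T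
→ k` surjective. -/
theorem finrank_quotient_eq_card {V : Type*} [AddCommGroup V] [Module k V] (R I : Submodule k V)
    (χ : T → I →ₗ[k] k) (hker : ∀ x : I, (x : V) ∈ R ↔ ∀ t, χ t x = 0) (x : T → I) (r : T → ℕ)
    (hd : ∀ t, χ t (x t) ≠ 0)
    (ht : ∀ t s, χ s (x t) ≠ 0 → r t ≤ r s ∧ (r t = r s → s = t)) :
    Module.finrank k (I ⧸ (R ⊓ I).submoduleOf I) = Fintype.card T := by
  have hrange : LinearMap.range (LinearMap.pi χ) = ⊤ := by
    rw [eq_top_iff, ← span_eq_top_of_triangular r (fun t s => χ s (x t)) hd ht, Submodule.span_le]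
    rintro _ ⟨t, rfl⟩
    exact ⟨x t, rfl⟩
  have hk : (R ⊓ I).submoduleOf I = LinearMap.ker (LinearMap.pi χ) := by
    ext y
    rw [Submodule.submoduleOf, Submodule.mem_comap, Submodule.mem_inf, LinearMap.mem_ker]
    change ((y : V) ∈ R ∧ (y : V) ∈ I) ↔ _
    rw [and_iff_left y.2, hker]
    exact ⟨fun h => funext h, fun h t => congrFun h t⟩
  rw [hk, ((LinearMap.pi χ).quotKerEquivOfSurjective (LinearMap.range_eq_top.mp hrange)).finrank_eq,
    Module.finrank_fintype_fun_eq_card]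

end Triangular

theorem natCast_ne_zero_of_le {k : Type*} [Field k] {n : ℕ} (hn : (n.factorial : k) ≠ 0) {m : ℕ}
    (hm : 0 < m) (hmn : m ≤ n) : (m : k) ≠ 0 := by
  intro h
  obtain ⟨c, hc⟩ := Nat.dvd_factorial hm hmn
  rw [hc, Nat.cast_mul, h, zero_mul] at hn
  exact hn rfl

theorem length_le_sum {bs : List ℕ} (hbs : ∀ b ∈ bs, 0 < b) : bs.length ≤ bs.sum := by
  induction bs with
  | nil => simp
  | cons b bs ih =>
    have h1 := ih fun b hb => hbs b (by simp [hb])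
    have h2 := hbs b (by simp)
    rw [List.length_cons, List.sum_cons]
    omega

/-! ### The radical of the descent algebra -/

section TypeB

variable (k : Type*) [Field k] (n : ℕ)

/-- The character of the descent algebra which belongs to a pseudocomposition. -/
def solChar (z : ℕ) (us : List ℕ) : descentSpan k n →ₗ[k] k :=
  ((SignedIdx.isChamberSystem n).char k (SignedIdx.face n z us)).toLinearMap.comp
    (Submodule.inclusion (SignedIdx.descentAlg_eq_descentSpan (n := n) k).ge)

variable {k n}

theorem solChar_cuts {z b₀ : ℕ} {us bs : List ℕ} (hus : ∀ u ∈ us, 0 < u) (hz : z + us.sum = n)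
    (hbs : ∀ b ∈ bs, 0 < b) (hsum : b₀ + bs.sum = n)
    (hm : descentX k n (cuts b₀ bs) ∈ descentSpan k n) :
    solChar k n z us ⟨descentX k n (cuts b₀ bs), hm⟩ = signedDist z us b₀ bs :=
  SignedIdx.char_face_descentX k hus hz hbs hsum _

/-- The values depend on the blocks only as a multiset, which is why partitions and not compositions
index the distinct characters. -/
theorem solChar_congr {z : ℕ} {us us' : List ℕ} (hus : ∀ u ∈ us, 0 < u) (hz : z + us.sum = n)
    (h : (us : Multiset ℕ) = us') : solChar k n z us = solChar k n z us' := by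
  have hp := Multiset.coe_eq_coe.mp h
  refine descentSpan_hom_ext k fun b₀ bs hbs hsum => ?_
  rw [solChar_cuts hus hz hbs hsum,
    solChar_cuts (fun u hu => hus u (hp.mem_iff.mpr hu)) (hp.sum_eq ▸ hz) hbs hsum, h]

/-- Checked on the `X_b`: a first part `0` cannot contain a nonempty zero block, and otherwise one
unit is removed from both. -/
theorem solChar_succ {z : ℕ} {us : List ℕ} (hus : ∀ u ∈ us, 0 < u) (hz : z + 1 + us.sum = n) :
    solChar k n (z + 1) us = (solChar k (n - 1) z us).comp (beta k n) := by
  refine descentSpan_hom_ext k fun b₀ bs hbs hsum => ?_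
  rw [LinearMap.comp_apply, solChar_cuts hus hz hbs hsum]
  rcases b₀ with _ | b₀
  · rw [beta_descentX_zero k hbs hsum, map_zero, signedDist_of_lt (by omega)]
  · have h1 : beta k n ⟨_, descentX_cuts_mem k hbs hsum⟩
        = ⟨_, descentX_cuts_mem (n := n - 1) k hbs (by omega : b₀ + bs.sum = n - 1)⟩ :=
      Subtype.ext (beta_descentX_succ k hbs hsum _)
    rw [h1, solChar_cuts hus (by omega) hbs (by omega), signedDist_succ]

theorem solChar_betaIter {us : List ℕ} (hus : ∀ u ∈ us, 0 < u) (m : ℕ) {z : ℕ}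
    (hz : z + m + us.sum = n) (x : descentSpan k n) :
    solChar k n (z + m) us x = solChar k (n - m) z us (betaIter k n m x) := by
  induction m generalizing z with
  | zero => rfl
  | succ m ih =>
    rw [show z + (m + 1) = z + 1 + m by omega, ih (by omega), solChar_succ hus (by omega)]
    rfl

theorem betaIter_descentX {bs : List ℕ} (hbs : ∀ b ∈ bs, 0 < b) (m : ℕ) {b₀ : ℕ}
    (hsum : b₀ + m + bs.sum = n) :
    betaIter k n m ⟨_, descentX_cuts_mem k hbs hsum⟩
      = ⟨_, descentX_cuts_mem (n := n - m) k hbs (by omega : b₀ + bs.sum = n - m)⟩ := by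
  induction m generalizing b₀ with
  | zero => rfl
  | succ m ih =>
    have h1 : betaIter k n (m + 1) ⟨_, descentX_cuts_mem k hbs hsum⟩
        = beta k (n - m) (betaIter k n m ⟨descentX k n (cuts (b₀ + 1 + m) bs),
          descentX_cuts_mem k hbs (by omega)⟩) := by
      rw [betaIter, LinearMap.comp_apply]
      congr 5
      omega
    rw [h1, ih (by omega)]
    exact Subtype.ext (beta_descentX_succ (n := n - m) k hbs (by omega) _)

theorem betaIter_descentX_eq_zero {bs : List ℕ} (hbs : ∀ b ∈ bs, 0 < b) {m b₀ : ℕ}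
    (hsum : b₀ + bs.sum = n) (hm : b₀ < m) :
    betaIter k n m ⟨_, descentX_cuts_mem k hbs hsum⟩ = 0 := by
  induction m with
  | zero => omega
  | succ m ih =>
    rw [betaIter, LinearMap.comp_apply]
    rcases Nat.lt_or_ge b₀ m with h | h
    · rw [ih h, map_zero]
    -- After `m` steps the first part is exactly `0`, and one more application of `β` kills the
    -- element.
    · obtain rfl : b₀ = 0 + m := by omega
      rw [betaIter_descentX hbs m hsum]
      exact beta_descentX_zero (n := n - m) k hbs (by omega) _

theorem solB_toSubmodule : Subalgebra.toSubmodule (solB k n) = descentSpan k n := by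
  rw [SignedIdx.solB_eq, SignedIdx.descentAlg_eq_descentSpan]

theorem mem_rad_solB_iff (x : descentSpan k n) :
    (x : MonoidAlgebra k (SignedPerm n)) ∈ rad (solB k n) ↔
      ∀ z us, (∀ u ∈ us, 0 < u) → z + us.sum = n → solChar k n z us x = 0 := by
  rw [SignedIdx.solB_eq]
  have h := mem_rad_iff ((SignedIdx.isChamberSystem n).descentAlg k)
    (fun p : {p : ℕ × List ℕ // (∀ u ∈ p.2, 0 < u) ∧ p.1 + p.2.sum = n} =>
      (SignedIdx.isChamberSystem n).char k (SignedIdx.face n p.1.1 p.1.2))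
    (fun y hy => (SignedIdx.isChamberSystem n).isNilpotent_of_char_eq_zero y fun e he => by
      obtain ⟨z, us, hus, hz, rfl⟩ := SignedIdx.exists_eq_face he
      exact hy ⟨(z, us), hus, hz⟩)
    (Submodule.inclusion (SignedIdx.descentAlg_eq_descentSpan (n := n) k).ge x)
  refine h.trans ?_
  exact ⟨fun h z us hus hz => h ⟨(z, us), hus, hz⟩, fun h p => h _ _ p.2.1 p.2.2⟩

theorem idealJ_le (i : ℕ) : idealJ k n i ≤ descentSpan k n := Submodule.map_subtype_le _ _

theorem mem_idealJ_iff (i : ℕ) (x : descentSpan k n) :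
    (x : MonoidAlgebra k (SignedPerm n)) ∈ idealJ k n i ↔ betaIter k n (i + 1) x = 0 := by
  rw [idealJ, Submodule.mem_map]
  constructor
  · rintro ⟨y, hy, hyx⟩
    rwa [← Subtype.ext (a1 := y) (a2 := x) hyx]
  · exact fun h => ⟨x, h, rfl⟩

theorem sum_toList {m : ℕ} (μ : Nat.Partition m) : μ.parts.toList.sum = m := by
  rw [Multiset.sum_toList, μ.parts_sum]

theorem pos_of_mem_toList {m : ℕ} (μ : Nat.Partition m) : ∀ u ∈ μ.parts.toList, 0 < u :=
  fun _ hu => μ.parts_pos (Multiset.mem_toList.mp hu)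

/-- The partition with the given positive parts. -/
def partitionOfList {m : ℕ} (us : List ℕ) (hus : ∀ u ∈ us, 0 < u) (hsum : us.sum = m) :
    Nat.Partition m :=
  ⟨us, fun {u} hu => hus u (by simpa using hu), by simpa using hsum⟩

/-- The test elements are the `X_(l, μ)` with `l ≤ i`, which lie in the kernel since their first
part is used up after `i + 1` steps; the order is by the number of parts of `μ`. -/
theorem finrank_idealJ_quotient (h2 : (2 : k) ≠ 0) (hn : (n.factorial : k) ≠ 0) {i : ℕ}
    (hi : i ≤ n) :
    Module.finrank k (idealJ k n i ⧸ (rad (solB k n) ⊓ idealJ k n i).submoduleOf (idealJ k n i))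
      = ∑ l ∈ Finset.range (i + 1), Fintype.card (Nat.Partition (n - l)) := by
  set T := Σ l : Fin (i + 1), Nat.Partition (n - l) with hT
  have hsum : ∀ t : T, (t.1 : ℕ) + t.2.parts.toList.sum = n := fun t => by
    rw [sum_toList]
    omega
  have hcard : Fintype.card T = ∑ l ∈ Finset.range (i + 1), Fintype.card (Nat.Partition (n - l)) := by
    rw [Fintype.card_sigma, Finset.sum_range]
  rw [← hcard]
  have hx : ∀ t : T, descentX k n (cuts t.1 t.2.parts.toList) ∈ idealJ k n i := fun t => by
    refine (mem_idealJ_iff i ⟨_, descentX_cuts_mem k (pos_of_mem_toList t.2) (hsum t)⟩).mpr ?_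
    exact betaIter_descentX_eq_zero (pos_of_mem_toList t.2) (hsum t) t.1.2
  have hval : ∀ t s : T, solChar k n s.1 s.2.parts.toList
      (Submodule.inclusion (idealJ_le i) ⟨_, hx t⟩)
        = signedDist s.1 s.2.parts t.1 t.2.parts.toList := fun t s => by
    refine (solChar_cuts (pos_of_mem_toList s.2) (hsum s) (pos_of_mem_toList t.2) (hsum t) _).trans ?_
    rw [Multiset.coe_toList]
  refine finrank_quotient_eq_card _ _
    (fun t : T => (solChar k n t.1 t.2.parts.toList).comp (Submodule.inclusion (idealJ_le i)))
    (fun x => ?_) (fun t => ⟨_, hx t⟩) (fun t => t.2.parts.card) (fun t => ?_) (fun t s hst => ?_)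
  · refine (mem_rad_solB_iff (Submodule.inclusion (idealJ_le i) x)).trans ⟨fun h t => ?_, ?_⟩
    · exact h _ _ (pos_of_mem_toList t.2) (hsum t)
    · intro h z us hus hz
      rcases Nat.lt_or_ge i z with hzi | hzi
      -- A character with `z > i` factors through `β^(i+1)`, hence vanishes on the ideal.
      · obtain ⟨z, rfl⟩ : ∃ a, z = a + (i + 1) := ⟨z - (i + 1), by omega⟩
        rw [solChar_betaIter hus _ hz, (mem_idealJ_iff i _).mp x.2, map_zero]
      · have h1 := h ⟨⟨z, by omega⟩, partitionOfList us hus (by simp only; omega)⟩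
        rw [LinearMap.comp_apply] at h1
        rw [← h1]
        refine LinearMap.congr_fun (solChar_congr hus hz ?_) _
        rw [Multiset.coe_toList]
        rfl
  · rw [LinearMap.comp_apply, hval]
    conv => arg 1; arg 2; rw [← Multiset.coe_toList t.2.parts]
    refine signedDist_self_ne_zero h2 _ (pos_of_mem_toList t.2) fun m hm hml => ?_
    refine natCast_ne_zero_of_le hn hm (hml.trans ?_)
    have := length_le_sum (pos_of_mem_toList t.2)
    have := hsum t
    omega
  · rw [LinearMap.comp_apply, hval] at hst
    obtain ⟨h3, h4, h5⟩ := signedDist_ne_zero (pos_of_mem_toList t.2) hst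
    rw [Multiset.length_toList] at h4 h5
    refine ⟨h4, fun he => ?_⟩
    obtain ⟨h6, h7⟩ := h5 he.symm
    rw [Multiset.coe_toList] at h7
    obtain ⟨⟨l, hl⟩, μ⟩ := t
    obtain ⟨⟨l', hl'⟩, μ'⟩ := s
    simp only at h6 h7
    subst h6
    congr 1
    exact Nat.Partition.ext h7

end TypeB

/-! ### The radical of the peak algebra -/

section TypeA

variable {k : Type*} [Field k] {n : ℕ}

/-- Expanding the valleys puts the image into the descent algebra of `S_n`, and the parity of the
blocks turns the resulting count into one of type B. -/
theorem char_forget_descentX {b₀ : ℕ} {bs : List ℕ} (hbs : ∀ b ∈ bs, 0 < b)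
    (hsum : b₀ + bs.sum = n) :
    ∃ h : forget k n (descentX k n (cuts b₀ bs)) ∈ (PermFace.isChamberSystem n).descentAlg k,
      ∀ us : PermFace.FaceType n,
        (PermFace.isChamberSystem n).char k (PermFace.face n us.1) ⟨_, h⟩
          = signedDist ((us.1 : Multiset ℕ).filter fun x => Even x).sum
            ((us.1 : Multiset ℕ).filter fun x => ¬ Even x) b₀ bs := by
  have h1 := PermFace.shapePair_mem (n := n) k b₀ [] (bs.map fun b => (.valley, b))
    (by simpa [Function.comp_def] using hsum)
  have e : PermFace.shapeSum n k ([b₀].map (fun b => (.inc, b)) ++ bs.map fun b => (.valley, b))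
      = forget k n (descentX k n (cuts b₀ bs)) := (forget_descentX_cuts k hbs hsum).symm
  rw [PermFace.shapePair, e, PermFace.mem_charGraph_iff] at h1
  obtain ⟨h, h1⟩ := h1
  refine ⟨h, fun us => (h1 us).trans ?_⟩
  rw [← distSum_peak_eq_signedDist, List.map_append, List.map_map, List.map_map]
  rfl

theorem peakSpan_le_descentAlg (h2 : (2 : k) ≠ 0) :
    peakSpan k n ≤ Subalgebra.toSubmodule ((PermFace.isChamberSystem n).descentAlg k) := by
  rw [← map_forget_descentSpan h2, descentSpan, Submodule.map_span, Submodule.span_le]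
  rintro _ ⟨_, ⟨⟨J, hJ⟩, rfl⟩, rfl⟩
  obtain ⟨b₀, bs, hbs, hsum, rfl⟩ := exists_eq_cuts hJ
  exact (char_forget_descentX hbs hsum).1

/-- The span of the `P_F` is closed under multiplication because it is the image of an algebra under
a homomorphism. -/
theorem peakAlg_eq_map (h2 : (2 : k) ≠ 0) :
    peakAlg k n = ((SignedIdx.isChamberSystem n).descentAlg k).map (forget k n) := by
  have h : peakSpan k n = Subalgebra.toSubmodule
      (((SignedIdx.isChamberSystem n).descentAlg k).map (forget k n)) := by
    rw [← map_forget_descentSpan h2, ← SignedIdx.descentAlg_eq_descentSpan, Subalgebra.map_toSubmodule]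
  rw [peakAlg, h]
  exact Algebra.adjoin_eq _

theorem peakAlg_toSubmodule (h2 : (2 : k) ≠ 0) :
    Subalgebra.toSubmodule (peakAlg k n) = peakSpan k n := by
  rw [peakAlg_eq_map h2, Subalgebra.map_toSubmodule, SignedIdx.descentAlg_eq_descentSpan,
    map_forget_descentSpan h2]

theorem peakAlg_le_descentAlg (h2 : (2 : k) ≠ 0) :
    peakAlg k n ≤ (PermFace.isChamberSystem n).descentAlg k :=
  Algebra.adjoin_le (peakSpan_le_descentAlg h2)

/-- The character of the peak algebra which belongs to a composition. -/
def peakChar (h2 : (2 : k) ≠ 0) (n : ℕ) (us : List ℕ) : peakSpan k n →ₗ[k] k :=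
  ((PermFace.isChamberSystem n).char k (PermFace.face n us)).toLinearMap.comp
    (Submodule.inclusion (peakSpan_le_descentAlg h2))

theorem peakChar_forgetSpan (h2 : (2 : k) ≠ 0) {us os : List ℕ} {z : ℕ} (hus : ∀ u ∈ us, 0 < u)
    (husum : us.sum = n) (hz : ((us : Multiset ℕ).filter fun x => Even x).sum = z)
    (hos : ((us : Multiset ℕ).filter fun x => ¬ Even x) = os) :
    (peakChar h2 n us).comp (forgetSpan k n) = solChar k n z os := by
  have hsum : z + os.sum = n := by
    rw [← hz, ← Multiset.sum_coe os, ← hos, ← Multiset.sum_add, Multiset.filter_add_not,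
      Multiset.sum_coe, husum]
  have hos' : ∀ u ∈ os, 0 < u := fun u hu => by
    rw [← Multiset.mem_coe, ← hos] at hu
    exact hus u (by simpa using Multiset.mem_of_mem_filter hu)
  refine descentSpan_hom_ext k fun b₀ bs hbs hsumb => ?_
  rw [LinearMap.comp_apply, solChar_cuts hos' hsum hbs hsumb, ← hz, ← hos]
  exact (char_forget_descentX hbs hsumb).2 ⟨us, hus, husum⟩

/-- Nilpotence may be tested in the larger descent algebra of `S_n`, so restrictions of its
characters suffice. -/
theorem mem_rad_peakAlg_iff (h2 : (2 : k) ≠ 0) (x : peakSpan k n) :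
    (x : MonoidAlgebra k (Equiv.Perm (Fin n))) ∈ rad (peakAlg k n) ↔
      ∀ us, (∀ u ∈ us, 0 < u) → us.sum = n → peakChar h2 n us x = 0 := by
  have hle := peakAlg_le_descentAlg (n := n) h2
  have h := mem_rad_iff (peakAlg k n)
    (fun us : PermFace.FaceType n =>
      ((PermFace.isChamberSystem n).char k (PermFace.face n us.1)).comp (Subalgebra.inclusion hle))
    (fun y hy => by
      have h1 := (PermFace.isChamberSystem n).isNilpotent_of_char_eq_zero
        (Subalgebra.inclusion hle y) fun e he => by
          obtain ⟨us, hus, hsum, rfl⟩ := PermFace.exists_eq_face he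
          exact hy ⟨us, hus, hsum⟩
      exact (IsNilpotent.map_iff (Subalgebra.inclusion_injective hle)).mp h1)
    (Submodule.inclusion (peakAlg_toSubmodule (n := n) h2).ge x)
  refine h.trans ?_
  exact ⟨fun h us hus hsum => h ⟨us, hus, hsum⟩, fun h us => h us.1 us.2.1 us.2.2⟩

theorem peakIdeal_le (j : ℕ) : peakIdeal k n j ≤ peakSpan k n := Submodule.map_subtype_le _ _

theorem mem_peakIdeal_iff (j : ℕ) (x : peakSpan k n) :
    (x : MonoidAlgebra k (Equiv.Perm (Fin n))) ∈ peakIdeal k n j ↔ piIter k n (j + 1) x = 0 := by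
  rw [peakIdeal, Submodule.mem_map]
  constructor
  · rintro ⟨y, hy, hyx⟩
    rwa [← Subtype.ext (a1 := y) (a2 := x) hyx]
  · exact fun h => ⟨x, h, rfl⟩

/-- The composition with the odd parts `os` and at most one even part `2 * l`. -/
def evenCons (l : ℕ) (os : List ℕ) : List ℕ := if l = 0 then os else (2 * l) :: os

theorem sum_evenCons (l : ℕ) (os : List ℕ) : (evenCons l os).sum = 2 * l + os.sum := by
  rw [evenCons]
  split_ifs with h
  · simp [h]
  · rw [List.sum_cons]

theorem pos_of_mem_evenCons {l : ℕ} {os : List ℕ} (hos : ∀ u ∈ os, 0 < u) :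
    ∀ u ∈ evenCons l os, 0 < u := by
  intro u hu
  rw [evenCons] at hu
  split_ifs at hu with h
  · exact hos u hu
  · rcases List.mem_cons.mp hu with rfl | hu
    · omega
    · exact hos u hu

theorem peakChar_evenCons (h2 : (2 : k) ≠ 0) {l : ℕ} {os : List ℕ} (hos : ∀ u ∈ os, 0 < u)
    (hodd : ∀ u ∈ os, ¬ Even u) (hsum : 2 * l + os.sum = n) :
    (peakChar h2 n (evenCons l os)).comp (forgetSpan k n) = solChar k n (2 * l) os := by
  have h1 : (os : Multiset ℕ).filter (fun x => Even x) = 0 :=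
    Multiset.filter_eq_nil.mpr fun u hu => hodd u hu
  have h3 : (os : Multiset ℕ).filter (fun x => ¬ Even x) = os :=
    Multiset.filter_eq_self.mpr fun u hu => hodd u hu
  refine peakChar_forgetSpan h2 (pos_of_mem_evenCons hos) (by rw [sum_evenCons, hsum]) ?_ ?_
  · rw [evenCons]
    split_ifs with h
    · rw [h1, h]
      rfl
    · rw [← Multiset.cons_coe, Multiset.filter_cons_of_pos _ (even_two_mul l), h1]
      simp
  · rw [evenCons]
    split_ifs with h
    · exact h3
    · rw [← Multiset.cons_coe, Multiset.filter_cons_of_neg (p := fun x => ¬ Even x) _ (not_not.mpr (even_two_mul l)), h3]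

/-- The argument of `finrank_idealJ_quotient` is transported along `forgetSpan`. The character of
`(2 * l, μ)` with `μ` odd is realized by the parts of `μ` and one extra even block `2 * l`. -/
theorem finrank_peakIdeal_quotient (h2 : (2 : k) ≠ 0) (hn : (n.factorial : k) ≠ 0) {j : ℕ}
    (hj : j ≤ n / 2) :
    Module.finrank k
        (peakIdeal k n j ⧸ (rad (peakAlg k n) ⊓ peakIdeal k n j).submoduleOf (peakIdeal k n j))
      = ∑ l ∈ Finset.range (j + 1), (Nat.Partition.odds (n - 2 * l)).card := by
  set T := Σ l : Fin (j + 1), {μ // μ ∈ Nat.Partition.odds (n - 2 * l)} with hT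
  have hsum : ∀ t : T, 2 * (t.1 : ℕ) + t.2.1.parts.toList.sum = n := fun t => by
    rw [sum_toList]
    omega
  have hodd : ∀ t : T, ∀ u ∈ t.2.1.parts.toList, ¬ Even u := fun t u hu =>
    (Finset.mem_filter.mp t.2.2).2 u (Multiset.mem_toList.mp hu)
  have hpos : ∀ t : T, ∀ u ∈ t.2.1.parts.toList, 0 < u := fun t => pos_of_mem_toList t.2.1
  have hcard : Fintype.card T
      = ∑ l ∈ Finset.range (j + 1), (Nat.Partition.odds (n - 2 * l)).card := by
    rw [Fintype.card_sigma, Finset.sum_range]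
    simp only [Fintype.card_coe]
  rw [← hcard]
  set y : T → descentSpan k n := fun t => ⟨_, descentX_cuts_mem k (hpos t) (hsum t)⟩ with hy
  have hx : ∀ t : T, (forgetSpan k n (y t) : MonoidAlgebra k (Equiv.Perm (Fin n)))
      ∈ peakIdeal k n j := fun t => by
    rw [mem_peakIdeal_iff, piIter_forgetSpan]
    have h1 := betaIter_descentX_eq_zero (k := k) (m := 2 * (j + 1)) (hpos t) (hsum t) (by omega)
    exact (congrArg _ h1).trans (map_zero _)
  have hval : ∀ t s : T, peakChar h2 n (evenCons s.1 s.2.1.parts.toList)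
      (Submodule.inclusion (peakIdeal_le j) ⟨_, hx t⟩)
        = signedDist (2 * s.1) s.2.1.parts (2 * t.1) t.2.1.parts.toList := fun t s => by
    refine (LinearMap.congr_fun (peakChar_evenCons h2 (hpos s) (hodd s) (hsum s)) (y t)).trans ?_
    rw [solChar_cuts (hpos s) (hsum s) (hpos t) (hsum t), Multiset.coe_toList]
  refine finrank_quotient_eq_card _ _
    (fun t : T => (peakChar h2 n (evenCons t.1 t.2.1.parts.toList)).comp
      (Submodule.inclusion (peakIdeal_le j)))
    (fun x => ?_) (fun t => ⟨_, hx t⟩) (fun t => t.2.1.parts.card) (fun t => ?_) (fun t s hst => ?_)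
  · refine (mem_rad_peakAlg_iff h2 (Submodule.inclusion (peakIdeal_le j) x)).trans
      ⟨fun h t => ?_, fun h us hus husum => ?_⟩
    · exact h _ (pos_of_mem_evenCons (hpos t)) (by rw [sum_evenCons, hsum])
    · obtain ⟨w, hw⟩ := forgetSpan_surjective (n := n) k h2 (Submodule.inclusion (peakIdeal_le j) x)
      set os := ((us : Multiset ℕ).filter fun x => ¬ Even x).toList with hos
      have hos' : ((us : Multiset ℕ).filter fun x => ¬ Even x) = os := by
        rw [hos, Multiset.coe_toList]
      have hmem : ∀ u ∈ os, u ∈ us ∧ ¬ Even u := fun u hu => by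
        rw [← Multiset.mem_coe, ← hos', Multiset.mem_filter] at hu
        simpa using hu
      have hospos : ∀ u ∈ os, 0 < u := fun u hu => hus u (hmem u hu).1
      obtain ⟨z, hz⟩ : ∃ z, ((us : Multiset ℕ).filter fun x => Even x).sum = 2 * z := by
        refine even_iff_two_dvd.mp ?_
        exact Multiset.sum_induction _ _ (fun _ _ => Even.add) Even.zero
          fun u hu => (Multiset.mem_filter.mp hu).2
      have hzos : 2 * z + os.sum = n := by
        rw [← hz, ← Multiset.sum_coe os, ← hos', ← Multiset.sum_add, Multiset.filter_add_not,
          Multiset.sum_coe, husum]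
      have h1 := LinearMap.congr_fun (peakChar_forgetSpan h2 hus husum hz hos') w
      rw [LinearMap.comp_apply, hw] at h1
      rw [h1]
      rcases Nat.lt_or_ge j z with hzj | hzj
      · obtain ⟨z, rfl⟩ : ∃ a, z = a + (j + 1) := ⟨z - (j + 1), by omega⟩
        -- For `z > j` the type B character factors through `β^(2(j+1))`. What remains is again a
        -- pullback from the peak algebra, evaluated at `π^(j+1)` of the given element.
        have h3 : piIter k n (j + 1) (forgetSpan k n w) = 0 := by
          rw [hw]
          exact (mem_peakIdeal_iff j _).mp x.2
        rw [piIter_forgetSpan] at h3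
        rw [mul_add, solChar_betaIter hospos _ (by omega),
          ← peakChar_evenCons h2 hospos (fun u hu => (hmem u hu).2) (by omega),
          LinearMap.comp_apply, h3, map_zero]
      · set μ : Nat.Partition (n - 2 * z) := partitionOfList os hospos (by omega) with hμ
        have hμ' : μ ∈ Nat.Partition.odds (n - 2 * z) :=
          Finset.mem_filter.mpr ⟨Finset.mem_univ _, fun u hu => (hmem u (Multiset.mem_coe.mp hu)).2⟩
        set t : T := ⟨⟨z, by omega⟩, ⟨μ, hμ'⟩⟩ with ht
        have h3 := h t
        rw [LinearMap.comp_apply, ← hw] at h3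
        have h4 := LinearMap.congr_fun (peakChar_evenCons h2 (hpos t) (hodd t) (hsum t)) w
        rw [LinearMap.comp_apply, h3] at h4
        rw [h4]
        exact LinearMap.congr_fun
          (solChar_congr hospos hzos (Multiset.coe_toList μ.parts).symm) _
  · rw [LinearMap.comp_apply, hval]
    conv => arg 1; arg 2; rw [← Multiset.coe_toList t.2.1.parts]
    refine signedDist_self_ne_zero h2 _ (hpos t) fun m hm hml => ?_
    refine natCast_ne_zero_of_le hn hm (hml.trans ?_)
    have := length_le_sum (hpos t)
    have := hsum t
    omega
  · rw [LinearMap.comp_apply, hval] at hst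
    obtain ⟨h3, h4, h5⟩ := signedDist_ne_zero (hpos t) hst
    rw [Multiset.length_toList] at h4 h5
    refine ⟨h4, fun he => ?_⟩
    obtain ⟨h6, h7⟩ := h5 he.symm
    rw [Multiset.coe_toList] at h7
    obtain ⟨⟨l, hl⟩, μ⟩ := t
    obtain ⟨⟨l', hl'⟩, μ'⟩ := s
    simp only at h6 h7
    obtain rfl : l' = l := by omega
    congr 1
    exact Subtype.ext (Nat.Partition.ext h7)

end TypeA

end PeakAlgebra

end

/-! ### The main theorem -/

theorem corollary3p4 (k : Type*) [Field k] (n : ℕ)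
    (h2 : (2 : k) ≠ 0) (hn : (n.factorial : k) ≠ 0) :
    -- the spans of the `X_J` and of the `P_F` are the algebras `Sol(B_n)` and `𝔓_n`
    Subalgebra.toSubmodule (PeakAlgebra.solB k n) = PeakAlgebra.descentSpan k n ∧
    Subalgebra.toSubmodule (PeakAlgebra.peakAlg k n) = PeakAlgebra.peakSpan k n ∧
    (∀ i ≤ n,
      Module.finrank k
        (PeakAlgebra.idealJ k n i ⧸
          (PeakAlgebra.rad (PeakAlgebra.solB k n) ⊓ PeakAlgebra.idealJ k n i).submoduleOf
            (PeakAlgebra.idealJ k n i))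
        = ∑ l ∈ Finset.range (i + 1), Fintype.card (Nat.Partition (n - l))) ∧
    (∀ j ≤ n / 2,
      Module.finrank k
        (PeakAlgebra.peakIdeal k n j ⧸
          (PeakAlgebra.rad (PeakAlgebra.peakAlg k n) ⊓ PeakAlgebra.peakIdeal k n j).submoduleOf
            (PeakAlgebra.peakIdeal k n j))
        = ∑ l ∈ Finset.range (j + 1), (Nat.Partition.odds (n - 2 * l)).card) :=
  ⟨PeakAlgebra.solB_toSubmodule, PeakAlgebra.peakAlg_toSubmodule h2,
    fun _ hi => PeakAlgebra.finrank_idealJ_quotient h2 hn hi,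
    fun _ hj => PeakAlgebra.finrank_peakIdeal_quotient h2 hn hj⟩
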